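/- Let $n\ge 2$ be an integer, $\alpha>0$, $a>0$. On $(0,a)\times\mathbb S^{n-2}$ let $\mathbf L^2:=L^2\big((0,a)\times\mathbb S^{n-2},\,x\,dx\,d\theta\big)$ (real-valued functions, $d\theta$ the standard measure on the unit sphere), and define the twisted derivatives $$\mathbf D_x u:=\partial_x u+\frac{\alpha}{x}u,\qquad \mathbf D_x^*u:=-\partial_x u+\frac{\alpha-1}{x}u ,$$ $$\mathbf D_x^{(k)}:=(\mathbf D_x^*\mathbf D_x)^{k/2}\ \text{ for even } k,\qquad \mathbf D_x^{(k)}:=\mathbf D_x(\mathbf D_x^*\mathbf D_x)^{(k-1)/2}\ \text{ for odd } k .$$ Let $D_\theta^j u$ denote the collection of all $j$-fold angular derivatives of $u$, taken along the rotation fields $\theta_p\partial_{\theta_q}-\theta_q\partial_{\theta_p}$ of $\mathbb S^{n-2}\subset\mathbb R^{n-1}$ (which span the tangent space of the sphere at every point). All derivatives are taken in the sense of distributions. Set $\mathbf H^0:=\mathbf L^2$ and $\mathbf H^{m+1}:=\{v\in\mathbf H^m:\ D_\theta v\in\mathbf H^m,\ \mathbf D_x^{(m+1)}v\in\mathbf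 L^2\}$; thus $\mathbf H^m$ consists of the $u\in\mathbf L^2$ with $\mathbf D_x^{(k)}D_\theta^ju\in\mathbf L^2$ whenever $j+k\le m$, and $\|u\|_{\mathbf H^m}$ is the sum of the $\mathbf L^2$ norms of all these derivatives. Let $m>\frac n2$ be an integer, let $l\ge1$, and let $j_1,\dots,j_l,k_1,\dots,k_l$ be nonnegative integers with $$j_1+\cdots+j_l+k_1+\cdots+k_l\le m .$$ Set $$\eta:=\begin{cases}0&\text{if }\alpha>1,\\ \max(\alpha,1-\alpha)&\text{if }\alpha<1,\end{cases}$$ and, if $\alpha=1$, let $\eta$ be any positive number. Then there is a constant $C$, independent of $u_1,\dots,u_l$, such that $$\Big\|x^{(l-1)\eta}\prod_{i=1}^l \mathbf D_x^{(k_i)}D_\theta^{j_i}u_i\Big\|_{\mathbf L^2}\le C\prod_{i=1}^l\|u_i\|_{\mathbf H^m}$$ for all $u_1,\dots,u_l\in\mathbf H^m$ (and for every choice of the components of the angular derivatives). -/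

import Mathlib

open MeasureTheory
open scoped NNReal ENNReal ContDiff

noncomputable section

/-- The Euclidean space `ℝ^{n-1}`, which contains the unit sphere `S^{n-2}`. -/
abbrev Ambient (n : ℕ) : Type := EuclideanSpace ℝ (Fin (n - 1))

/-- The unit sphere `S^{n-2}`. -/
abbrev USphere (n : ℕ) : Type := Metric.sphere (0 : Ambient n) 1

/-- The measure `x dx dθ` on `(0,a) × S^{n-2}`, as a measure on `ℝ × S^{n-2}` that vanishes off
`(0,a) × S^{n-2}`. Here `dθ` is the standard surface measure of the unit sphere. -/
def patchMeasure (n : ℕ) (a : ℝ) : Measure (ℝ × USphere n) :=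
  ((volume.restrict (Set.Ioo (0 : ℝ) a)).withDensity (fun x => ENNReal.ofReal x)).prod
    (volume : Measure (Ambient n)).toSphere

/-- Test functions. The restrictions to `(0,a) × S^{n-2}` of these functions are exactly the smooth
functions with compact support in `(0,a) × S^{n-2}`. -/
structure IsTestFn (n : ℕ) (a : ℝ) (φ : ℝ × Ambient n → ℝ) : Prop where
  smooth : ContDiff ℝ ∞ φ
  compact : HasCompactSupport φ
  supp : tsupport φ ⊆ Set.Ioo (0 : ℝ) a ×ˢ (Set.univ : Set (Ambient n))

/-- Classical twisted derivative `D_x φ = ∂_x φ + (α / x) φ`. -/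
def twD {n : ℕ} (α : ℝ) (φ : ℝ × Ambient n → ℝ) : ℝ × Ambient n → ℝ :=
  fun z => fderiv ℝ φ z (1, 0) + α / z.1 * φ z

/-- Classical adjoint twisted derivative `D_x^* φ = -∂_x φ + ((α - 1) / x) φ`. -/
def twDStar {n : ℕ} (α : ℝ) (φ : ℝ × Ambient n → ℝ) : ℝ × Ambient n → ℝ :=
  fun z => -fderiv ℝ φ z (1, 0) + (α - 1) / z.1 * φ z

/-- Classical derivative along the rotation field `X_{pq} = θ_p ∂_q - θ_q ∂_p`, which is tangent
to the sphere. These fields span the tangent space of the sphere at each of its points. -/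
def rotD {n : ℕ} (pq : Fin (n - 1) × Fin (n - 1)) (φ : ℝ × Ambient n → ℝ) :
    ℝ × Ambient n → ℝ :=
  fun z => fderiv ℝ φ z
    (0, z.2 pq.1 • EuclideanSpace.single pq.2 (1 : ℝ) -
      z.2 pq.2 • EuclideanSpace.single pq.1 (1 : ℝ))

/-- Formal adjoint, with respect to `x dx dθ`, of the ordered twisted derivative
`D_x^{(k)} = (D_x^* D_x)^{k/2}` (`k` even), `D_x^{(k)} = D_x (D_x^* D_x)^{(k-1)/2}` (`k` odd).
For odd `k` the division `k / 2` below is `(k - 1) / 2`. -/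
def twAdj {n : ℕ} (α : ℝ) (k : ℕ) (φ : ℝ × Ambient n → ℝ) : ℝ × Ambient n → ℝ :=
  if Even k then (fun ψ => twDStar α (twD α ψ))^[k / 2] φ
  else (fun ψ => twDStar α (twD α ψ))^[k / 2] (twDStar α φ)

/-- Formal adjoint of the angular derivative `X_{J_1} X_{J_2} ⋯ X_{J_r}`; each rotation field is
skew-adjoint with respect to `dθ`. -/
def rotAdj {n : ℕ} (J : List (Fin (n - 1) × Fin (n - 1))) (φ : ℝ × Ambient n → ℝ) :
    ℝ × Ambient n → ℝ :=
  J.foldl (fun ψ pq => -rotD pq ψ) φ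

/-- `w ∈ L²(x dx dθ)` and `w = D_x^{(k)} X_{J_1} ⋯ X_{J_r} u` in the weak sense on
`(0,a) × S^{n-2}`. -/
def IsWeakDeriv {n : ℕ} (α a : ℝ) (k : ℕ) (J : List (Fin (n - 1) × Fin (n - 1)))
    (u w : ℝ × USphere n → ℝ) : Prop :=
  MemLp w 2 (patchMeasure n a) ∧
    ∀ φ : ℝ × Ambient n → ℝ, IsTestFn n a φ →
      ∫ z, w z * φ (z.1, (z.2 : Ambient n)) ∂(patchMeasure n a) =
        ∫ z, u z * rotAdj J (twAdj α k φ) (z.1, (z.2 : Ambient n)) ∂(patchMeasure n a)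

/-- The twisted Sobolev space `H^m` on `(0,a) × S^{n-2}`: functions in `L²(x dx dθ)` all of whose
weak derivatives `D_x^{(k)} D_θ^j u` with `j + k ≤ m` belong to `L²(x dx dθ)`.
(Equivalent to the recursive definition; see `memTwH_zero` and `memTwH_succ`.) -/
def MemTwH {n : ℕ} (α a : ℝ) (m : ℕ) (u : ℝ × USphere n → ℝ) : Prop :=
  MemLp u 2 (patchMeasure n a) ∧
    ∀ (k : ℕ) (J : List (Fin (n - 1) × Fin (n - 1))), k + J.length ≤ m →
      ∃ w, IsWeakDeriv α a k J u w

open Classical in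
/-- The weak derivative `D_x^{(k)} X_{J_1} ⋯ X_{J_r} u ∈ L²(x dx dθ)`, and `0` if there is none.
It is unique up to null sets by `IsWeakDeriv.ae_eq`. -/
def weakDeriv {n : ℕ} (α a : ℝ) (k : ℕ) (J : List (Fin (n - 1) × Fin (n - 1)))
    (u : ℝ × USphere n → ℝ) : ℝ × USphere n → ℝ :=
  if h : ∃ w, IsWeakDeriv α a k J u w then h.choose else 0

/-- The norm of `H^m`: the sum of the `L²(x dx dθ)` norms of all the derivatives
`D_x^{(k)} X_{J_1} ⋯ X_{J_j} u` with `j + k ≤ m`. -/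
def twNorm {n : ℕ} (α a : ℝ) (m : ℕ) (u : ℝ × USphere n → ℝ) : ℝ≥0∞ :=
  ∑ k ∈ Finset.range (m + 1), ∑ j ∈ Finset.range (m + 1 - k),
    ∑ J : Fin j → Fin (n - 1) × Fin (n - 1),
      eLpNorm (weakDeriv α a k (List.ofFn J) u) 2 (patchMeasure n a)

/-! Well-definedness of the objects above. -/

instance instFinitePatchMeasure (n : ℕ) (a : ℝ) : IsFiniteMeasure (patchMeasure n a) := by
  have : IsFiniteMeasure ((volume.restrict (Set.Ioo (0 : ℝ) a)).withDensity
      (fun x => ENNReal.ofReal x)) := by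
    refine isFiniteMeasure_withDensity (ne_of_lt ?_)
    calc ∫⁻ x in Set.Ioo (0 : ℝ) a, ENNReal.ofReal x
        ≤ ∫⁻ _ in Set.Ioo (0 : ℝ) a, ENNReal.ofReal a := by
          refine setLIntegral_mono measurable_const (fun x hx => ?_)
          exact ENNReal.ofReal_le_ofReal hx.2.le
      _ < ⊤ := by
          simp [ENNReal.mul_lt_top]
  unfold patchMeasure
  infer_instance

theorem ae_patchMeasure_mem (n : ℕ) (a : ℝ) :
    ∀ᵐ z ∂(patchMeasure n a), z.1 ∈ Set.Ioo (0 : ℝ) a := by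
  have h1 : ∀ᵐ x ∂((volume.restrict (Set.Ioo (0 : ℝ) a)).withDensity
      (fun x => ENNReal.ofReal x)), x ∈ Set.Ioo (0 : ℝ) a :=
    (withDensity_absolutelyContinuous _ _).ae_le (ae_restrict_mem measurableSet_Ioo)
  exact (Measure.quasiMeasurePreserving_fst).ae h1

theorem memLp_integrable_mul_test {n : ℕ} {a : ℝ} {w : ℝ × USphere n → ℝ}
    (hw : MemLp w 2 (patchMeasure n a)) {φ : ℝ × Ambient n → ℝ} (hφ : IsTestFn n a φ) :
    Integrable (fun z => w z * φ (z.1, (z.2 : Ambient n))) (patchMeasure n a) := by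
  obtain ⟨C, hC⟩ := hφ.compact.exists_bound_of_continuous hφ.smooth.continuous
  refine (hw.integrable (by norm_num)).mul_bdd (c := C) ?_ ?_
  · have : Continuous (fun z : ℝ × USphere n => φ (z.1, (z.2 : Ambient n))) :=
      hφ.smooth.continuous.comp (by fun_prop)
    exact this.aestronglyMeasurable
  · exact Filter.Eventually.of_forall fun z => hC _

theorem IsWeakDeriv.ae_eq {n : ℕ} {α a : ℝ} {k : ℕ} {J : List (Fin (n - 1) × Fin (n - 1))}
    {u w w' : ℝ × USphere n → ℝ} (h : IsWeakDeriv α a k J u w) (h' : IsWeakDeriv α a k J u w') :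
    w =ᵐ[patchMeasure n a] w' := by
  set ι : ℝ × USphere n → ℝ × Ambient n := fun z => (z.1, (z.2 : Ambient n)) with hι
  have hemb : MeasurableEmbedding ι :=
    MeasurableEmbedding.id.prodMap (MeasurableEmbedding.subtype_coe
      Metric.isClosed_sphere.measurableSet)
  set f : ℝ × Ambient n → ℝ := Function.extend ι (fun z => w z - w' z) 0 with hf
  have hfι : ∀ z, f (ι z) = w z - w' z := fun z => hemb.injective.extend_apply _ _ _
  have hint : Integrable f ((patchMeasure n a).map ι) := by
    rw [hemb.integrable_map_iff]
    have : f ∘ ι = w - w' := by ext z; simp [hfι]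
    rw [this]
    exact (h.1.sub h'.1).integrable (by norm_num)
  have key := (isOpen_Ioo.prod isOpen_univ :
      IsOpen (Set.Ioo (0 : ℝ) a ×ˢ (Set.univ : Set (Ambient n)))
    ).ae_eq_zero_of_integral_contDiff_smul_eq_zero (hint.locallyIntegrable.locallyIntegrableOn _)
    (by
      intro g hg hgc hgs
      have ht : IsTestFn n a g := ⟨hg, hgc, hgs⟩
      rw [hemb.integral_map]
      simp only [hfι, smul_eq_mul]
      have : ∀ z, g (ι z) * (w z - w' z) = w z * g (ι z) - w' z * g (ι z) := fun z => by ring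
      simp only [this]
      rw [integral_sub (memLp_integrable_mul_test h.1 ht) (memLp_integrable_mul_test h'.1 ht)]
      exact sub_eq_zero.2 ((h.2 g ht).trans (h'.2 g ht).symm))
  rw [hemb.ae_map_iff] at key
  filter_upwards [key, ae_patchMeasure_mem n a] with z hz hz'
  have := hz ⟨hz', trivial⟩
  rw [hfι] at this
  linarith

theorem IsTestFn.fderiv_apply {n : ℕ} {a : ℝ} {φ : ℝ × Ambient n → ℝ} (hφ : IsTestFn n a φ)
    {v : ℝ × Ambient n → ℝ × Ambient n} (hv : ContDiff ℝ ∞ v) :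
    IsTestFn n a (fun z => fderiv ℝ φ z (v z)) := by
  have hs : tsupport (fun z => fderiv ℝ φ z (v z)) ⊆ tsupport φ := by
    refine (closure_mono ?_).trans (tsupport_fderiv_subset ℝ (f := φ))
    intro z hz hz'
    exact hz (by simp [hz'])
  refine ⟨?_, hφ.compact.mono' (subset_closure.trans hs), hs.trans hφ.supp⟩
  exact (hφ.smooth.fderiv_right (m := ∞) (by simp)).clm_apply hv

theorem IsTestFn.add {n : ℕ} {a : ℝ} {φ ψ : ℝ × Ambient n → ℝ} (hφ : IsTestFn n a φ)
    (hψ : IsTestFn n a ψ) : IsTestFn n a (fun z => φ z + ψ z) :=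
  ⟨hφ.smooth.add hψ.smooth, hφ.compact.add hψ.compact,
    (tsupport_add φ ψ).trans (Set.union_subset hφ.supp hψ.supp)⟩

theorem IsTestFn.neg {n : ℕ} {a : ℝ} {φ : ℝ × Ambient n → ℝ} (hφ : IsTestFn n a φ) :
    IsTestFn n a (-φ) := by
  have hs : tsupport (-φ) = tsupport φ := by
    simp [tsupport, Function.support_neg]
  exact ⟨hφ.smooth.neg, by rw [HasCompactSupport, hs]; exact hφ.compact, hs ▸ hφ.supp⟩

theorem IsTestFn.div_mul {n : ℕ} {a : ℝ} {φ : ℝ × Ambient n → ℝ} (hφ : IsTestFn n a φ) (c : ℝ) :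
    IsTestFn n a (fun z => c / z.1 * φ z) := by
  have hs : tsupport (fun z => c / z.1 * φ z) ⊆ tsupport φ :=
    tsupport_mul_subset_right (f := fun z : ℝ × Ambient n => c / z.1) (g := φ)
  refine ⟨contDiff_iff_contDiffAt.2 fun z => ?_, hφ.compact.mul_left, hs.trans hφ.supp⟩
  by_cases hz : z ∈ tsupport φ
  · have : z.1 ≠ 0 := (hφ.supp hz).1.1.ne'
    exact (contDiffAt_const.div contDiffAt_fst this).mul hφ.smooth.contDiffAt
  · have h0 : (fun z : ℝ × Ambient n => c / z.1 * φ z) =ᶠ[nhds z] fun _ => 0 := by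
      filter_upwards [(isClosed_tsupport φ).isOpen_compl.mem_nhds hz] with y hy
      simp [image_eq_zero_of_notMem_tsupport hy]
    exact contDiffAt_const.congr_of_eventuallyEq h0

theorem IsTestFn.twD {n : ℕ} {a : ℝ} {φ : ℝ × Ambient n → ℝ} (hφ : IsTestFn n a φ) (α : ℝ) :
    IsTestFn n a (twD α φ) :=
  (hφ.fderiv_apply contDiff_const).add (hφ.div_mul α)

theorem IsTestFn.twDStar {n : ℕ} {a : ℝ} {φ : ℝ × Ambient n → ℝ} (hφ : IsTestFn n a φ) (α : ℝ) :
    IsTestFn n a (twDStar α φ) :=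
  (hφ.fderiv_apply contDiff_const).neg.add (hφ.div_mul (α - 1))

theorem IsTestFn.rotD {n : ℕ} {a : ℝ} {φ : ℝ × Ambient n → ℝ} (hφ : IsTestFn n a φ)
    (pq : Fin (n - 1) × Fin (n - 1)) : IsTestFn n a (rotD pq φ) := by
  refine hφ.fderiv_apply ?_
  fun_prop

theorem IsTestFn.twAdj {n : ℕ} {a : ℝ} {φ : ℝ × Ambient n → ℝ} (hφ : IsTestFn n a φ) (α : ℝ)
    (k : ℕ) : IsTestFn n a (twAdj α k φ) := by
  have h : ∀ (r : ℕ) (ψ : ℝ × Ambient n → ℝ), IsTestFn n a ψ →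
      IsTestFn n a ((fun ψ => _root_.twDStar α (_root_.twD α ψ))^[r] ψ) := by
    intro r
    induction r with
    | zero => exact fun ψ hψ => hψ
    | succ r ih => exact fun ψ hψ => ih _ ((hψ.twD α).twDStar α)
  unfold _root_.twAdj
  split_ifs
  · exact h _ _ hφ
  · exact h _ _ (hφ.twDStar α)

theorem IsTestFn.rotAdj {n : ℕ} {a : ℝ} (J : List (Fin (n - 1) × Fin (n - 1))) :
    ∀ {φ : ℝ × Ambient n → ℝ}, IsTestFn n a φ → IsTestFn n a (rotAdj J φ) := by
  induction J with
  | nil => exact fun hφ => hφ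
  | cons pq J ih => exact fun hφ => ih (hφ.rotD pq).neg

theorem memTwH_zero {n : ℕ} {α a : ℝ} {u : ℝ × USphere n → ℝ} :
    MemTwH α a 0 u ↔ MemLp u 2 (patchMeasure n a) := by
  refine ⟨fun h => h.1, fun h => ⟨h, fun k J hkJ => ?_⟩⟩
  obtain ⟨rfl, hJ⟩ : k = 0 ∧ J.length = 0 := by omega
  rw [List.length_eq_zero_iff] at hJ
  subst hJ
  exact ⟨u, h, fun φ _ => by simp [rotAdj, twAdj]⟩

/-- `H^{m+1}` consists of the `v ∈ H^m` such that `D_θ v ∈ H^m` and `D_x^{(m+1)} v ∈ L²`. -/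
theorem memTwH_succ {n : ℕ} {α a : ℝ} {m : ℕ} {u : ℝ × USphere n → ℝ} :
    MemTwH α a (m + 1) u ↔ MemTwH α a m u ∧
      (∀ pq, ∃ w, IsWeakDeriv α a 0 [pq] u w ∧ MemTwH α a m w) ∧
      ∃ w, IsWeakDeriv α a (m + 1) [] u w := by
  -- the adjoint of `P X_{J_1} ⋯ X_{J_r} X_{pq}` is `-X_{pq}` after the adjoint of the rest
  have hstep : ∀ (pq : Fin (n - 1) × Fin (n - 1)) (w : ℝ × USphere n → ℝ),
      IsWeakDeriv α a 0 [pq] u w → ∀ (k : ℕ) (J : List (Fin (n - 1) × Fin (n - 1))) (v),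
      IsWeakDeriv α a k J w v ↔ IsWeakDeriv α a k (J ++ [pq]) u v := by
    intro pq w hw k J v
    refine and_congr_right fun _ => forall_congr' fun φ => forall_congr' fun hφ => ?_
    have := hw.2 _ (IsTestFn.rotAdj J (hφ.twAdj α k))
    rw [this]
    simp [rotAdj, twAdj, List.foldl_append]
  constructor
  · intro h
    refine ⟨⟨h.1, fun k J hkJ => h.2 k J (by omega)⟩, fun pq => ?_, h.2 _ _ (by simp)⟩
    obtain ⟨w, hw⟩ := h.2 0 [pq] (by simp)
    refine ⟨w, hw, hw.1, fun k J hkJ => ?_⟩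
    obtain ⟨v, hv⟩ := h.2 k (J ++ [pq]) (by simp; omega)
    exact ⟨v, (hstep pq w hw k J v).2 hv⟩
  · rintro ⟨h0, h1, h2⟩
    refine ⟨h0.1, fun k J hkJ => ?_⟩
    rcases Nat.lt_or_ge (k + J.length) (m + 1) with hlt | hge
    · exact h0.2 k J (by omega)
    rcases List.eq_nil_or_concat J with rfl | ⟨L, pq, rfl⟩
    · have : k = m + 1 := by simp at hkJ hge; omega
      exact this ▸ h2
    · obtain ⟨w, hw, hwm⟩ := h1 pq
      obtain ⟨v, hv⟩ := hwm.2 k L (by simp at hkJ; omega)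
      exact ⟨v, by simpa using (hstep pq w hw k L v).1 hv⟩

end

/-! The angular variable is treated by Fourier series and the radial variable by a one-dimensional
weighted bound. The sphere is covered by finitely many patches on which one coordinate, up to sign,
is bounded below. Each patch is mapped into the unit cube of dimension `n - 2` by central projection
(`map_patchChart`). After multiplication by a cutoff, a function on the patch has coefficients
`sphCoef` against the characters of the cube, and these are functions of `x` alone.

Radial part. One twisted derivative of a coefficient is the coefficient of the next twisted
derivative, so with `β = α` or `β = 1 - α` according to parity, `c' + (β / x) c = f` with both `c`
and `f` in `L²(x dx)`. Then `x ^ β * c` is a primitive of `x ^ β * f`, and Cauchy–Schwarz bounds `x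
^ η * c x` almost everywhere (`exists_bound_of_isWeakTwisted`). So one twisted derivative buys
boundedness in `x` with weight `x ^ η`.

Angular part. Multiplication of a coefficient by a frequency is a combination of derivatives along
rotation fields (`IsPatchCutoff.freq_mul_patchTest`). Hence `t` angular derivatives control the sum
over frequencies weighted by the power `2 * t` (`IsPatchCutoff.exists_patchEnergy_le`).

Product. For fixed `x`, the `L²` norm of a product on a patch is bounded by weighted `ℓ²` norms of
the coefficients: if the factors have orders `b i` with sum at most `M`, the weight of exponent `M -
b i` suffices, provided `n - 2 < 2 * M` (`lintegral_prod_patch_le`). The largest frequency absorbs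
the powers of all the others. That leaves one factor in `ℓ²`, while the others are in `ℓ¹` by
Cauchy–Schwarz and summability of the inverse power `2 * M`.

Counting derivatives (`IsPatchCutoff.exists_lintegral_prod_le`). Take `M = m - 1`, so that `n < 2 *
m` is the dimension condition. The factor of highest order is kept in `L²` in `x` and needs no
radial derivative; its order may therefore be lowered by one, which brings the total down to `m -
1`. Every other factor has order at most `m - 1`, so it has one twisted derivative to spare, and it
is bounded in `x` with weight `x ^ η`. There are `l - 1` such factors, which explains the weight `x
^ ((l - 1) * η)`. -/

noncomputable section

open Set Filter Topology

/-! ### Weak derivatives and primitives on an interval -/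

/-- Smooth functions on the line with compact support in `(0, a)`. -/
structure IsTestFn1 (a : ℝ) (φ : ℝ → ℝ) : Prop where
  smooth : ContDiff ℝ ∞ φ
  compact : HasCompactSupport φ
  supp : tsupport φ ⊆ Ioo 0 a

theorem IsTestFn1.exists_Icc {a : ℝ} (ha : 0 < a) {φ : ℝ → ℝ} (hφ : IsTestFn1 a φ) :
    ∃ u v : ℝ, 0 < u ∧ u < a / 2 ∧ a / 2 < v ∧ v < a ∧ tsupport φ ⊆ Ioo u v := by
  -- Adjoining `a / 2` makes the set nonempty even for `φ = 0`, and puts the base point of the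
  -- primitives used later inside `(u, v)`.
  set K : Set ℝ := tsupport φ ∪ {a / 2} with hK
  have hKc : IsCompact K := hφ.compact.isCompact.union isCompact_singleton
  have hKne : K.Nonempty := ⟨a / 2, by simp [hK]⟩
  have hKs : K ⊆ Ioo 0 a :=
    union_subset hφ.supp (by simp only [singleton_subset_iff, mem_Ioo]; constructor <;> linarith)
  have h1 := hKs (hKc.sInf_mem hKne)
  have h2 := hKs (hKc.sSup_mem hKne)
  have hle : ∀ x ∈ K, sInf K ≤ x ∧ x ≤ sSup K := fun x hx =>
    ⟨csInf_le hKc.bddBelow hx, le_csSup hKc.bddAbove hx⟩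
  have hm := hle (a / 2) (by simp [hK])
  refine ⟨sInf K / 2, (sSup K + a) / 2, by linarith [h1.1], by linarith [h1.1], by linarith [h2.2],
    by linarith [h2.2], fun x hx => ?_⟩
  have := hle x (by simp [hK, hx])
  exact ⟨by linarith [h1.1], by linarith [h2.2]⟩

theorem IsTestFn1.deriv {a : ℝ} {φ : ℝ → ℝ} (hφ : IsTestFn1 a φ) : IsTestFn1 a (deriv φ) :=
  ⟨((contDiff_infty_iff_deriv (𝕜 := ℝ)).1 hφ.smooth).2, hφ.compact.deriv,
    (tsupport_deriv_subset).trans hφ.supp⟩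

theorem IsTestFn1.mul_contDiffOn {a : ℝ} {φ : ℝ → ℝ} (hφ : IsTestFn1 a φ) {f : ℝ → ℝ}
    (hf : ∀ x, 0 < x → ContDiffAt ℝ ∞ f x) : IsTestFn1 a (fun x => f x * φ x) := by
  have hs : tsupport (fun x => f x * φ x) ⊆ tsupport φ := tsupport_mul_subset_right
  refine ⟨contDiff_iff_contDiffAt.2 fun x => ?_, hφ.compact.mul_left, hs.trans hφ.supp⟩
  by_cases hx : x ∈ tsupport φ
  · exact (hf x (hφ.supp hx).1).mul hφ.smooth.contDiffAt
  · have h0 : (fun x => f x * φ x) =ᶠ[𝓝 x] fun _ => 0 := by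
      filter_upwards [(isClosed_tsupport φ).isOpen_compl.mem_nhds hx] with y hy
      simp [image_eq_zero_of_notMem_tsupport hy]
    exact contDiffAt_const.congr_of_eventuallyEq h0

theorem IsTestFn1.add {a : ℝ} {φ ψ : ℝ → ℝ} (hφ : IsTestFn1 a φ)
    (hψ : IsTestFn1 a ψ) : IsTestFn1 a (fun z => φ z + ψ z) :=
  ⟨hφ.smooth.add hψ.smooth, hφ.compact.add hψ.compact,
    (tsupport_add φ ψ).trans (union_subset hφ.supp hψ.supp)⟩

theorem IsTestFn1.const_mul {a : ℝ} {φ : ℝ → ℝ} (hφ : IsTestFn1 a φ) (c : ℝ) :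
    IsTestFn1 a (fun z => c * φ z) :=
  hφ.mul_contDiffOn fun _ _ => contDiffAt_const

theorem IsTestFn1.integrable {a : ℝ} {φ : ℝ → ℝ} (hφ : IsTestFn1 a φ) : Integrable φ :=
  hφ.smooth.continuous.integrable_of_hasCompactSupport hφ.compact

theorem exists_testFn1_integral_eq_one {a : ℝ} (ha : 0 < a) :
    ∃ ρ : ℝ → ℝ, IsTestFn1 a ρ ∧ ∫ x, ρ x = 1 := by
  let f : ContDiffBump (a / 2) := ⟨a / 8, a / 4, by positivity, by linarith⟩
  refine ⟨f.normed volume, ⟨f.contDiff_normed, f.hasCompactSupport_normed, ?_⟩, f.integral_normed⟩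
  rw [f.tsupport_normed_eq]
  intro x hx
  simp only [Metric.mem_closedBall, Real.dist_eq, abs_le, f] at hx
  constructor <;> linarith [hx.1, hx.2]

/-- A test function with vanishing integral is the derivative of a test function. -/
theorem IsTestFn1.exists_deriv_eq {a : ℝ} (ha : 0 < a) {φ : ℝ → ℝ} (hφ : IsTestFn1 a φ)
    (h0 : ∫ x, φ x = 0) : ∃ Z, IsTestFn1 a Z ∧ _root_.deriv Z = φ := by
  obtain ⟨u, v, hu, hua, hav, hva, huv⟩ := hφ.exists_Icc ha
  have hder : ∀ x, HasDerivAt (fun x => ∫ t in u..x, φ t) (φ x) x := fun x =>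
    intervalIntegral.integral_hasDerivAt_right (hφ.smooth.continuous.intervalIntegrable _ _)
      (hφ.smooth.continuous.stronglyMeasurableAtFilter _ _) hφ.smooth.continuous.continuousAt
  have hd : _root_.deriv (fun x => ∫ t in u..x, φ t) = φ := funext fun x => (hder x).deriv
  have hzero : ∀ x, x ∉ tsupport φ → φ x = 0 := fun x hx => image_eq_zero_of_notMem_tsupport hx
  have hsupp : tsupport (fun x => ∫ t in u..x, φ t) ⊆ Icc u v := by
    refine closure_minimal ?_ isClosed_Icc
    intro x hx
    by_contra hxn
    apply hx
    rw [mem_Icc, not_and_or, not_le, not_le] at hxn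
    rcases hxn with hxn | hxn
    · refine intervalIntegral.integral_zero_ae (ae_of_all _ fun t ht => ?_)
      rw [uIoc_of_ge hxn.le] at ht
      exact hzero t fun h => absurd (huv h).1 (not_lt.2 ht.2)
    · change ∫ t in u..x, φ t = 0
      rw [intervalIntegral.integral_eq_integral_of_support_subset, h0]
      intro t ht
      have := huv (subset_tsupport _ ht)
      exact ⟨this.1, (this.2.trans hxn).le⟩
  refine ⟨_, ⟨?_, ?_, ?_⟩, hd⟩
  · rw [contDiff_infty_iff_deriv, hd]
    exact ⟨fun x => (hder x).differentiableAt, hφ.smooth⟩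
  · exact HasCompactSupport.of_support_subset_isCompact isCompact_Icc
      ((subset_tsupport _).trans hsupp)
  · exact hsupp.trans fun x hx => ⟨hu.trans_le hx.1, hx.2.trans_lt hva⟩

theorem locallyIntegrableOn_integrable_mul_test {a : ℝ} {g : ℝ → ℝ}
    (hg : LocallyIntegrableOn g (Ioo 0 a)) {φ : ℝ → ℝ} (hφ : IsTestFn1 a φ) :
    Integrable (fun x => g x * φ x) := by
  have h1 : IntegrableOn (fun x => g x * φ x) (tsupport φ) := by
    refine ((hg.integrableOn_compact_subset hφ.supp hφ.compact).mul_continuousOn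
      hφ.smooth.continuous.continuousOn hφ.compact)
  refine (integrableOn_iff_integrable_of_support_subset ?_).1 h1
  exact (Function.support_mul_subset_right _ _).trans (subset_tsupport _)

/-- The du Bois-Reymond lemma on an interval: a function with vanishing weak derivative is
constant. -/
theorem exists_ae_eq_const_of_integral_mul_deriv_eq_zero {a : ℝ} (ha : 0 < a) {g : ℝ → ℝ}
    (hg : LocallyIntegrableOn g (Ioo 0 a))
    (h : ∀ ζ, IsTestFn1 a ζ → ∫ x, g x * deriv ζ x = 0) :
    ∃ K : ℝ, ∀ᵐ x, x ∈ Ioo 0 a → g x = K := by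
  obtain ⟨ρ, hρ, hρ1⟩ := exists_testFn1_integral_eq_one ha
  -- The function `ζ - (∫ ζ) ρ` has integral zero, hence is the derivative of a test function.
  -- Testing with it gives `∫ g ζ = (∫ g ρ) (∫ ζ)`, which identifies the constant.
  refine ⟨∫ x, g x * ρ x, ?_⟩
  have key := isOpen_Ioo.ae_eq_zero_of_integral_contDiff_smul_eq_zero (μ := volume)
    (f := fun x => g x - ∫ x, g x * ρ x) (U := Ioo 0 a)
    (hg.sub ((locallyIntegrable_const _).locallyIntegrableOn _)) (by
      intro ζ h1 h2 h3
      have hζ : IsTestFn1 a ζ := ⟨h1, h2, h3⟩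
      have hdiff : IsTestFn1 a (fun x => ζ x + (-∫ y, ζ y) * ρ x) := hζ.add (hρ.const_mul _)
      obtain ⟨Z, hZ, hZd⟩ := hdiff.exists_deriv_eq ha (by
        rw [integral_add hζ.integrable (hρ.integrable.const_mul _), integral_const_mul, hρ1]; ring)
      have e := h Z hZ
      rw [hZd] at e
      have e1 : ∀ x, g x * (ζ x + (-∫ y, ζ y) * ρ x) = g x * ζ x + (-∫ y, ζ y) * (g x * ρ x) :=
        fun x => by ring
      simp only [e1] at e
      rw [integral_add (locallyIntegrableOn_integrable_mul_test hg hζ)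
        ((locallyIntegrableOn_integrable_mul_test hg hρ).const_mul _), integral_const_mul] at e
      have e2 : ∀ x, ζ x • (g x - ∫ x, g x * ρ x) = g x * ζ x - ζ x * (∫ x, g x * ρ x) :=
        fun x => by simp only [smul_eq_mul]; ring
      simp only [e2]
      rw [integral_sub (locallyIntegrableOn_integrable_mul_test hg hζ) (hζ.integrable.mul_const _),
        integral_mul_const]
      linarith)
  filter_upwards [key] with x hx hxa
  linarith [hx hxa]

theorem locallyIntegrableOn_intervalIntegrable_Ioo {a : ℝ} {G : ℝ → ℝ}
    (hG : LocallyIntegrableOn G (Ioo 0 a)) {u v : ℝ} (hu : u ∈ Ioo 0 a) (hv : v ∈ Ioo 0 a) :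
    IntervalIntegrable G volume u v := by
  refine (hG.integrableOn_compact_subset (t := uIcc u v) ?_ isCompact_uIcc).intervalIntegrable
  exact (convex_Ioo 0 a).ordConnected.uIcc_subset hu hv

/-- A locally integrable function with a locally integrable weak derivative is a.e. equal to a
primitive of that derivative. -/
theorem exists_ae_eq_primitive {a : ℝ} (ha : 0 < a) {g G : ℝ → ℝ}
    (hg : LocallyIntegrableOn g (Ioo 0 a)) (hG : LocallyIntegrableOn G (Ioo 0 a))
    (h : ∀ ζ, IsTestFn1 a ζ → ∫ x, g x * deriv ζ x = -∫ x, G x * ζ x) :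
    ∃ K : ℝ, ∀ᵐ x, x ∈ Ioo 0 a → g x = K + ∫ t in (a / 2)..x, G t := by
  set P : ℝ → ℝ := fun x => ∫ t in (a / 2)..x, G t with hP
  have ha2 : a / 2 ∈ Ioo 0 a := ⟨by linarith, by linarith⟩
  have hAC : ∀ u v, u ∈ Ioo 0 a → v ∈ Ioo 0 a → u ≤ a / 2 → a / 2 ≤ v →
      AbsolutelyContinuousOnInterval P u v := fun u v hu hv h1 h2 =>
    (locallyIntegrableOn_intervalIntegrable_Ioo hG hu
      hv).absolutelyContinuousOnInterval_intervalIntegral (by rw [uIcc_of_le (h1.trans h2)]; exact ⟨h1, h2⟩)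
  have hPc : ContinuousOn P (Ioo 0 a) := by
    intro x hx
    have hu : min x (a / 2) / 2 ∈ Ioo 0 a := by
      have := lt_min hx.1 ha2.1
      have := min_le_left x (a / 2)
      exact ⟨by linarith, by linarith [hx.2]⟩
    have hv : (max x (a / 2) + a) / 2 ∈ Ioo 0 a := by
      have := max_lt hx.2 ha2.2
      have := le_max_left x (a / 2)
      exact ⟨by linarith [hx.1], by linarith⟩
    have h1 : min x (a / 2) / 2 < x := by
      have := lt_min hx.1 ha2.1
      have := min_le_left x (a / 2)
      linarith
    have h1' : min x (a / 2) / 2 < a / 2 := by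
      have := lt_min hx.1 ha2.1
      have := min_le_right x (a / 2)
      linarith
    have h2 : x < (max x (a / 2) + a) / 2 := by
      have := le_max_left x (a / 2)
      linarith [hx.2]
    have h2' : a / 2 < (max x (a / 2) + a) / 2 := by
      have := le_max_right x (a / 2)
      linarith [hx.2]
    have := (hAC _ _ hu hv h1'.le h2'.le).continuousOn
    rw [uIcc_of_le (h1.trans h2).le] at this
    exact (this.continuousAt (Icc_mem_nhds h1 h2)).continuousWithinAt
  have hPl : LocallyIntegrableOn P (Ioo 0 a) := hPc.locallyIntegrableOn measurableSet_Ioo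
  -- `P` is absolutely continuous on compact subintervals, so integration by parts shows that its
  -- weak derivative is also `G`. Then `g - P` has vanishing weak derivative.
  have hIBP : ∀ ζ, IsTestFn1 a ζ → ∫ x, P x * deriv ζ x = -∫ x, G x * ζ x := by
    intro ζ hζ
    obtain ⟨u, v, hu, hua, hav, hva, huv⟩ := hζ.exists_Icc ha
    have hu' : u ∈ Ioo 0 a := ⟨hu, by linarith⟩
    have hv' : v ∈ Ioo 0 a := ⟨by linarith, hva⟩
    have hz : ∀ x, x ∉ Ioo u v → ζ x = 0 := fun x hx =>
      image_eq_zero_of_notMem_tsupport fun hh => hx (huv hh)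
    have hz' : ∀ x, x ∉ Ioo u v → deriv ζ x = 0 := fun x hx =>
      image_eq_zero_of_notMem_tsupport fun hh => hx (huv (tsupport_deriv_subset hh))
    have e := (hAC u v hu' hv' hua.le hav.le).integral_mul_deriv_eq_deriv_mul
      (g := ζ) ((hζ.smooth.of_le (by simp)).contDiffOn.absolutelyContinuousOnInterval)
    have sub : ∀ f : ℝ → ℝ, (∀ x, x ∉ Ioo u v → f x = 0) → Function.support f ⊆ Ioc u v := by
      intro f hf x hx
      by_contra hn
      exact hx (hf x fun hh => hn ⟨hh.1, hh.2.le⟩)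
    rw [← intervalIntegral.integral_eq_integral_of_support_subset (a := u) (b := v)
        (sub (fun x => P x * deriv ζ x) fun x hx => by simp [hz' x hx]),
      ← intervalIntegral.integral_eq_integral_of_support_subset (a := u) (b := v)
        (sub (fun x => G x * ζ x) fun x hx => by simp [hz x hx]), e, hz u (by simp), hz v (by simp)]
    simp only [mul_zero, sub_zero, zero_sub, neg_inj]
    refine intervalIntegral.integral_congr_ae ?_
    filter_upwards [(locallyIntegrableOn_intervalIntegrable_Ioo hG hu' hv').ae_hasDerivAt_integral]
      with x hx hxm
    rw [(hx (uIoc_subset_uIcc hxm) (a / 2)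
      (by rw [uIcc_of_le (by linarith)]; exact ⟨hua.le, hav.le⟩)).deriv]
  obtain ⟨K, hK⟩ := exists_ae_eq_const_of_integral_mul_deriv_eq_zero ha (hg.sub hPl) (by
    intro ζ hζ
    simp only [Pi.sub_apply, sub_mul]
    rw [integral_sub (locallyIntegrableOn_integrable_mul_test hg hζ.deriv)
      (locallyIntegrableOn_integrable_mul_test hPl hζ.deriv), h ζ hζ, hIBP ζ hζ, sub_self])
  refine ⟨K, ?_⟩
  filter_upwards [hK] with x hx hxa
  have := hx hxa
  simp only [Pi.sub_apply] at this
  linarith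

/-! ### Weighted pointwise bounds in one radial variable -/

theorem sq_lintegral_mul_le {X : Type*} [MeasurableSpace X] {μ : Measure X} {f g : X → ℝ≥0∞}
    (hf : AEMeasurable f μ) (hg : AEMeasurable g μ) :
    (∫⁻ x, f x * g x ∂μ) ^ 2 ≤ (∫⁻ x, f x ^ 2 ∂μ) * ∫⁻ x, g x ^ 2 ∂μ := by
  have h := ENNReal.lintegral_mul_le_Lp_mul_Lq μ Real.HolderConjugate.two_two hf hg
  have e : ∀ z : ℝ≥0∞, (z ^ (1 / (2 : ℝ))) ^ 2 = z := fun z => by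
    rw [← ENNReal.rpow_natCast, ← ENNReal.rpow_mul]; norm_num
  calc (∫⁻ x, f x * g x ∂μ) ^ 2 ≤ _ := pow_le_pow_left' h 2
    _ = _ := by rw [mul_pow, e, e]; simp only [ENNReal.rpow_two]

theorem eLpNorm_two_sq {X E : Type*} [MeasurableSpace X] [NormedAddCommGroup E] {μ : Measure X}
    (f : X → E) : eLpNorm f 2 μ ^ 2 = ∫⁻ x, ‖f x‖ₑ ^ 2 ∂μ := by
  rw [eLpNorm_eq_lintegral_rpow_enorm_toReal (by norm_num) (by norm_num), ← ENNReal.rpow_natCast,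
    ← ENNReal.rpow_mul]
  norm_num

theorem add_sq_le_two_mul (x y : ℝ≥0∞) : (x + y) ^ 2 ≤ 2 * (x ^ 2 + y ^ 2) := by
  have := ENNReal.rpow_add_le_mul_rpow_add_rpow x y (p := 2) (by norm_num)
  norm_num at this
  exact this

/-- The measure `x dx` on `(0, a)`. -/
abbrev radialMeasure (a : ℝ) : Measure ℝ :=
  (volume.restrict (Ioo (0 : ℝ) a)).withDensity (fun x => ENNReal.ofReal x)

instance (a : ℝ) : IsFiniteMeasure (radialMeasure a) := by
  refine isFiniteMeasure_withDensity (ne_of_lt ?_)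
  calc ∫⁻ x in Ioo (0 : ℝ) a, ENNReal.ofReal x
      ≤ ∫⁻ _ in Ioo (0 : ℝ) a, ENNReal.ofReal a :=
        setLIntegral_mono measurable_const fun x hx => ENNReal.ofReal_le_ofReal hx.2.le
    _ < ⊤ := by simp [ENNReal.mul_lt_top]

theorem ae_radialMeasure_iff {a : ℝ} {p : ℝ → Prop} :
    (∀ᵐ x ∂(radialMeasure a), p x) ↔ ∀ᵐ x, x ∈ Ioo 0 a → p x := by
  rw [ae_withDensity_iff (by fun_prop), ae_restrict_iff' measurableSet_Ioo]
  refine ⟨fun h => ?_, fun h => ?_⟩ <;> filter_upwards [h] with x hx hxa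
  · exact hx hxa (by simpa using hxa.1)
  · exact fun _ => hx hxa

theorem integral_radialMeasure {a : ℝ} {E : Type*} [NormedAddCommGroup E] [NormedSpace ℝ E]
    (f : ℝ → E) : ∫ x, f x ∂(radialMeasure a) = ∫ x in Ioo 0 a, x • f x := by
  rw [integral_withDensity_eq_integral_toReal_smul (by fun_prop) (by simp)]
  exact setIntegral_congr_fun measurableSet_Ioo fun x hx => by
    simp only [ENNReal.toReal_ofReal hx.1.le]

theorem lintegral_radialMeasure {a : ℝ} (f : ℝ → ℝ≥0∞) :
    ∫⁻ x, f x ∂(radialMeasure a) = ∫⁻ x in Ioo 0 a, ENNReal.ofReal x * f x := by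
  rw [lintegral_withDensity_eq_lintegral_mul_non_measurable _ (by fun_prop) (by simp)]
  rfl

theorem integrable_radialMeasure_iff {a : ℝ} {f : ℝ → ℝ} :
    Integrable f (radialMeasure a) ↔ IntegrableOn (fun x => x * f x) (Ioo 0 a) := by
  rw [integrable_withDensity_iff_integrable_smul' (by fun_prop) (by simp)]
  exact integrableOn_congr_fun (fun x hx => by simp [ENNReal.toReal_ofReal hx.1.le])
    measurableSet_Ioo

theorem contDiffAt_rpow_const_of_pos {β x : ℝ} (hx : 0 < x) :
    ContDiffAt ℝ ∞ (fun t : ℝ => t ^ β) x :=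
  contDiffAt_id.rpow_const_of_ne hx.ne'

theorem locallyIntegrableOn_rpow_mul {a : ℝ} {c : ℝ → ℝ} (hc : Integrable c (radialMeasure a))
    (β : ℝ) : LocallyIntegrableOn (fun x => x ^ β * c x) (Ioo 0 a) := by
  have h1 : LocallyIntegrableOn (fun x => x * c x) (Ioo 0 a) :=
    (integrable_radialMeasure_iff.1 hc).locallyIntegrableOn
  have h2 : ContinuousOn (fun x : ℝ => x ^ (β - 1)) (Ioo 0 a) := fun x hx =>
    (contDiffAt_rpow_const_of_pos hx.1).continuousAt.continuousWithinAt
  have h3 := h1.continuousOn_mul h2 isOpen_Ioo.isLocallyClosed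
  intro x hx
  obtain ⟨s, hs, hi⟩ := h3 x hx
  refine ⟨s ∩ Ioo 0 a, inter_mem hs self_mem_nhdsWithin, ?_⟩
  have hI := hi.mono_set (inter_subset_left (t := Ioo 0 a))
  refine hI.congr ?_
  have : ∀ᵐ x ∂(volume.restrict (s ∩ Ioo 0 a)), x ∈ Ioo 0 a :=
    ae_mono (Measure.restrict_mono inter_subset_right le_rfl) (ae_restrict_mem measurableSet_Ioo)
  filter_upwards [this] with t ht
  rw [← mul_assoc, ← Real.rpow_add_one ht.1.ne']
  simp

/-- Weak form of `c' + (β / x) c = f` with respect to the measure `x dx` on `(0, a)`. -/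
def IsWeakTwisted (a β : ℝ) (c f : ℝ → ℝ) : Prop :=
  ∀ φ, IsTestFn1 a φ → ∫ x, φ x * f x ∂(radialMeasure a) =
    ∫ x, (-deriv φ x + (β - 1) / x * φ x) * c x ∂(radialMeasure a)

/-- `x ^ β` is an integrating factor: `x ^ β (c' + (β / x) c) = (x ^ β c)'`. -/
theorem IsWeakTwisted.exists_primitive {a β : ℝ} (ha : 0 < a) {c f : ℝ → ℝ}
    (hc : Integrable c (radialMeasure a)) (hf : Integrable f (radialMeasure a))
    (h : IsWeakTwisted a β c f) :
    ∃ K : ℝ, ∀ᵐ x, x ∈ Ioo 0 a → x ^ β * c x = K + ∫ t in (a / 2)..x, t ^ β * f t := by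
  refine exists_ae_eq_primitive ha (locallyIntegrableOn_rpow_mul hc β)
    (locallyIntegrableOn_rpow_mul hf β) fun ζ hζ => ?_
  -- The exponent is `β - 1` because the measure `x dx` supplies the remaining power of `x`.
  have hφ : IsTestFn1 a (fun x => x ^ (β - 1) * ζ x) :=
    hζ.mul_contDiffOn fun x hx => contDiffAt_rpow_const_of_pos hx
  have e := h _ hφ
  rw [integral_radialMeasure, integral_radialMeasure] at e
  have hz : ∀ x, x ∉ Ioo 0 a → ζ x = 0 := fun x hx =>
    image_eq_zero_of_notMem_tsupport fun hh => hx (hζ.supp hh)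
  have hz' : ∀ x, x ∉ Ioo 0 a → deriv ζ x = 0 := fun x hx =>
    image_eq_zero_of_notMem_tsupport fun hh => hx (hζ.deriv.supp (by
      have := hζ.supp (tsupport_deriv_subset hh); exact absurd this hx))
  rw [← setIntegral_eq_integral_of_forall_compl_eq_zero (s := Ioo 0 a)
      (f := fun x => x ^ β * c x * deriv ζ x) fun x hx => by simp [hz' x hx],
    ← setIntegral_eq_integral_of_forall_compl_eq_zero (s := Ioo 0 a)
      (f := fun x => x ^ β * f x * ζ x) fun x hx => by simp [hz x hx]]
  have e1 : ∫ x in Ioo 0 a, x ^ β * f x * ζ x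
      = ∫ x in Ioo 0 a, x • (x ^ (β - 1) * ζ x * f x) := by
    refine setIntegral_congr_fun measurableSet_Ioo fun x hx => ?_
    have : x ^ β = x * x ^ (β - 1) := by
      rw [mul_comm, ← Real.rpow_add_one hx.1.ne']; simp
    simp only [this, smul_eq_mul]; ring
  rw [e1, e, ← integral_neg]
  refine setIntegral_congr_fun measurableSet_Ioo fun x hx => ?_
  have hd : deriv (fun x => x ^ (β - 1) * ζ x) x
      = (β - 1) * x ^ (β - 1 - 1) * ζ x + x ^ (β - 1) * deriv ζ x := by
    have h1 := Real.hasDerivAt_rpow_const (p := β - 1) (Or.inl hx.1.ne')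
    have h2 := (hζ.smooth.differentiable (by simp) x).hasDerivAt
    exact (h1.mul h2).deriv
  have e2 : x ^ β = x * x ^ (β - 1) := by
    rw [mul_comm, ← Real.rpow_add_one hx.1.ne']; simp
  have e3 : x ^ (β - 1) = x * x ^ (β - 1 - 1) := by
    rw [mul_comm, ← Real.rpow_add_one hx.1.ne']; simp
  simp only [hd, smul_eq_mul]
  rw [e2, e3]
  have := hx.1.ne'
  field_simp
  ring

/-- The primitive is subtracted at two points. Stating this on one conull set leaves the base point
`y` free to be chosen afterwards, depending on `c` and, near `0`, on `x`. -/
theorem IsWeakTwisted.enorm_le {a β : ℝ} (ha : 0 < a) {c f : ℝ → ℝ}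
    (hc : Integrable c (radialMeasure a)) (hf : Integrable f (radialMeasure a))
    (h : IsWeakTwisted a β c f) :
    ∃ s : Set ℝ, s ∈ ae volume ∧ ∀ x ∈ s, ∀ y ∈ s, x ∈ Ioo 0 a → y ∈ Ioo 0 a →
      ‖x ^ β * c x‖ₑ ≤ ‖y ^ β * c y‖ₑ + ∫⁻ t in uIoc y x, ‖t ^ β * f t‖ₑ := by
  obtain ⟨K, hK⟩ := h.exists_primitive ha hc hf
  refine ⟨_, hK, fun x hx y hy hxa hya => ?_⟩
  have ex := hx hxa
  have ey := hy hya
  have ha2 : a / 2 ∈ Ioo 0 a := ⟨by linarith, by linarith⟩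
  have hG := locallyIntegrableOn_rpow_mul hf β
  have e : x ^ β * c x = y ^ β * c y + ∫ t in y..x, t ^ β * f t := by
    rw [ex, ey, add_assoc, intervalIntegral.integral_add_adjacent_intervals
      (locallyIntegrableOn_intervalIntegrable_Ioo hG ha2 hya)
      (locallyIntegrableOn_intervalIntegrable_Ioo hG hya hxa)]
  rw [e]
  refine (enorm_add_le _ _).trans (by
    gcongr
    rw [← enorm_norm, intervalIntegral.norm_intervalIntegral_eq, enorm_norm]
    exact enorm_integral_le_lintegral_enorm _)

theorem volume_restrict_absolutelyContinuous_radialMeasure {a : ℝ} {A : Set ℝ} (hAa : A ⊆ Ioo 0 a) :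
    volume.restrict A ≪ radialMeasure a := by
  refine (Measure.restrict_mono hAa le_rfl).absolutelyContinuous.trans ?_
  refine withDensity_absolutelyContinuous' (by fun_prop) ?_
  filter_upwards [ae_restrict_mem measurableSet_Ioo] with x hx
  simpa using hx.1

/-- Cauchy–Schwarz for `t ^ γ f = t ^ (γ - 1/2) · (t ^ (1/2) f)`; the square of the second factor is
the density of `f ^ 2` for `t dt`. -/
theorem sq_setLIntegral_rpow_mul_le {a : ℝ} {f : ℝ → ℝ}
    (hf : AEStronglyMeasurable f (radialMeasure a)) (γ : ℝ) {A : Set ℝ} (hA : MeasurableSet A)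
    (hAa : A ⊆ Ioo 0 a) :
    (∫⁻ t in A, ‖t ^ γ * f t‖ₑ) ^ 2 ≤
      (∫⁻ t in A, ENNReal.ofReal (t ^ (2 * γ - 1))) * ∫⁻ t, ‖f t‖ₑ ^ 2 ∂(radialMeasure a) := by
  have hac := volume_restrict_absolutelyContinuous_radialMeasure hAa
  have hfm : AEStronglyMeasurable f (volume.restrict A) := hf.mono_ac hac
  have e1 : ∫⁻ t in A, ‖t ^ γ * f t‖ₑ =
      ∫⁻ t in A, ENNReal.ofReal (t ^ (γ - 1 / 2)) * (ENNReal.ofReal (t ^ (1 / 2 : ℝ)) * ‖f t‖ₑ) := by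
    refine setLIntegral_congr_fun hA fun t ht => ?_
    have h0 := (hAa ht).1
    rw [← mul_assoc, ← ENNReal.ofReal_mul (by positivity), ← Real.rpow_add h0, enorm_mul,
      Real.enorm_of_nonneg (by positivity)]
    norm_num
  rw [e1]
  refine (sq_lintegral_mul_le (by fun_prop) ?_).trans ?_
  · exact AEMeasurable.mul (by fun_prop) hfm.enorm
  · gcongr ?_ * ?_
    · refine le_of_eq (setLIntegral_congr_fun hA fun t ht => ?_)
      have h0 := (hAa ht).1
      rw [← ENNReal.ofReal_pow (by positivity), ← Real.rpow_mul_natCast h0.le]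
      congr 2
      push_cast; ring
    · rw [lintegral_radialMeasure]
      refine le_trans (le_of_eq ?_) (lintegral_mono_set hAa)
      refine setLIntegral_congr_fun hA fun t ht => ?_
      have h0 := (hAa ht).1
      simp only [mul_pow]
      rw [← ENNReal.ofReal_pow (by positivity), ← Real.rpow_mul_natCast h0.le]
      norm_num

/-- Averaging over `(a / 2, a)`: the interval has length `a / 2` and the weight `x` is at least `a /
2` there, whence the constant `a ^ 2 / 4`. -/
theorem exists_small_value {a : ℝ} (ha : 0 < a) {c : ℝ → ℝ}
    (hc : AEStronglyMeasurable c (radialMeasure a)) {s : Set ℝ} (hs : s ∈ ae volume) :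
    ∃ y ∈ s, y ∈ Ioo (a / 2) a ∧
      ENNReal.ofReal (a ^ 2 / 4) * ‖c y‖ₑ ^ 2 ≤ ∫⁻ t, ‖c t‖ₑ ^ 2 ∂(radialMeasure a) := by
  by_contra hcon
  push Not at hcon
  have hlt : ∀ᵐ y ∂(volume.restrict (Ioo (a / 2) a)),
      ∫⁻ t, ‖c t‖ₑ ^ 2 ∂(radialMeasure a) < ENNReal.ofReal (a ^ 2 / 4) * ‖c y‖ₑ ^ 2 := by
    rw [ae_restrict_iff' measurableSet_Ioo]
    filter_upwards [hs] with y hy hya using hcon y hy hya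
  have hfin : ∫⁻ t, ‖c t‖ₑ ^ 2 ∂(radialMeasure a) ≠ ⊤ := by
    intro htop
    have : ∃ y ∈ s, y ∈ Ioo (a / 2) a := by
      have : (0 : ℝ≥0∞) < volume (s ∩ Ioo (a / 2) a) := by
        rw [inter_comm, measure_inter_conull (mem_ae_iff.1 hs)]
        simpa using ha
      obtain ⟨y, hy⟩ := nonempty_of_measure_ne_zero this.ne'
      exact ⟨y, hy.1, hy.2⟩
    obtain ⟨y, hy, hya⟩ := this
    have := hcon y hy hya
    rw [htop] at this
    exact absurd this (by simp)
  have h2 : ∫⁻ y in Ioo (a / 2) a, ∫⁻ t, ‖c t‖ₑ ^ 2 ∂(radialMeasure a) <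
      ∫⁻ y in Ioo (a / 2) a, ENNReal.ofReal (a ^ 2 / 4) * ‖c y‖ₑ ^ 2 := by
    refine lintegral_strict_mono (by simp [ha]) ?_ ?_ hlt
    · have hac := volume_restrict_absolutelyContinuous_radialMeasure (a := a) (A := Ioo (a / 2) a)
        (Ioo_subset_Ioo_left (by linarith))
      exact ((hc.mono_ac hac).enorm.pow_const 2).const_mul _
    · simp only [lintegral_const]
      exact ENNReal.mul_ne_top hfin (by simp)
  have h3 : ∫⁻ y in Ioo (a / 2) a, ENNReal.ofReal (a ^ 2 / 4) * ‖c y‖ₑ ^ 2 ≤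
      ENNReal.ofReal (a / 2) * ∫⁻ t, ‖c t‖ₑ ^ 2 ∂(radialMeasure a) := by
    rw [lintegral_radialMeasure, ← lintegral_const_mul' _ _ (by simp)]
    refine le_trans (setLIntegral_mono' measurableSet_Ioo fun y hy => ?_)
      (lintegral_mono_set (Ioo_subset_Ioo_left (by linarith)))
    rw [← mul_assoc, ← ENNReal.ofReal_mul (by linarith)]
    gcongr
    nlinarith [hy.1]
  rw [lintegral_const] at h2
  simp only [MeasurableSet.univ, Measure.restrict_apply, univ_inter, Real.volume_Ioo] at h2
  have h4 := h2.trans_le h3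
  rw [mul_comm, show a - a / 2 = a / 2 by ring] at h4
  exact lt_irrefl _ h4

theorem enorm_rpow_mul {x : ℝ} (hx : 0 < x) (β c : ℝ) :
    ‖x ^ β * c‖ₑ = ENNReal.ofReal (x ^ β) * ‖c‖ₑ := by
  rw [enorm_mul, Real.enorm_of_nonneg (by positivity)]

theorem enorm_rpow_mul_eq {x : ℝ} (hx : 0 < x) (β η c : ℝ) :
    ‖x ^ η * c‖ₑ = ENNReal.ofReal (x ^ (η - β)) * ‖x ^ β * c‖ₑ := by
  rw [enorm_rpow_mul hx, enorm_rpow_mul hx, ← mul_assoc, ← ENNReal.ofReal_mul (by positivity),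
    ← Real.rpow_add hx]
  simp

theorem lintegral_Ioo_rpow_lt_top {γ a : ℝ} (ha : 0 < a) (hγ : -1 < γ) :
    ∫⁻ t in Ioo 0 a, ENNReal.ofReal (t ^ γ) < ⊤ := by
  have h := (intervalIntegral.integrableOn_Ioo_rpow_iff ha).2 hγ
  exact h.lintegral_lt_top

/-- Since `y > a / 2`, every `t` between `x` and `y` satisfies `x ≤ 2 t`. So `x ^ (η - β) t ^ β ≤ 2
^ (η - β) t ^ η`, and Cauchy–Schwarz costs `∫ t ^ (2 η - 1)` over `(0, a)`, which converges because
`η > 0`. -/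
theorem sq_mul_setLIntegral_uIoc_le_of_pos {a β η : ℝ} (ha : 0 < a) (hη : 0 < η) (hβ : β ≤ η) :
    ∃ D : ℝ≥0, ∀ f : ℝ → ℝ, AEStronglyMeasurable f (radialMeasure a) → ∀ x ∈ Ioo 0 a,
      ∀ y ∈ Ioo (a / 2) a, (ENNReal.ofReal (x ^ (η - β)) * ∫⁻ t in uIoc y x, ‖t ^ β * f t‖ₑ) ^ 2 ≤
        D * ∫⁻ t, ‖f t‖ₑ ^ 2 ∂(radialMeasure a) := by
  have hI := lintegral_Ioo_rpow_lt_top (γ := 2 * η - 1) ha (by linarith)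
  refine ⟨(ENNReal.ofReal (2 ^ (η - β)) ^ 2 *
    ∫⁻ t in Ioo 0 a, ENNReal.ofReal (t ^ (2 * η - 1))).toNNReal, fun f hf x hx y hy => ?_⟩
  rw [ENNReal.coe_toNNReal (ENNReal.mul_ne_top (by simp) hI.ne)]
  have hsub : uIoc y x ⊆ Ioo 0 a := fun t ht => by
    rw [uIoc, mem_Ioc] at ht
    exact ⟨(lt_min (by linarith [hy.1]) hx.1).trans ht.1, ht.2.trans_lt (max_lt hy.2 hx.2)⟩
  have h1 : ENNReal.ofReal (x ^ (η - β)) * ∫⁻ t in uIoc y x, ‖t ^ β * f t‖ₑ ≤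
      ENNReal.ofReal (2 ^ (η - β)) * ∫⁻ t in Ioo 0 a, ‖t ^ η * f t‖ₑ := by
    rw [← lintegral_const_mul' _ _ (by simp), ← lintegral_const_mul' _ _ (by simp)]
    refine (setLIntegral_mono' measurableSet_uIoc fun t ht => ?_).trans (lintegral_mono_set hsub)
    have ht0 := (hsub ht).1
    have htx : x ≤ 2 * t := by
      rw [uIoc, mem_Ioc] at ht
      have : x / 2 ≤ min y x := le_min (by linarith [hx.2, hy.1]) (by linarith [hx.1])
      linarith [ht.1]
    rw [enorm_rpow_mul ht0, enorm_rpow_mul ht0, ← mul_assoc, ← mul_assoc,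
      ← ENNReal.ofReal_mul (by have := hx.1; positivity), ← ENNReal.ofReal_mul (by positivity)]
    gcongr ENNReal.ofReal ?_ * _
    calc x ^ (η - β) * t ^ β ≤ (2 * t) ^ (η - β) * t ^ β := by
          gcongr
          exact hx.1.le
      _ = 2 ^ (η - β) * t ^ η := by
          rw [Real.mul_rpow (by norm_num) ht0.le, mul_assoc, ← Real.rpow_add ht0]; simp
  calc _ ≤ (ENNReal.ofReal (2 ^ (η - β)) * ∫⁻ t in Ioo 0 a, ‖t ^ η * f t‖ₑ) ^ 2 := by gcongr
    _ ≤ _ := by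
      rw [mul_pow, mul_assoc]
      gcongr
      exact sq_setLIntegral_rpow_mul_le hf η measurableSet_Ioo subset_rfl

/-- For negative `β` no weight is needed: `∫ t ^ (2 β - 1)` over `(x / 2, ∞)` equals `(x / 2) ^ (2
β) / (-2 β)`, and the factor `x ^ (-2 β)` cancels its growth as `x → 0`. -/
theorem sq_mul_setLIntegral_uIoc_le_of_neg {a β : ℝ} (ha : 0 < a) (hβ : β < 0) :
    ∃ D : ℝ≥0, ∀ f : ℝ → ℝ, AEStronglyMeasurable f (radialMeasure a) → ∀ x ∈ Ioo 0 a,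
      ∀ y ∈ Ioo (a / 2) a, (ENNReal.ofReal (x ^ (0 - β)) * ∫⁻ t in uIoc y x, ‖t ^ β * f t‖ₑ) ^ 2 ≤
        D * ∫⁻ t, ‖f t‖ₑ ^ 2 ∂(radialMeasure a) := by
  refine ⟨(ENNReal.ofReal (2 ^ (-(2 * β)) / (-(2 * β)))).toNNReal, fun f hf x hx y hy => ?_⟩
  rw [ENNReal.coe_toNNReal (by simp)]
  have hsub : uIoc y x ⊆ Ioo 0 a := fun t ht => by
    rw [uIoc, mem_Ioc] at ht
    exact ⟨(lt_min (by linarith [hy.1]) hx.1).trans ht.1, ht.2.trans_lt (max_lt hy.2 hx.2)⟩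
  have hsub' : uIoc y x ⊆ Ioi (x / 2) := fun t ht => by
    rw [uIoc, mem_Ioc] at ht
    have : x / 2 ≤ min y x := le_min (by linarith [hx.2, hy.1]) (by linarith [hx.1])
    exact this.trans_lt ht.1
  have hx0 := hx.1
  rw [mul_pow]
  calc _ ≤ ENNReal.ofReal (x ^ (0 - β)) ^ 2 *
        ((∫⁻ t in uIoc y x, ENNReal.ofReal (t ^ (2 * β - 1))) *
          ∫⁻ t, ‖f t‖ₑ ^ 2 ∂(radialMeasure a)) := by
        gcongr
        exact sq_setLIntegral_rpow_mul_le hf β measurableSet_uIoc hsub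
    _ ≤ ENNReal.ofReal (x ^ (0 - β)) ^ 2 *
        ((∫⁻ t in Ioi (x / 2), ENNReal.ofReal (t ^ (2 * β - 1))) *
          ∫⁻ t, ‖f t‖ₑ ^ 2 ∂(radialMeasure a)) := by
        gcongr
    _ = _ := by
        rw [← ofReal_integral_eq_lintegral_ofReal
          (integrableOn_Ioi_rpow_of_lt (by linarith) (by positivity)) (by
            filter_upwards [ae_restrict_mem measurableSet_Ioi] with t ht
            have : 0 < t := lt_trans (by positivity) (mem_Ioi.1 ht)
            positivity), integral_Ioi_rpow_of_lt (by linarith) (by positivity), ← mul_assoc,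
          ← ENNReal.ofReal_pow (by positivity), ← ENNReal.ofReal_mul (by positivity)]
        congr 2
        rw [← Real.rpow_mul_natCast hx0.le, Real.div_rpow hx0.le (by norm_num),
          show 2 * β - 1 + 1 = 2 * β by ring, Real.rpow_neg (by norm_num : (0 : ℝ) ≤ 2)]
        have e : x ^ ((0 - β) * (2 : ℕ)) = (x ^ (2 * β))⁻¹ := by
          rw [← Real.rpow_neg hx0.le]; congr 1; push_cast; ring
        rw [e]
        have h1 : x ^ (2 * β) ≠ 0 := (Real.rpow_pos_of_pos hx0 _).ne'
        have h2 : (2 : ℝ) ^ (2 * β) ≠ 0 := (Real.rpow_pos_of_pos (by norm_num) _).ne'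
        field_simp

/-- `x ^ η c x = x ^ (η - β) · x ^ β c x`, and `x ^ β c x` is compared with its value at a point `y`
of `(a / 2, a)` where `c` does not exceed its mean size. The difference is the integral that `hD`
controls. -/
theorem exists_bound_of_sq_mul_setLIntegral_le {a β η : ℝ} (ha : 0 < a) (hβ : β ≤ η) {D : ℝ≥0}
    (hD : ∀ f : ℝ → ℝ, AEStronglyMeasurable f (radialMeasure a) → ∀ x ∈ Ioo 0 a,
      ∀ y ∈ Ioo (a / 2) a, (ENNReal.ofReal (x ^ (η - β)) * ∫⁻ t in uIoc y x, ‖t ^ β * f t‖ₑ) ^ 2 ≤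
        D * ∫⁻ t, ‖f t‖ₑ ^ 2 ∂(radialMeasure a)) :
    ∃ C : ℝ≥0, ∀ c f : ℝ → ℝ, MemLp c 2 (radialMeasure a) → MemLp f 2 (radialMeasure a) →
      IsWeakTwisted a β c f → ∀ᵐ x ∂(radialMeasure a), ‖x ^ η * c x‖ₑ ^ 2 ≤
        C * (∫⁻ t, ‖c t‖ₑ ^ 2 ∂(radialMeasure a) + ∫⁻ t, ‖f t‖ₑ ^ 2 ∂(radialMeasure a)) := by
  -- `B` dominates `x ^ (η - β) * y ^ β`; the two summands serve the two signs of `β`.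
  set B : ℝ := a ^ (η - β) * ((a / 2) ^ β + a ^ β) with hB
  have hB0 : 0 ≤ B := by positivity
  set C₁ : ℝ≥0∞ := ENNReal.ofReal B ^ 2 * ENNReal.ofReal (4 / a ^ 2) with hC₁
  have hC₁t : C₁ ≠ ⊤ := ENNReal.mul_ne_top (by simp) (by simp)
  refine ⟨2 * (C₁.toNNReal + D), fun c f hc hf h => ?_⟩
  obtain ⟨s, hs, hsb⟩ := h.enorm_le ha (hc.integrable (by norm_num)) (hf.integrable (by norm_num))
  obtain ⟨y, hys, hya, hy⟩ := exists_small_value ha hc.1 hs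
  rw [ae_radialMeasure_iff]
  filter_upwards [hs] with x hxs hxa
  have hx0 := hxa.1
  have hy0 : 0 < y := by linarith [hya.1]
  have hya' : y ∈ Ioo 0 a := ⟨hy0, hya.2⟩
  have hyβ : y ^ β ≤ (a / 2) ^ β + a ^ β := by
    rcases le_total 0 β with h0 | h0
    · have := Real.rpow_le_rpow hy0.le hya.2.le h0
      have : 0 ≤ (a / 2) ^ β := by positivity
      linarith
    · have := Real.rpow_le_rpow_of_nonpos (by positivity) hya.1.le h0
      have : 0 ≤ a ^ β := by positivity
      linarith
  have hcy : ‖c y‖ₑ ^ 2 ≤ ENNReal.ofReal (4 / a ^ 2) * ∫⁻ t, ‖c t‖ₑ ^ 2 ∂(radialMeasure a) := by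
    calc ‖c y‖ₑ ^ 2 = ENNReal.ofReal (4 / a ^ 2) * (ENNReal.ofReal (a ^ 2 / 4) * ‖c y‖ₑ ^ 2) := by
          rw [← mul_assoc, ← ENNReal.ofReal_mul (by positivity),
            show 4 / a ^ 2 * (a ^ 2 / 4) = 1 by field_simp]
          simp
      _ ≤ _ := by gcongr
  have e1 := enorm_rpow_mul_eq hx0 β η (c x)
  have e2 : ENNReal.ofReal (x ^ (η - β)) * ‖y ^ β * c y‖ₑ ≤ ENNReal.ofReal B * ‖c y‖ₑ := by
    rw [enorm_rpow_mul hy0, ← mul_assoc, ← ENNReal.ofReal_mul (by positivity)]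
    gcongr ENNReal.ofReal ?_ * _
    rw [hB]
    gcongr
    exact hxa.2.le
  calc ‖x ^ η * c x‖ₑ ^ 2
      ≤ (ENNReal.ofReal B * ‖c y‖ₑ +
          ENNReal.ofReal (x ^ (η - β)) * ∫⁻ t in uIoc y x, ‖t ^ β * f t‖ₑ) ^ 2 := by
        rw [e1]
        refine pow_le_pow_left' ?_ 2
        refine (mul_le_mul_right (hsb x hxs y hys hxa hya') _).trans ?_
        rw [mul_add]
        gcongr
    _ ≤ _ := add_sq_le_two_mul _ _
    _ ≤ 2 * (C₁ * (∫⁻ t, ‖c t‖ₑ ^ 2 ∂(radialMeasure a)) +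
          D * ∫⁻ t, ‖f t‖ₑ ^ 2 ∂(radialMeasure a)) := by
        gcongr
        · rw [mul_pow, hC₁, mul_assoc]
          gcongr
        · exact hD f hf.1 x hxa y hya
    _ ≤ _ := by
        push_cast
        rw [ENNReal.coe_toNNReal hC₁t, mul_assoc 2]
        refine mul_le_mul_right ?_ _
        rw [add_mul]
        refine add_le_add ?_ ?_
        · gcongr
          exact le_self_add
        · gcongr
          exact le_add_self

/-- If `y ^ β |c y|` stayed above `ε` near `0`, then `y c(y) ^ 2` would dominate a multiple of `y ^
(1 - 2 β)`, which is not integrable at `0` when `β ≥ 1`. -/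
theorem exists_small_value_near_zero {a β : ℝ} (hβ : 1 ≤ β) {c : ℝ → ℝ}
    (hc : MemLp c 2 (radialMeasure a)) {s : Set ℝ} (hs : s ∈ ae volume) {x : ℝ}
    (hx : x ∈ Ioo 0 a) {ε : ℝ} (hε : 0 < ε) :
    ∃ y ∈ s, y ∈ Ioo 0 x ∧ y ^ β * |c y| ≤ ε := by
  by_contra hcon
  push Not at hcon
  have hi : IntegrableOn (fun y => y * c y ^ 2) (Ioo 0 x) :=
    (integrable_radialMeasure_iff.1 hc.integrable_sq).mono_set (Ioo_subset_Ioo_right hx.2.le)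
  have h1 : IntegrableOn (fun y : ℝ => y ^ (1 - 2 * β)) (Ioo 0 x) := by
    have hi2 := hi.const_mul (ε⁻¹ ^ 2)
    refine Integrable.mono' hi2 (by fun_prop) ?_
    rw [ae_restrict_iff' measurableSet_Ioo]
    filter_upwards [hs] with y hy hyx
    have hy0 := hyx.1
    have h2 := hcon y hy hyx
    have h3 : ε ^ 2 ≤ (y ^ β * |c y|) ^ 2 := by gcongr
    rw [Real.norm_of_nonneg (by positivity)]
    have h4 : y ^ (1 - 2 * β) = y * (y ^ β * y ^ β)⁻¹ := by
      rw [← Real.rpow_add hy0, ← Real.rpow_neg hy0.le, mul_comm y, ← Real.rpow_add_one hy0.ne']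
      congr 1; ring
    have hp : 0 < y ^ β := by positivity
    rw [mul_pow, sq_abs] at h3
    rw [h4, inv_pow]
    have : (y ^ β * y ^ β)⁻¹ ≤ (ε ^ 2)⁻¹ * c y ^ 2 := by
      rw [inv_le_iff_one_le_mul₀ (by positivity), mul_assoc, inv_mul_eq_div, one_le_div (by positivity)]
      nlinarith
    calc y * (y ^ β * y ^ β)⁻¹ ≤ y * ((ε ^ 2)⁻¹ * c y ^ 2) := by gcongr
      _ = _ := by ring
  rw [intervalIntegral.integrableOn_Ioo_rpow_iff hx.1] at h1
  linarith

/-- Membership in `L²(x dx)` forces the boundary term at `0` to vanish, so the primitive may start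
there. Then `∫ t ^ (2 β - 1)` over `(0, x]` is `x ^ (2 β) / (2 β)`, and after multiplication by `x ^
(2 (η - β))` only `x ^ (2 η) ≤ a ^ (2 η)` remains. -/
theorem exists_bound_of_one_le {a β η : ℝ} (ha : 0 < a) (hβ : 1 ≤ β) (hη : 0 ≤ η) :
    ∃ C : ℝ≥0, ∀ c f : ℝ → ℝ, MemLp c 2 (radialMeasure a) → MemLp f 2 (radialMeasure a) →
      IsWeakTwisted a β c f → ∀ᵐ x ∂(radialMeasure a), ‖x ^ η * c x‖ₑ ^ 2 ≤
        C * (∫⁻ t, ‖c t‖ₑ ^ 2 ∂(radialMeasure a) + ∫⁻ t, ‖f t‖ₑ ^ 2 ∂(radialMeasure a)) := by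
  refine ⟨(ENNReal.ofReal (a ^ (2 * η) / (2 * β))).toNNReal, fun c f hc hf h => ?_⟩
  rw [ENNReal.coe_toNNReal (by simp)]
  obtain ⟨s, hs, hsb⟩ := h.enorm_le ha (hc.integrable (by norm_num)) (hf.integrable (by norm_num))
  rw [ae_radialMeasure_iff]
  filter_upwards [hs] with x hxs hxa
  have hx0 := hxa.1
  have h1 : ‖x ^ β * c x‖ₑ ≤ ∫⁻ t in Ioc 0 x, ‖t ^ β * f t‖ₑ := by
    refine ENNReal.le_of_forall_pos_le_add fun ε hε _ => ?_
    obtain ⟨y, hys, hyx, hy⟩ := exists_small_value_near_zero hβ hc hs hxa (ε := ε) hε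
    have hy0 := hyx.1
    refine (hsb x hxs y hys hxa ⟨hy0, hyx.2.trans hxa.2⟩).trans ?_
    rw [add_comm]
    gcongr
    · rw [uIoc_of_le hyx.2.le]
      exact Ioc_subset_Ioc_left hy0.le
    · rw [enorm_mul, Real.enorm_of_nonneg (by positivity), ← ofReal_norm, Real.norm_eq_abs,
        ← ENNReal.ofReal_mul (by positivity)]
      exact ENNReal.ofReal_le_of_le_toReal (by simpa using hy)
  have hsub : Ioc 0 x ⊆ Ioo 0 a := fun t ht => ⟨ht.1, ht.2.trans_lt hxa.2⟩
  have h2 : ∫⁻ t in Ioc 0 x, ENNReal.ofReal (t ^ (2 * β - 1)) =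
      ENNReal.ofReal (x ^ (2 * β) / (2 * β)) := by
    rw [← ofReal_integral_eq_lintegral_ofReal, ← intervalIntegral.integral_of_le hx0.le,
      integral_rpow (Or.inl (by linarith)), show 2 * β - 1 + 1 = 2 * β by ring,
      Real.zero_rpow (by linarith), sub_zero]
    · exact (intervalIntegrable_iff_integrableOn_Ioc_of_le hx0.le).1
        (intervalIntegral.intervalIntegrable_rpow' (by linarith))
    · filter_upwards [ae_restrict_mem measurableSet_Ioc] with t ht
      have := ht.1
      positivity
  have e1 := enorm_rpow_mul_eq hx0 β η (c x)
  calc ‖x ^ η * c x‖ₑ ^ 2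
      ≤ ENNReal.ofReal (x ^ (η - β)) ^ 2 * (∫⁻ t in Ioc 0 x, ‖t ^ β * f t‖ₑ) ^ 2 := by
        rw [e1, mul_pow]; gcongr
    _ ≤ ENNReal.ofReal (x ^ (η - β)) ^ 2 * (ENNReal.ofReal (x ^ (2 * β) / (2 * β)) *
          ∫⁻ t, ‖f t‖ₑ ^ 2 ∂(radialMeasure a)) := by
        gcongr
        rw [← h2]
        exact sq_setLIntegral_rpow_mul_le hf.1 β measurableSet_Ioc hsub
    _ ≤ _ := by
        rw [← mul_assoc, ← ENNReal.ofReal_pow (by positivity),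
          ← ENNReal.ofReal_mul (by positivity)]
        gcongr
        · rw [← mul_div_assoc]
          gcongr
          rw [← Real.rpow_mul_natCast hx0.le, ← Real.rpow_add hx0]
          calc _ = x ^ (2 * η) := by congr 1; push_cast; ring
            _ ≤ _ := Real.rpow_le_rpow hx0.le hxa.2.le (by linarith)
        · exact le_add_self

/-- Weighted pointwise bound for an `L²(x dx)` function whose twisted derivative is in
`L²(x dx)`. -/
theorem exists_bound_of_isWeakTwisted {a β η : ℝ} (ha : 0 < a)
    (h : (0 < η ∧ β ≤ η) ∨ (β < 0 ∧ η = 0) ∨ (1 ≤ β ∧ 0 ≤ η)) :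
    ∃ C : ℝ≥0, ∀ c f : ℝ → ℝ, MemLp c 2 (radialMeasure a) → MemLp f 2 (radialMeasure a) →
      IsWeakTwisted a β c f → ∀ᵐ x ∂(radialMeasure a), ‖x ^ η * c x‖ₑ ^ 2 ≤
        C * (∫⁻ t, ‖c t‖ₑ ^ 2 ∂(radialMeasure a) + ∫⁻ t, ‖f t‖ₑ ^ 2 ∂(radialMeasure a)) := by
  rcases h with h | ⟨h, rfl⟩ | h
  · obtain ⟨D, hD⟩ := sq_mul_setLIntegral_uIoc_le_of_pos ha h.1 h.2
    exact exists_bound_of_sq_mul_setLIntegral_le ha h.2 hD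
  · obtain ⟨D, hD⟩ := sq_mul_setLIntegral_uIoc_le_of_neg ha h
    exact exists_bound_of_sq_mul_setLIntegral_le ha h.le hD
  · exact exists_bound_of_one_le ha h.1 h.2

/-! ### Frequency weights and common subsequences -/

/-- The size `1 + ∑ |ξ_q|` of a frequency. -/
def freqSize {ι : Type*} [Fintype ι] (ξ : ι → ℤ) : ℝ≥0 := 1 + ∑ q, ((ξ q).natAbs : ℝ≥0)

theorem one_le_freqSize {ι : Type*} [Fintype ι] (ξ : ι → ℤ) : 1 ≤ freqSize ξ := le_self_add

/-- Comparison with the convergent lattice sum of `‖ξ‖⁻¹ ^ r` over the integer lattice, since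
`freqSize` dominates the sup norm. -/
theorem summable_inv_freqSize_pow {ι : Type*} [Fintype ι] {r : ℕ} (hr : Fintype.card ι < r) :
    Summable fun ξ : ι → ℤ => (freqSize ξ)⁻¹ ^ r := by
  classical
  let L : Submodule ℤ (ι → ℝ) := Submodule.span ℤ (Set.range (Pi.basisFun ℝ ι))
  have hrank : Module.finrank ℤ L = Fintype.card ι := by
    rw [ZLattice.rank ℝ L, Module.finrank_fintype_fun_eq_card]
  have hs := ZLattice.summable_norm_pow_inv L r (by rwa [hrank])
  let e : (ι → ℤ) → L := fun ξ => ⟨fun q => (ξ q : ℝ), by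
    rw [Module.Basis.mem_span_iff_repr_mem]
    intro q
    exact ⟨ξ q, by simp⟩⟩
  have he : Function.Injective e := fun ξ ζ h => by
    funext q
    have := congrFun (congrArg Subtype.val h) q
    simpa [e] using this
  have h1 := hs.comp_injective he
  -- The frequency `0` needs its own term: there the inverse of the norm is `0` by convention and
  -- dominates nothing.
  have h2 : Summable fun ξ : ι → ℤ => if ξ = 0 then (1 : ℝ) else 0 :=
    summable_of_ne_finset_zero (s := {0}) fun ξ hξ => by simpa using hξ
  rw [← NNReal.summable_coe]
  refine Summable.of_nonneg_of_le (fun _ => by positivity) (fun ξ => ?_) (h2.add h1)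
  by_cases hξ : ξ = 0
  · subst hξ
    simp only [if_true, Function.comp]
    have : (((freqSize (0 : ι → ℤ))⁻¹ ^ r : ℝ≥0) : ℝ) ≤ 1 := by
      simp [freqSize]
    have h0 : 0 ≤ ‖e 0‖⁻¹ ^ r := by positivity
    linarith
  · simp only [hξ, if_false, zero_add, Function.comp]
    push_cast
    have hpos : 0 < ‖e ξ‖ := by
      rw [norm_pos_iff]
      intro h0
      exact hξ (he (h0.trans (by ext q; simp [e])))
    gcongr
    change ‖fun q => (ξ q : ℝ)‖ ≤ _
    rw [pi_norm_le_iff_of_nonneg (by positivity)]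
    intro q
    have : ((ξ q).natAbs : ℝ≥0) ≤ freqSize ξ :=
      (Finset.single_le_sum (f := fun q => ((ξ q).natAbs : ℝ≥0)) (by simp)
        (Finset.mem_univ q)).trans le_add_self
    calc ‖(ξ q : ℝ)‖ = (((ξ q).natAbs : ℝ≥0) : ℝ) := by
          simp [Nat.cast_natAbs]
      _ ≤ _ := by exact_mod_cast this

/-- The largest frequency absorbs all the powers; summing over the candidates removes the dependence
on which one it is. -/
theorem prod_freqSize_pow_le {ι κ : Type*} [Fintype ι] [Fintype κ] [Nonempty κ] {M : ℕ}
    {b : κ → ℕ} (hb : ∑ i, b i ≤ M) (f : κ → ι → ℤ) :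
    ∏ i, freqSize (f i) ^ b i ≤ ∑ i, freqSize (f i) ^ M := by
  obtain ⟨i₀, -, h⟩ := Finset.exists_max_image Finset.univ (fun i => freqSize (f i))
    Finset.univ_nonempty
  calc ∏ i, freqSize (f i) ^ b i ≤ ∏ i, freqSize (f i₀) ^ b i :=
        Finset.prod_le_prod' fun i hi => pow_le_pow_left' (h i hi) _
    _ = freqSize (f i₀) ^ ∑ i, b i := Finset.prod_pow_eq_pow_sum _ _ _
    _ ≤ freqSize (f i₀) ^ M := pow_le_pow_right₀ (one_le_freqSize _) hb
    _ ≤ _ := Finset.single_le_sum (f := fun i => freqSize (f i) ^ M) (by simp) (Finset.mem_univ i₀)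

/-- Several sequences which converge in measure converge a.e. along a common subsequence. -/
theorem exists_seq_forall_tendsto_ae {X κ σ E : Type*} [MeasurableSpace X] {μ : Measure X}
    [NormedAddCommGroup E] {u : Filter σ} [u.NeBot] [u.IsCountablyGenerated]
    (s : Finset κ) {f : κ → σ → X → E} {g : κ → X → E}
    (h : ∀ i ∈ s, TendstoInMeasure μ (f i) u (g i)) :
    ∃ ns : ℕ → σ, Tendsto ns atTop u ∧
      ∀ i ∈ s, ∀ᵐ x ∂μ, Tendsto (fun k => f i (ns k) x) atTop (𝓝 (g i x)) := by
  classical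
  induction s using Finset.induction_on with
  | empty =>
    obtain ⟨ns, hns⟩ := exists_seq_tendsto u
    exact ⟨ns, hns, by simp⟩
  | insert i s hi ih =>
    obtain ⟨ns, hns, hs⟩ := ih fun j hj => h j (Finset.mem_insert_of_mem hj)
    have hm : TendstoInMeasure μ (fun k => f i (ns k)) atTop (g i) := fun ε hε =>
      (h i (Finset.mem_insert_self i s) ε hε).comp hns
    obtain ⟨ms, hms, hi'⟩ := hm.exists_seq_tendsto_ae
    refine ⟨ns ∘ ms, hns.comp hms.tendsto_atTop, fun j hj => ?_⟩
    rcases Finset.mem_insert.1 hj with rfl | hj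
    · exact hi'
    · filter_upwards [hs j hj] with x hx
      exact hx.comp hms.tendsto_atTop

/-! ### Products of Fourier series on the torus and on the unit cube -/

section Torus

local instance unitAddCircleMeasureSpace : MeasureSpace UnitAddCircle := ⟨AddCircle.haarAddCircle⟩

open UnitAddTorus

theorem coeFn_sum_smul_mFourierLp {ι : Type*} [Fintype ι] (K : Finset (ι → ℤ))
    (c : (ι → ℤ) → ℂ) : (∑ ζ ∈ K, c ζ • mFourierLp (d := ι) 2 ζ : Lp ℂ 2 _) =ᵐ[volume]
      fun x => ∑ ζ ∈ K, c ζ * mFourier ζ x := by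
  classical
  induction K using Finset.induction_on with
  | empty =>
    simp only [Finset.sum_empty]
    exact Lp.coeFn_zero ℂ 2 (volume : Measure (UnitAddTorus ι))
  | insert ζ K hζ ih =>
    rw [Finset.sum_insert hζ]
    filter_upwards [ih, Lp.coeFn_add (c ζ • mFourierLp (d := ι) 2 ζ)
      (∑ ζ ∈ K, c ζ • mFourierLp (d := ι) 2 ζ), Lp.coeFn_smul (c ζ) (mFourierLp (d := ι) 2 ζ),
      coeFn_mFourierLp (d := ι) 2 ζ] with x h1 h2 h3 h4
    rw [h2, Pi.add_apply, h1, h3, Pi.smul_apply, h4, Finset.sum_insert hζ, smul_eq_mul]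

theorem lintegral_enorm_sq_sum_mFourier {ι : Type*} [Fintype ι] (K : Finset (ι → ℤ))
    (c : (ι → ℤ) → ℂ) : ∫⁻ x : UnitAddTorus ι, ‖∑ ζ ∈ K, c ζ * mFourier ζ x‖ₑ ^ 2 =
      ((∑ ζ ∈ K, ‖c ζ‖₊ ^ 2 : ℝ≥0) : ℝ≥0∞) := by
  set F : Lp ℂ 2 (volume : Measure (UnitAddTorus ι)) := ∑ ζ ∈ K, c ζ • mFourierLp 2 ζ with hF
  have h1 : ‖F‖ ^ 2 = ∑ ζ ∈ K, ‖c ζ‖ ^ 2 := by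
    have := orthonormal_mFourier.inner_sum c c K
    rw [← hF, inner_self_eq_norm_sq_to_K] at this
    simp only [RCLike.conj_mul] at this
    exact_mod_cast this
  have h2 : ∫⁻ x : UnitAddTorus ι, ‖∑ ζ ∈ K, c ζ * mFourier ζ x‖ₑ ^ 2 = eLpNorm F 2 volume ^ 2 := by
    rw [eLpNorm_two_sq]
    refine lintegral_congr_ae ?_
    filter_upwards [coeFn_sum_smul_mFourierLp K c] with x hx
    rw [hF, hx]
  rw [h2, ← Lp.enorm_def, ← ofReal_norm, ← ENNReal.ofReal_pow (norm_nonneg _), h1,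
    ENNReal.ofReal, ENNReal.coe_inj, ← NNReal.coe_inj]
  rw [Real.coe_toNNReal _ (by positivity)]
  push_cast
  rfl

theorem mFourier_sum {ι κ : Type*} [Fintype ι] (s : Finset κ) (f : κ → ι → ℤ)
    (x : UnitAddTorus ι) : mFourier (∑ i ∈ s, f i) x = ∏ i ∈ s, mFourier (f i) x := by
  classical
  induction s using Finset.induction_on with
  | empty => simp [mFourier_zero]
  | insert i s hi ih => rw [Finset.sum_insert hi, Finset.prod_insert hi, mFourier_add, ih]

/-- Expanding the product and grouping by total frequency gives the convolution of the coefficients;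
then Parseval. -/
theorem lintegral_enorm_sq_prod_sum_mFourier {ι κ : Type*} [Fintype ι] [Fintype κ]
    [DecidableEq κ] [DecidableEq ι] (S : Finset (ι → ℤ)) (A : κ → (ι → ℤ) → ℂ) :
    ∫⁻ x : UnitAddTorus ι, ‖∏ i, ∑ ξ ∈ S, A i ξ * mFourier ξ x‖ₑ ^ 2 =
      ((∑ ζ ∈ (Fintype.piFinset fun _ : κ => S).image (fun f => ∑ i, f i),
        ‖∑ f ∈ (Fintype.piFinset fun _ : κ => S) with ∑ i, f i = ζ, ∏ i, A i (f i)‖₊ ^ 2 : ℝ≥0) :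
          ℝ≥0∞) := by
  rw [← lintegral_enorm_sq_sum_mFourier]
  refine lintegral_congr fun x => ?_
  congr 2
  rw [Finset.prod_univ_sum, ← Finset.sum_fiberwise_of_maps_to
    (g := fun f => ∑ i, f i) (t := (Fintype.piFinset fun _ : κ => S).image (fun f => ∑ i, f i))
    (fun f hf => Finset.mem_image_of_mem _ hf)]
  refine Finset.sum_congr rfl fun ζ _ => ?_
  rw [Finset.sum_mul]
  refine Finset.sum_congr rfl fun f hf => ?_
  rw [← (Finset.mem_filter.1 hf).2, mFourier_sum, Finset.prod_mul_distrib]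

/-- The `L²` norm of a product of trigonometric polynomials is monotone in the absolute values of
the coefficients, and subadditive. -/
theorem lintegral_prod_le_of_coeff_le {ι κ σ : Type*} [Fintype ι] [Fintype κ] [Fintype σ]
    (S : Finset (ι → ℤ)) (A : κ → (ι → ℤ) → ℂ) (B : σ → κ → (ι → ℤ) → ℝ≥0)
    (h : ∀ f : κ → ι → ℤ, ∏ i, ‖A i (f i)‖₊ ≤ ∑ j, ∏ i, B j i (f i)) :
    ∫⁻ x : UnitAddTorus ι, ‖∏ i, ∑ ξ ∈ S, A i ξ * mFourier ξ x‖ₑ ^ 2 ≤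
      Fintype.card σ * ∑ j, ∫⁻ x : UnitAddTorus ι,
        ‖∏ i, ∑ ξ ∈ S, ((B j i ξ : ℝ) : ℂ) * mFourier ξ x‖ₑ ^ 2 := by
  classical
  simp only [lintegral_enorm_sq_prod_sum_mFourier]
  rw [← ENNReal.coe_natCast, ← ENNReal.ofNNReal_finsetSum, ← ENNReal.coe_mul, ENNReal.coe_le_coe,
    Finset.sum_comm, Finset.mul_sum]
  refine Finset.sum_le_sum fun ζ _ => ?_
  refine le_trans ?_ (sq_sum_le_card_mul_sum_sq)
  gcongr
  refine (nnnorm_sum_le _ _).trans ?_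
  simp only [nnnorm_prod]
  refine (Finset.sum_le_sum fun f _ => h f).trans ?_
  rw [Finset.sum_comm]
  refine Finset.sum_le_sum fun j _ => le_of_eq ?_
  rw [← NNReal.coe_inj, coe_nnnorm]
  push_cast
  have : (∑ f ∈ (Fintype.piFinset fun _ : κ => S) with ∑ i, f i = ζ, ∏ i, ((B j i (f i) : ℝ) : ℂ))
      = ((∑ f ∈ (Fintype.piFinset fun _ : κ => S) with ∑ i, f i = ζ, ∏ i, (B j i (f i) : ℝ) : ℝ) : ℂ) := by
    push_cast; rfl
  rw [this, Complex.norm_real, Real.norm_of_nonneg (by positivity)]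

/-- All factors except `j` are bounded in supremum norm by the `ℓ¹` norm of their coefficients, and
the factor `j` is evaluated by Parseval. -/
theorem lintegral_prod_le_of_one_factor {ι κ : Type*} [Fintype ι] [Fintype κ] [DecidableEq κ]
    (S : Finset (ι → ℤ)) (j : κ) (B : κ → (ι → ℤ) → ℝ≥0) :
    ∫⁻ x : UnitAddTorus ι, ‖∏ i, ∑ ξ ∈ S, ((B i ξ : ℝ) : ℂ) * mFourier ξ x‖ₑ ^ 2 ≤
      (((∏ i ∈ Finset.univ.erase j, (∑ ξ ∈ S, B i ξ) ^ 2) * ∑ ξ ∈ S, B j ξ ^ 2 : ℝ≥0) : ℝ≥0∞) := by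
  have h1 : ∀ (i : κ) (x : UnitAddTorus ι), ‖∑ ξ ∈ S, ((B i ξ : ℝ) : ℂ) * mFourier ξ x‖₊ ≤
      ∑ ξ ∈ S, B i ξ := fun i x => by
    refine (nnnorm_sum_le _ _).trans (Finset.sum_le_sum fun ξ _ => ?_)
    rw [nnnorm_mul]
    refine (mul_le_mul' (le_of_eq ?_) ?_).trans_eq (mul_one _)
    · ext; simp
    · rw [← NNReal.coe_le_coe, coe_nnnorm]
      exact ((mFourier ξ).norm_coe_le_norm x).trans_eq mFourier_norm
  have h2 := lintegral_enorm_sq_sum_mFourier S fun ξ => ((B j ξ : ℝ) : ℂ)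
  have h3 : ∀ ξ, ‖((B j ξ : ℝ) : ℂ)‖₊ = B j ξ := fun ξ => by ext; simp
  simp only [h3] at h2
  rw [ENNReal.coe_mul, ← h2, ← lintegral_const_mul' _ _ ENNReal.coe_ne_top]
  refine lintegral_mono fun x => ?_
  rw [← Finset.mul_prod_erase _ _ (Finset.mem_univ j), enorm_mul, mul_pow, mul_comm]
  gcongr
  rw [enorm_eq_nnnorm, nnnorm_prod, ← ENNReal.coe_pow, ← Finset.prod_pow, ENNReal.coe_le_coe]
  exact Finset.prod_le_prod' fun i _ => pow_le_pow_left' (h1 i x) 2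

/-- This is the Sobolev product estimate. The weights `freqSize ^ b i` missing from the factors are
collected on the factor with the largest frequency, which then carries the full weight `M - b i`.
The others end up with `M` spare negative powers, enough for `ℓ¹` because `2 * M` exceeds the
dimension. -/
theorem lintegral_prod_trigPoly_le {ι κ : Type*} [Fintype ι] [Fintype κ] [Nonempty κ] {M : ℕ}
    (hM : Fintype.card ι < 2 * M) {b : κ → ℕ} (hb : ∑ i, b i ≤ M) :
    ∃ C : ℝ≥0, ∀ (S : Finset (ι → ℤ)) (A : κ → (ι → ℤ) → ℂ),
      ∫⁻ x : UnitAddTorus ι, ‖∏ i, ∑ ξ ∈ S, A i ξ * mFourier ξ x‖ₑ ^ 2 ≤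
        ((C * ∏ i, ∑ ξ ∈ S, freqSize ξ ^ (2 * (M - b i)) * ‖A i ξ‖₊ ^ 2 : ℝ≥0) : ℝ≥0∞) := by
  classical
  set K : ℝ≥0 := ∑' ξ : ι → ℤ, (freqSize ξ)⁻¹ ^ (2 * M) with hK
  have hsum := summable_inv_freqSize_pow hM
  have hbi : ∀ i, b i ≤ M := fun i =>
    (Finset.single_le_sum (fun _ _ => Nat.zero_le _) (Finset.mem_univ i)).trans hb
  refine ⟨Fintype.card κ * ∑ _j : κ, K ^ (Fintype.card κ - 1), fun S A => ?_⟩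
  set N : κ → ℝ≥0 := fun i => ∑ ξ ∈ S, freqSize ξ ^ (2 * (M - b i)) * ‖A i ξ‖₊ ^ 2 with hN
  -- `B j` is the coefficient system in which the factor `j` receives the power `M`; every factor
  -- `i` has given away the power `b i`.
  let B : κ → κ → (ι → ℤ) → ℝ≥0 := fun j i ξ =>
    (if i = j then freqSize ξ ^ M else 1) * ((freqSize ξ)⁻¹ ^ b i * ‖A i ξ‖₊)
  have hne : ∀ ξ : ι → ℤ, freqSize ξ ≠ 0 := fun ξ => (zero_lt_one.trans_le (one_le_freqSize ξ)).ne'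
  refine (lintegral_prod_le_of_coeff_le S A B fun f => ?_).trans ?_
  · have e1 : ∀ j, ∏ i, B j i (f i) =
        freqSize (f j) ^ M * ∏ i, ((freqSize (f i))⁻¹ ^ b i * ‖A i (f i)‖₊) := fun j => by
      simp only [B]
      rw [Finset.prod_mul_distrib]
      congr 1
      rw [Finset.prod_ite_eq' Finset.univ j (fun i => freqSize (f i) ^ M)]
      simp
    simp only [e1]
    rw [← Finset.sum_mul]
    calc ∏ i, ‖A i (f i)‖₊
        = (∏ i, freqSize (f i) ^ b i) * ∏ i, ((freqSize (f i))⁻¹ ^ b i * ‖A i (f i)‖₊) := by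
          rw [← Finset.prod_mul_distrib]
          refine Finset.prod_congr rfl fun i _ => ?_
          rw [← mul_assoc, ← mul_pow, mul_inv_cancel₀ (hne _), one_pow, one_mul]
      _ ≤ _ := by gcongr; exact prod_freqSize_pow_le hb f
  · push_cast
    rw [mul_assoc, Finset.sum_mul]
    gcongr with j
    refine (lintegral_prod_le_of_one_factor S j (B j)).trans ?_
    have e2 : ∑ ξ ∈ S, B j j ξ ^ 2 = N j := by
      refine Finset.sum_congr rfl fun ξ _ => ?_
      simp only [B, if_true]
      rw [← mul_assoc, mul_pow, pow_mul']
      congr 2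
      obtain ⟨r, hr⟩ := Nat.exists_eq_add_of_le (hbi j)
      rw [hr, add_tsub_cancel_left, pow_add, mul_comm, ← mul_assoc, ← mul_pow,
        inv_mul_cancel₀ (hne _), one_pow, one_mul]
    -- Cauchy–Schwarz after writing `freqSize ^ (-b i)` as `freqSize ^ (-M)` times `freqSize ^ (M -
    -- b i)`.
    have e3 : ∀ i ∈ Finset.univ.erase j, (∑ ξ ∈ S, B j i ξ) ^ 2 ≤ K * N i := by
      intro i hi
      have hij : i ≠ j := (Finset.mem_erase.1 hi).1
      have e4 : ∀ ξ, B j i ξ = (freqSize ξ)⁻¹ ^ M * (freqSize ξ ^ (M - b i) * ‖A i ξ‖₊) := by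
        intro ξ
        simp only [B, hij, if_false, one_mul]
        rw [← mul_assoc]
        congr 1
        obtain ⟨r, hr⟩ := Nat.exists_eq_add_of_le (hbi i)
        rw [hr, add_tsub_cancel_left, pow_add, mul_assoc, ← mul_pow, inv_mul_cancel₀ (hne _),
          one_pow, mul_one]
      simp only [e4]
      refine (Finset.sum_mul_sq_le_sq_mul_sq _ _ _).trans ?_
      refine mul_le_mul' ?_ (le_of_eq ?_)
      · simp only [← pow_mul, mul_comm M 2]
        exact hsum.sum_le_tsum S (fun _ _ => by positivity)
      · refine Finset.sum_congr rfl fun ξ _ => ?_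
        rw [mul_pow, ← pow_mul, mul_comm _ 2]
    rw [e2]
    calc _ ≤ (((∏ i ∈ Finset.univ.erase j, K * N i) * N j : ℝ≥0) : ℝ≥0∞) := by
          rw [ENNReal.coe_le_coe]
          gcongr with i hi
          exact e3 i hi
      _ = _ := by
          rw [Finset.prod_mul_distrib, Finset.prod_const, Finset.card_erase_of_mem (Finset.mem_univ j),
            mul_assoc, Finset.prod_erase_mul _ _ (Finset.mem_univ j)]
          push_cast
          simp [hN]

theorem tendstoInMeasure_sum_mFourierCoeff {ι : Type*} [Fintype ι] {G : UnitAddTorus ι → ℂ}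
    (hG : MemLp G 2) : TendstoInMeasure volume
      (fun (S : Finset (ι → ℤ)) x => ∑ ξ ∈ S, mFourierCoeff G ξ * mFourier ξ x) atTop G := by
  refine tendstoInMeasure_of_tendsto_eLpNorm (p := 2) (by norm_num) (fun S => ?_) hG.1 ?_
  · exact (Continuous.aestronglyMeasurable (by fun_prop))
  · have h := hasSum_mFourier_series_L2 (hG.toLp G)
    have h' := (Lp.tendsto_Lp_iff_tendsto_eLpNorm' _ _).1 h
    refine h'.congr fun S => eLpNorm_congr_ae ?_
    have hc : ∀ ξ, mFourierCoeff (hG.toLp G) ξ = mFourierCoeff G ξ := fun ξ =>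
      integral_congr_ae (by filter_upwards [hG.coeFn_toLp] with x hx; rw [hx])
    simp only [hc]
    exact (coeFn_sum_smul_mFourierLp S (mFourierCoeff G)).sub hG.coeFn_toLp

theorem tsum_enorm_sq_mFourierCoeff {ι : Type*} [Fintype ι] {G : UnitAddTorus ι → ℂ}
    (hG : MemLp G 2) : ∑' ξ, ‖mFourierCoeff G ξ‖ₑ ^ 2 = ∫⁻ x, ‖G x‖ₑ ^ 2 := by
  have h := hasSum_sq_mFourierCoeff (hG.toLp G)
  have hc : ∀ ξ, mFourierCoeff (hG.toLp G) ξ = mFourierCoeff G ξ := fun ξ =>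
    integral_congr_ae (by filter_upwards [hG.coeFn_toLp] with x hx; rw [hx])
  have hi : ∫ x, ‖hG.toLp G x‖ ^ 2 = ∫ x, ‖G x‖ ^ 2 :=
    integral_congr_ae (by filter_upwards [hG.coeFn_toLp] with x hx; rw [hx])
  simp only [hc, hi] at h
  have e1 : ∀ ξ, ‖mFourierCoeff G ξ‖ₑ ^ 2 = ENNReal.ofReal (‖mFourierCoeff G ξ‖ ^ 2) := fun ξ => by
    rw [ENNReal.ofReal_pow (norm_nonneg _), ofReal_norm]
  have e2 : ∀ x, ‖G x‖ₑ ^ 2 = ENNReal.ofReal (‖G x‖ ^ 2) := fun x => by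
    rw [ENNReal.ofReal_pow (norm_nonneg _), ofReal_norm]
  simp only [e1, e2]
  rw [← ofReal_integral_eq_lintegral_ofReal (hG.integrable_norm_pow (by norm_num))
    (ae_of_all _ fun x => by positivity), ← h.tsum_eq,
    ENNReal.ofReal_tsum_of_nonneg (fun _ => by positivity) h.summable]

/-- The bound for trigonometric polynomials is uniform in the set of frequencies. It passes to the
limit by Fatou's lemma, along a subsequence on which the partial sums of all factors converge a.e.
simultaneously. -/
theorem lintegral_prod_le_mFourierCoeff {ι κ : Type*} [Fintype ι] [Fintype κ] [Nonempty κ] {M : ℕ}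
    (hM : Fintype.card ι < 2 * M) {b : κ → ℕ} (hb : ∑ i, b i ≤ M) :
    ∃ C : ℝ≥0, ∀ G : κ → UnitAddTorus ι → ℂ, (∀ i, MemLp (G i) 2) →
      ∫⁻ x, ∏ i, ‖G i x‖ₑ ^ 2 ≤ C * ∏ i, ∑' ξ : ι → ℤ,
        (freqSize ξ : ℝ≥0∞) ^ (2 * (M - b i)) * ‖mFourierCoeff (G i) ξ‖ₑ ^ 2 := by
  obtain ⟨C, hC⟩ := lintegral_prod_trigPoly_le hM hb
  refine ⟨C, fun G hG => ?_⟩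
  obtain ⟨ns, hns, hae⟩ := exists_seq_forall_tendsto_ae Finset.univ
    fun i _ => tendstoInMeasure_sum_mFourierCoeff (hG i)
  have hae' : ∀ᵐ x : UnitAddTorus ι, ∀ i, Tendsto
      (fun k => ∑ ξ ∈ ns k, mFourierCoeff (G i) ξ * mFourier ξ x) atTop (𝓝 (G i x)) :=
    ae_all_iff.2 fun i => hae i (Finset.mem_univ i)
  calc ∫⁻ x, ∏ i, ‖G i x‖ₑ ^ 2
      = ∫⁻ x, liminf (fun k => ‖∏ i, ∑ ξ ∈ ns k, mFourierCoeff (G i) ξ * mFourier ξ x‖ₑ ^ 2)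
          atTop := by
        refine lintegral_congr_ae ?_
        filter_upwards [hae'] with x hx
        have h1 : Tendsto (fun k => ∏ i, ∑ ξ ∈ ns k, mFourierCoeff (G i) ξ * mFourier ξ x) atTop
            (𝓝 (∏ i, G i x)) := tendsto_finsetProd _ fun i _ => hx i
        have h2 := (ENNReal.continuous_pow 2).continuousAt.tendsto.comp h1.enorm
        have e : ‖∏ i, G i x‖ₑ ^ 2 = ∏ i, ‖G i x‖ₑ ^ 2 := by
          simp only [enorm_eq_nnnorm, nnnorm_prod]
          push_cast
          rw [Finset.prod_pow]
        rw [← e]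
        exact h2.liminf_eq.symm
    _ ≤ liminf (fun k => ∫⁻ x, ‖∏ i, ∑ ξ ∈ ns k, mFourierCoeff (G i) ξ * mFourier ξ x‖ₑ ^ 2)
          atTop := by
        refine lintegral_liminf_le' fun k => ?_
        have : Continuous fun x : UnitAddTorus ι =>
            ∏ i, ∑ ξ ∈ ns k, mFourierCoeff (G i) ξ * mFourier ξ x := by fun_prop
        exact (this.measurable.enorm.pow_const 2).aemeasurable
    _ ≤ _ := by
        refine (liminf_le_limsup (by isBoundedDefault) (by isBoundedDefault)).trans ?_
        refine limsup_le_of_le (by isBoundedDefault) (Eventually.of_forall fun k => ?_)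
        refine (hC (ns k) fun i => mFourierCoeff (G i)).trans ?_
        rw [ENNReal.coe_mul, ENNReal.ofNNReal_finsetProd]
        gcongr with i
        rw [ENNReal.ofNNReal_finsetSum]
        refine le_trans (le_of_eq ?_) (ENNReal.sum_le_tsum (ns k))
        refine Finset.sum_congr rfl fun ξ _ => ?_
        push_cast
        rfl

/-- The unit cube centred at the origin. -/
def unitCube (ι : Type*) : Set (ι → ℝ) := {x | ∀ i, x i ∈ Ioc (-1 / 2 : ℝ) (-1 / 2 + 1)}

/-- The character `exp (-2 π i ξ · x)`. -/
def cubeChar {ι : Type*} [Fintype ι] (ξ : ι → ℤ) (x : ι → ℝ) : ℂ :=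
  Complex.exp (-(2 * Real.pi * (∑ q, ξ q * x q : ℝ) * Complex.I))

/-- The Fourier coefficients of a function on the unit cube. -/
def cubeCoeff {ι : Type*} [Fintype ι] (G : (ι → ℝ) → ℂ) (ξ : ι → ℤ) : ℂ :=
  ∫ x in unitCube ι, cubeChar ξ x * G x

theorem measurableSet_unitCube (ι : Type*) [Finite ι] : MeasurableSet (unitCube ι) := by
  have := Fintype.ofFinite ι
  have : unitCube ι = Set.univ.pi fun _ => Ioc (-1 / 2 : ℝ) (-1 / 2 + 1) := by
    ext; simp [unitCube]
  rw [this]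
  exact MeasurableSet.univ_pi fun _ => measurableSet_Ioc

/-- The function on the torus with given restriction to the unit cube. -/
def torusLift {ι : Type*} [Fintype ι] (G : (ι → ℝ) → ℂ) (t : UnitAddTorus ι) : ℂ :=
  G (measurableEquivPiIoc (fun _ : ι => (-1 / 2 : ℝ)) t).1

theorem torusLift_coe {ι : Type*} [Fintype ι] (G : (ι → ℝ) → ℂ) {x : ι → ℝ}
    (hx : x ∈ unitCube ι) : torusLift G (fun i => (x i : UnitAddCircle)) = G x := by
  have := (measurableEquivPiIoc (fun _ : ι => (-1 / 2 : ℝ))).apply_symm_apply ⟨x, hx⟩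
  rw [coe_symm_measurableEquivPiIoc_apply] at this
  rw [torusLift, this]

theorem memLp_torusLift {ι : Type*} [Fintype ι] {G : (ι → ℝ) → ℂ}
    (hG : MemLp G 2 (volume.restrict (unitCube ι))) : MemLp (torusLift G) 2 := by
  have h1 : MemLp (fun x : {x : ι → ℝ // ∀ i, x i ∈ Ioc (-1 / 2 : ℝ) (-1 / 2 + 1)} => G x.1) 2
      (Measure.comap Subtype.val volume) := by
    rw [← map_comap_subtype_coe (measurableSet_unitCube ι)] at hG
    exact ((MeasurableEmbedding.subtype_coe (measurableSet_unitCube ι)).memLp_map_measure_iff).1 hG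
  exact h1.comp_measurePreserving (measurePreserving_equivPiIoc fun _ : ι => (-1 / 2 : ℝ))

theorem mFourierCoeff_torusLift {ι : Type*} [Fintype ι] (G : (ι → ℝ) → ℂ) (ξ : ι → ℤ) :
    mFourierCoeff (torusLift G) ξ = cubeCoeff G ξ := by
  rw [mFourierCoeff_eq_integral _ _ fun _ => (-1 / 2 : ℝ)]
  refine setIntegral_congr_fun (measurableSet_unitCube ι) fun x hx => ?_
  simp only [torusLift_coe G hx, smul_eq_mul]
  congr 1
  rw [mFourier]
  simp only [ContinuousMap.coe_mk, fourier_coe_apply, Pi.neg_apply]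
  rw [← Complex.exp_sum, cubeChar]
  congr 1
  push_cast
  rw [Finset.mul_sum, Finset.sum_mul, ← Finset.sum_neg_distrib]
  refine Finset.sum_congr rfl fun i _ => ?_
  ring

theorem tsum_enorm_sq_cubeCoeff {ι : Type*} [Fintype ι] {G : (ι → ℝ) → ℂ}
    (hG : MemLp G 2 (volume.restrict (unitCube ι))) :
    ∑' ξ, ‖cubeCoeff G ξ‖ₑ ^ 2 = ∫⁻ x in unitCube ι, ‖G x‖ₑ ^ 2 := by
  have h := tsum_enorm_sq_mFourierCoeff (memLp_torusLift hG)
  simp only [mFourierCoeff_torusLift] at h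
  rw [h, lintegral_preimage _ fun _ => (-1 / 2 : ℝ)]
  exact setLIntegral_congr_fun (measurableSet_unitCube ι) fun x hx => by
    simp only [torusLift_coe G hx]

/-- Product estimate in `L²` of the unit cube in terms of weighted Fourier coefficients. -/
theorem lintegral_prod_le_cubeCoeff {ι κ : Type*} [Fintype ι] [Fintype κ] [Nonempty κ] {M : ℕ}
    (hM : Fintype.card ι < 2 * M) {b : κ → ℕ} (hb : ∑ i, b i ≤ M) :
    ∃ C : ℝ≥0, ∀ G : κ → (ι → ℝ) → ℂ, (∀ i, MemLp (G i) 2 (volume.restrict (unitCube ι))) →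
      ∫⁻ x in unitCube ι, ∏ i, ‖G i x‖ₑ ^ 2 ≤ C * ∏ i, ∑' ξ : ι → ℤ,
        (freqSize ξ : ℝ≥0∞) ^ (2 * (M - b i)) * ‖cubeCoeff (G i) ξ‖ₑ ^ 2 := by
  obtain ⟨C, hC⟩ := lintegral_prod_le_mFourierCoeff hM hb
  refine ⟨C, fun G hG => ?_⟩
  have h := hC (fun i => torusLift (G i)) fun i => memLp_torusLift (hG i)
  simp only [mFourierCoeff_torusLift] at h
  refine le_trans (le_of_eq ?_) h
  rw [lintegral_preimage _ fun _ => (-1 / 2 : ℝ)]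
  exact setLIntegral_congr_fun (measurableSet_unitCube ι) fun x hx => by
    simp only [torusLift_coe _ hx]

end Torus

/-! ### Central projection of a hyperplane to the sphere -/

section Chart

variable {m : Type*} [DecidableEq m]

/-- The point of Euclidean space with coordinate `t` at `p` and the other coordinates `w`. -/
def insertCoord (p : m) (t : ℝ) (w : {q : m // q ≠ p} → ℝ) : EuclideanSpace ℝ m :=
  WithLp.toLp 2 fun q => if h : q = p then t else w ⟨q, h⟩

@[simp]
theorem insertCoord_self (p : m) (t : ℝ) (w : {q : m // q ≠ p} → ℝ) :
    insertCoord p t w p = t := by simp [insertCoord]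

@[simp]
theorem insertCoord_coe (p : m) (t : ℝ) (w : {q : m // q ≠ p} → ℝ) (q : {q : m // q ≠ p}) :
    insertCoord p t w q = w q := by simp [insertCoord, q.2]

theorem measurable_insertCoord (p : m) :
    Measurable fun z : ℝ × ({q : m // q ≠ p} → ℝ) => insertCoord p z.1 z.2 := by
  refine (WithLp.measurable_toLp 2 _).comp (measurable_pi_lambda _ fun q => ?_)
  by_cases h : q = p
  · simpa [h] using measurable_fst
  · simp only [h, dite_false]
    fun_prop

theorem insertCoord_smul (p : m) (t : ℝ) (w : {q : m // q ≠ p} → ℝ) :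
    insertCoord p t (t • w) = t • insertCoord p 1 w := by
  ext q
  by_cases h : q = p <;> simp [insertCoord, h]

theorem insertCoord_ne_zero (p : m) {t : ℝ} (ht : t ≠ 0) (w : {q : m // q ≠ p} → ℝ) :
    insertCoord p t w ≠ 0 := fun h => ht (by simpa using congrArg (fun z => z p) h)

variable [Fintype m]

theorem lintegral_eq_lintegral_insertCoord (p : m) {H : EuclideanSpace ℝ m → ℝ≥0∞}
    (hH : Measurable H) : ∫⁻ z, H z = ∫⁻ t : ℝ, ∫⁻ w, H (insertCoord p t w) := by
  rw [← (PiLp.volume_preserving_toLp m).lintegral_comp hH,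
    ← (volume_preserving_piEquivPiSubtypeProd (fun _ : m => ℝ) (· = p)).symm.lintegral_comp
      (f := fun x => H (WithLp.toLp 2 x)) (hH.comp (WithLp.measurable_toLp 2 _))]
  have hm := (hH.comp (WithLp.measurable_toLp 2 _)).comp
    (MeasurableEquiv.piEquivPiSubtypeProd (fun _ : m => ℝ) (· = p)).symm.measurable
  rw [Measure.volume_eq_prod]
  refine (lintegral_prod _ hm.aemeasurable).trans ?_
  have hu : MeasurePreserving (MeasurableEquiv.funUnique {q : m // q = p} ℝ)
      (@MeasureSpace.pi {q : m // q = p} (Subtype.fintype (fun q => q = p)) (fun _ => ℝ)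
        fun _ => Real.measureSpace).volume volume := by
    convert! volume_preserving_funUnique {q : m // q = p} ℝ
  refine (hu.symm.lintegral_comp
    (hm.lintegral_prod_right' (ν := volume))).symm.trans ?_
  refine lintegral_congr fun t => lintegral_congr fun w => ?_
  simp only [Function.comp]
  congr 1

/-- Radial projection to the unit sphere; the value at the origin is a coordinate vector. -/
def sphereDir (p : m) (z : EuclideanSpace ℝ m) : Metric.sphere (0 : EuclideanSpace ℝ m) 1 :=
  ⟨if z = 0 then EuclideanSpace.single p 1 else ‖z‖⁻¹ • z, by
    split_ifs with h
    · simp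
    · simp [norm_smul, h]⟩

theorem measurable_sphereDir (p : m) : Measurable (sphereDir p) :=
  (Measurable.ite (measurableSet_singleton 0) measurable_const (by fun_prop)).subtype_mk

theorem coe_sphereDir (p : m) {z : EuclideanSpace ℝ m} (hz : z ≠ 0) :
    (sphereDir p z : EuclideanSpace ℝ m) = ‖z‖⁻¹ • z := by simp [sphereDir, hz]

theorem sphereDir_smul (p : m) {r : ℝ} (hr : 0 < r) (z : EuclideanSpace ℝ m) :
    sphereDir p (r • z) = sphereDir p z := by
  ext1
  by_cases hz : z = 0
  · simp [hz]
  · rw [coe_sphereDir p hz, coe_sphereDir p (smul_ne_zero hr.ne' hz), norm_smul, smul_smul,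
      Real.norm_of_nonneg hr.le, mul_inv_rev, mul_assoc, inv_mul_cancel₀ hr.ne', mul_one]

theorem sphereDir_coe (p : m) (θ : Metric.sphere (0 : EuclideanSpace ℝ m) 1) :
    sphereDir p (θ : EuclideanSpace ℝ m) = θ := by
  ext1
  have h1 : ‖(θ : EuclideanSpace ℝ m)‖ = 1 := by simp
  rw [coe_sphereDir p (by rw [← norm_ne_zero_iff, h1]; norm_num), h1]
  simp

theorem lintegral_eq_lintegral_polar (p : m) {H : EuclideanSpace ℝ m → ℝ≥0∞}
    (hH : Measurable H) : ∫⁻ z, H z =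
      ∫⁻ θ, ∫⁻ r, H (r.1 • (θ : EuclideanSpace ℝ m))
        ∂(Measure.volumeIoiPow (Fintype.card m - 1))
        ∂(volume : Measure (EuclideanSpace ℝ m)).toSphere := by
  have : Nontrivial (EuclideanSpace ℝ m) :=
    ⟨EuclideanSpace.single p 1, 0, by simp⟩
  have h := (volume : Measure (EuclideanSpace ℝ m)).measurePreserving_homeomorphUnitSphereProd
  have hsymm := h.symm (homeomorphUnitSphereProd (EuclideanSpace ℝ m)).toMeasurableEquiv
  rw [finrank_euclideanSpace] at h
  have e1 : ∫⁻ z, H z = ∫⁻ z in ({0}ᶜ : Set (EuclideanSpace ℝ m)), H z := by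
    rw [restrict_compl_singleton]
  have hm : Measurable fun y : Metric.sphere (0 : EuclideanSpace ℝ m) 1 × Ioi (0 : ℝ) =>
      H (y.2.1 • (y.1 : EuclideanSpace ℝ m)) := hH.comp (by fun_prop)
  rw [e1, ← lintegral_subtype_comap (measurableSet_singleton _).compl,
    ← lintegral_prod (fun y : Metric.sphere (0 : EuclideanSpace ℝ m) 1 × Ioi (0 : ℝ) =>
      H (y.2.1 • (y.1 : EuclideanSpace ℝ m))) hm.aemeasurable, ← h.lintegral_comp hm]
  refine lintegral_congr fun z => ?_
  congr 1
  have := congrArg Subtype.val ((homeomorphUnitSphereProd (EuclideanSpace ℝ m)).symm_apply_apply z)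
  rw [← this]
  rfl

theorem lintegral_sign_Ioo (s : ℝ) (hs : s = 1 ∨ s = -1) (d : ℕ) :
    ∫⁻ t : ℝ, {t : ℝ | 0 < s * t ∧ s * t < 1}.indicator (fun t => ENNReal.ofReal (|t| ^ d)) t =
      ENNReal.ofReal (1 / (d + 1)) := by
  have key : ∫⁻ t in Ioo (0 : ℝ) 1, ENNReal.ofReal (t ^ d) = ENNReal.ofReal (1 / (d + 1)) := by
    rw [← ofReal_integral_eq_lintegral_ofReal, ← integral_Ioc_eq_integral_Ioo,
      ← intervalIntegral.integral_of_le zero_le_one]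
    · simp
    · exact ((continuous_pow d).continuousOn.integrableOn_Icc (a := (0 : ℝ)) (b := 1)).mono_set
        Ioo_subset_Icc_self
    · filter_upwards [ae_restrict_mem measurableSet_Ioo] with t ht
      exact pow_nonneg ht.1.le _
  have e : ∫⁻ t : ℝ, (Ioo (0 : ℝ) 1).indicator (fun t => ENNReal.ofReal (|t| ^ d)) t =
      ENNReal.ofReal (1 / (d + 1)) := by
    rw [lintegral_indicator measurableSet_Ioo, ← key]
    exact setLIntegral_congr_fun measurableSet_Ioo fun t ht => by simp only [abs_of_pos ht.1]
  rw [← e]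
  rcases hs with rfl | rfl
  · simp only [one_mul]
    rfl
  · rw [← (Measure.measurePreserving_neg (volume : Measure ℝ)).lintegral_comp_emb
      (MeasurableEquiv.neg ℝ).measurableEmbedding
      ((Ioo (0 : ℝ) 1).indicator (fun t => ENNReal.ofReal (|t| ^ d)))]
    refine lintegral_congr fun t => ?_
    simp only [Set.indicator, neg_mul, one_mul, mem_Ioo, abs_neg, mem_ofPred_eq]

/-- Central projection of the hyperplane `z p = s` to the sphere. -/
def gnomonic (p : m) (s : ℝ) (v : {q : m // q ≠ p} → ℝ) :
    Metric.sphere (0 : EuclideanSpace ℝ m) 1 :=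
  sphereDir p (s • insertCoord p 1 v)

theorem measurable_gnomonic (p : m) (s : ℝ) : Measurable (gnomonic p s) :=
  (measurable_sphereDir p).comp
    (((measurable_insertCoord p).comp (measurable_const.prodMk measurable_id)).const_smul s)

theorem coe_gnomonic (p : m) {s : ℝ} (hs : s ≠ 0) (v : {q : m // q ≠ p} → ℝ) :
    ∃ r : ℝ, 0 < r ∧ (gnomonic p s v : EuclideanSpace ℝ m) = r • s • insertCoord p 1 v := by
  have h : s • insertCoord p 1 v ≠ 0 := smul_ne_zero hs (insertCoord_ne_zero p one_ne_zero v)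
  exact ⟨_, inv_pos.2 (norm_pos_iff.2 h), coe_sphereDir p h⟩

/-- The integral of the degree-zero extension of `F` over the slab `0 < s z_p < 1` is computed
twice, by slices parallel to the hyperplane and in polar coordinates. Comparing the results gives
the Jacobian without differentiating the projection. -/
theorem lintegral_gnomonic (p : m) {s : ℝ} (hs : s = 1 ∨ s = -1)
    {F : Metric.sphere (0 : EuclideanSpace ℝ m) 1 → ℝ≥0∞} (hF : Measurable F) :
    ∫⁻ v, F (gnomonic p s v) = ∫⁻ θ in {θ | 0 < s * (θ : EuclideanSpace ℝ m) p},
      ENNReal.ofReal ((s * (θ : EuclideanSpace ℝ m) p)⁻¹ ^ Fintype.card m) * F θ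
        ∂(volume : Measure (EuclideanSpace ℝ m)).toSphere := by
  set N := Fintype.card m with hN
  have hN0 : 0 < N := Fintype.card_pos_iff.2 ⟨p⟩
  have hcard : Fintype.card {q : m // q ≠ p} = N - 1 := by
    rw [Fintype.card_subtype_compl, Fintype.card_subtype_eq]
  set R : Set (EuclideanSpace ℝ m) := {z | 0 < s * z p ∧ s * z p < 1} with hR
  have hRm : MeasurableSet R := by
    have : Measurable fun z : EuclideanSpace ℝ m => s * z p := by fun_prop
    exact this measurableSet_Ioo
  set H : EuclideanSpace ℝ m → ℝ≥0∞ := R.indicator fun z => F (sphereDir p z) with hH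
  have hHm : Measurable H := (hF.comp (measurable_sphereDir p)).indicator hRm
  have hUm : MeasurableSet {θ : Metric.sphere (0 : EuclideanSpace ℝ m) 1 |
      0 < s * (θ : EuclideanSpace ℝ m) p} := measurableSet_lt measurable_const (by fun_prop)
  -- The slice at height `t` is the hyperplane scaled by `|t|`, which contributes `|t| ^ (N - 1)`;
  -- the integral of this over the slab is `1 / N`.
  have h1 : ∫⁻ z, H z = ENNReal.ofReal (1 / N) * ∫⁻ v, F (gnomonic p s v) := by
    rw [lintegral_eq_lintegral_insertCoord p hHm]
    have e : ∀ t : ℝ, ∫⁻ w, H (insertCoord p t w) =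
        {t : ℝ | 0 < s * t ∧ s * t < 1}.indicator (fun t => ENNReal.ofReal (|t| ^ (N - 1))) t *
          ∫⁻ v, F (gnomonic p s v) := by
      intro t
      by_cases ht : 0 < s * t ∧ s * t < 1
      · rw [indicator_of_mem (by exact ht)]
        have ht0 : t ≠ 0 := by rintro rfl; simp at ht
        have e1 : ∀ w, H (insertCoord p t w) = F (sphereDir p (insertCoord p t w)) := fun w =>
          indicator_of_mem (by simpa [hR] using ht) _
        simp only [e1]
        have hm1 : Measurable fun w => F (sphereDir p (insertCoord p t w)) :=
          hF.comp ((measurable_sphereDir p).comp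
            ((measurable_insertCoord p).comp (measurable_const.prodMk measurable_id)))
        have hmap := Measure.map_addHaar_smul
          (volume : Measure ({q : m // q ≠ p} → ℝ)) ht0
        have e2 := congrArg (fun μ => ∫⁻ w, F (sphereDir p (insertCoord p t w)) ∂μ) hmap
        simp only [lintegral_smul_measure] at e2
        rw [lintegral_map hm1 (measurable_const_smul t), Module.finrank_fintype_fun_eq_card,
          hcard] at e2
        have e3 : ∀ w, F (sphereDir p (insertCoord p t (t • w))) = F (gnomonic p s w) := by
          intro w
          rw [insertCoord_smul, gnomonic]
          congr 1
          have : t = (s * t) * s := by rcases hs with rfl | rfl <;> ring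
          conv_lhs => rw [this, mul_smul]
          exact sphereDir_smul p ht.1 _
        simp only [e3] at e2
        rw [e2, smul_eq_mul, ← mul_assoc, ← ENNReal.ofReal_mul (by positivity), abs_inv, abs_pow,
          mul_inv_cancel₀ (pow_ne_zero _ (abs_ne_zero.2 ht0)), ENNReal.ofReal_one, one_mul]
      · rw [indicator_of_notMem (by exact ht), zero_mul]
        have e1 : ∀ w, H (insertCoord p t w) = 0 := fun w =>
          indicator_of_notMem (by simpa [hR] using ht) _
        simp [e1]
    simp only [e]
    have hst : Measurable fun t : ℝ => s * t := by fun_prop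
    have hSm : MeasurableSet {t : ℝ | 0 < s * t ∧ s * t < 1} := hst measurableSet_Ioo
    rw [lintegral_mul_const _ (Measurable.indicator (by fun_prop) hSm),
      lintegral_sign_Ioo s hs]
    congr 3
    rw [Nat.cast_pred hN0]; ring
  -- The ray in direction `θ` meets the slab for `r < (s θ_p)⁻¹`, and `∫ r ^ (N - 1)` up to there is
  -- `(s θ_p)⁻¹ ^ N / N`.
  have h2 : ∫⁻ z, H z = ENNReal.ofReal (1 / N) *
      ∫⁻ θ in {θ | 0 < s * (θ : EuclideanSpace ℝ m) p},
      ENNReal.ofReal ((s * (θ : EuclideanSpace ℝ m) p)⁻¹ ^ N) * F θ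
        ∂(volume : Measure (EuclideanSpace ℝ m)).toSphere := by
    rw [lintegral_eq_lintegral_polar p hHm, ← lintegral_const_mul' _ _ (by simp),
      ← lintegral_indicator hUm]
    refine lintegral_congr fun θ => ?_
    by_cases hθ : 0 < s * (θ : EuclideanSpace ℝ m) p
    · rw [indicator_of_mem (by exact hθ)]
      set c := s * (θ : EuclideanSpace ℝ m) p with hc
      have e1 : ∀ r : Ioi (0 : ℝ), H (r.1 • (θ : EuclideanSpace ℝ m)) =
          (Iio (⟨c⁻¹, inv_pos.2 hθ⟩ : Ioi (0 : ℝ))).indicator (fun _ => F θ) r := by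
        intro r
        have hr : 0 < r.1 := r.2
        have hd : sphereDir p (r.1 • (θ : EuclideanSpace ℝ m)) = θ := by
          rw [sphereDir_smul p hr, sphereDir_coe]
        by_cases hrc : r.1 < c⁻¹
        · rw [indicator_of_mem (by exact hrc), hH, indicator_of_mem, hd]
          have : s * (r.1 * (θ : EuclideanSpace ℝ m) p) = r.1 * c := by rw [hc]; ring
          simp only [hR, mem_ofPred_eq, PiLp.smul_apply, smul_eq_mul, this]
          refine ⟨by positivity, ?_⟩
          calc r.1 * c < c⁻¹ * c := by gcongr
            _ = 1 := inv_mul_cancel₀ hθ.ne'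
        · rw [indicator_of_notMem (by exact hrc), hH, indicator_of_notMem]
          have : s * (r.1 * (θ : EuclideanSpace ℝ m) p) = r.1 * c := by rw [hc]; ring
          simp only [hR, mem_ofPred_eq, PiLp.smul_apply, smul_eq_mul, this, not_and, not_lt]
          intro _
          calc 1 = c⁻¹ * c := (inv_mul_cancel₀ hθ.ne').symm
            _ ≤ r.1 * c := by gcongr; exact not_lt.1 hrc
      simp only [e1]
      rw [lintegral_indicator measurableSet_Iio, setLIntegral_const,
        Measure.volumeIoiPow_apply_Iio, ← hN, Nat.sub_add_cancel hN0, Nat.cast_pred hN0, mul_comm,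
        ← mul_assoc, ← ENNReal.ofReal_mul (by positivity)]
      congr 2
      simp; ring
    · rw [indicator_of_notMem (by exact hθ)]
      have e1 : ∀ r : Ioi (0 : ℝ), H (r.1 • (θ : EuclideanSpace ℝ m)) = 0 := by
        intro r
        have hr : 0 < r.1 := r.2
        refine indicator_of_notMem ?_ _
        simp only [hR, mem_ofPred_eq, PiLp.smul_apply, smul_eq_mul, not_and_or]
        left
        rw [mul_left_comm]
        exact fun h => hθ ((mul_pos_iff_of_pos_left hr).1 h)
      simp [e1]
  rw [h1] at h2
  have hne : ENNReal.ofReal (1 / N) ≠ 0 := by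
    simp only [ne_eq, ENNReal.ofReal_eq_zero, not_le]; positivity
  exact (ENNReal.mul_right_inj hne (by simp)).1 h2

end Chart

/-! ### Fourier analysis on a patch of the sphere -/

section Patch

variable {m : Type*} [Fintype m]

/-- The part of the sphere where `s θ_p ≥ c`. -/
def spherePatch (p : m) (s c : ℝ) : Set (Metric.sphere (0 : EuclideanSpace ℝ m) 1) :=
  {θ | c ≤ s * (θ : EuclideanSpace ℝ m) p}

theorem measurableSet_spherePatch (p : m) (s c : ℝ) : MeasurableSet (spherePatch p s c) :=
  measurableSet_le measurable_const (by fun_prop)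

theorem abs_sphere_apply_le_one (θ : Metric.sphere (0 : EuclideanSpace ℝ m) 1) (q : m) :
    |(θ : EuclideanSpace ℝ m) q| ≤ 1 := by
  have h := PiLp.norm_apply_le (p := 2) (θ : EuclideanSpace ℝ m) q
  rw [Real.norm_eq_abs] at h
  exact h.trans (by simp)

variable [DecidableEq m]

/-- Parametrization of `spherePatch p s c` by a subset of the unit cube. -/
def patchChart (p : m) (s c : ℝ) (x : {q : m // q ≠ p} → ℝ) :
    Metric.sphere (0 : EuclideanSpace ℝ m) 1 :=
  gnomonic p s ((c / 4)⁻¹ • x)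

/-- The density of the surface measure in the coordinates given by `patchChart`. -/
def patchJac (p : m) (s c : ℝ) (x : {q : m // q ≠ p} → ℝ) : ℝ≥0 :=
  Real.toNNReal ((c / 4)⁻¹ ^ (Fintype.card m - 1) *
    (s * (patchChart p s c x : EuclideanSpace ℝ m) p) ^ Fintype.card m)

/-- The character `exp (-2 π i (c / 4) ∑ ξ_q z_q / z_p)` in the coordinates given by
`patchChart`. -/
def patchChar (p : m) (c : ℝ) (ξ : {q : m // q ≠ p} → ℤ) (z : EuclideanSpace ℝ m) : ℂ :=
  Complex.exp (-(2 * Real.pi * (∑ q, ξ q * (c / 4 * (z q / z p)) : ℝ) * Complex.I))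

theorem measurable_patchChart (p : m) (s c : ℝ) : Measurable (patchChart p s c) :=
  (measurable_gnomonic p s).comp (measurable_const_smul _)

theorem measurable_patchJac (p : m) (s c : ℝ) : Measurable (patchJac p s c) := by
  have h : Measurable fun x => (patchChart p s c x : EuclideanSpace ℝ m) p :=
    (by fun_prop : Measurable fun θ : Metric.sphere (0 : EuclideanSpace ℝ m) 1 =>
      (θ : EuclideanSpace ℝ m) p).comp (measurable_patchChart p s c)
  exact (((h.const_mul s).pow_const _).const_mul _).real_toNNReal

theorem patchChart_apply_pos (p : m) {s : ℝ} (hs : s = 1 ∨ s = -1) (c : ℝ)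
    (x : {q : m // q ≠ p} → ℝ) : 0 < s * (patchChart p s c x : EuclideanSpace ℝ m) p := by
  have hs0 : s ≠ 0 := by rcases hs with rfl | rfl <;> norm_num
  obtain ⟨r, hr, h⟩ := coe_gnomonic p hs0 ((c / 4)⁻¹ • x)
  rw [patchChart, h]
  simp only [PiLp.smul_apply, insertCoord_self, smul_eq_mul, mul_one]
  have : s * (r * s) = r * (s * s) := by ring
  rw [this]
  have : 0 < s * s := mul_self_pos.2 hs0
  positivity

theorem patchChart_apply_div (p : m) {s : ℝ} (hs : s = 1 ∨ s = -1) {c : ℝ} (hc : 0 < c)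
    (x : {q : m // q ≠ p} → ℝ) (q : {q : m // q ≠ p}) :
    c / 4 * ((patchChart p s c x : EuclideanSpace ℝ m) q /
      (patchChart p s c x : EuclideanSpace ℝ m) p) = x q := by
  have hs0 : s ≠ 0 := by rcases hs with rfl | rfl <;> norm_num
  obtain ⟨r, hr, h⟩ := coe_gnomonic p hs0 ((c / 4)⁻¹ • x)
  rw [patchChart, h]
  simp only [PiLp.smul_apply, insertCoord_self, insertCoord_coe, smul_eq_mul, mul_one,
    Pi.smul_apply]
  field_simp

theorem patchChar_patchChart (p : m) {s : ℝ} (hs : s = 1 ∨ s = -1) {c : ℝ} (hc : 0 < c)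
    (ξ : {q : m // q ≠ p} → ℤ) (x : {q : m // q ≠ p} → ℝ) :
    patchChar p c ξ (patchChart p s c x) = cubeChar ξ x := by
  simp only [patchChar, cubeChar, patchChart_apply_div p hs hc]

/-- On the patch `|θ_q / θ_p| ≤ 1 / c`, so the scale `c / 4` keeps every coordinate within `1 / 4`,
in the interior of the cube. -/
theorem preimage_spherePatch_subset (p : m) {s : ℝ} (hs : s = 1 ∨ s = -1) {c : ℝ} (hc : 0 < c) :
    patchChart p s c ⁻¹' spherePatch p s c ⊆ unitCube {q : m // q ≠ p} := by
  intro x hx q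
  have hx' : c ≤ s * (patchChart p s c x : EuclideanSpace ℝ m) p := hx
  have h1 := patchChart_apply_div p hs hc x q
  have h2 := abs_sphere_apply_le_one (patchChart p s c x) q
  have h3 : c ≤ |(patchChart p s c x : EuclideanSpace ℝ m) p| := by
    have h4 : |s| = 1 := by rcases hs with rfl | rfl <;> simp
    calc c ≤ |s * (patchChart p s c x : EuclideanSpace ℝ m) p| := hx'.trans (le_abs_self _)
      _ = _ := by rw [abs_mul, h4, one_mul]
  have h5 : |x q| ≤ 1 / 4 := by
    rw [← h1, abs_mul, abs_of_pos (by positivity : 0 < c / 4), abs_div]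
    calc c / 4 * (|(patchChart p s c x : EuclideanSpace ℝ m) q| /
          |(patchChart p s c x : EuclideanSpace ℝ m) p|) ≤ c / 4 * (1 / c) := by gcongr
      _ = 1 / 4 := by field_simp
  rw [abs_le] at h5
  constructor <;> linarith [h5.1, h5.2]

theorem patchJac_le (p : m) {s : ℝ} (hs : s = 1 ∨ s = -1) {c : ℝ} (hc : 0 < c)
    (x : {q : m // q ≠ p} → ℝ) :
    patchJac p s c x ≤ Real.toNNReal ((c / 4)⁻¹ ^ (Fintype.card m - 1)) := by
  refine Real.toNNReal_le_toNNReal (mul_le_of_le_one_right (by positivity) ?_)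
  refine pow_le_one₀ (patchChart_apply_pos p hs c x).le ?_
  have h4 : |s| = 1 := by rcases hs with rfl | rfl <;> simp
  calc _ ≤ |s * (patchChart p s c x : EuclideanSpace ℝ m) p| := le_abs_self _
    _ ≤ 1 := by rw [abs_mul, h4, one_mul]; exact abs_sphere_apply_le_one _ _

theorem le_patchJac (p : m) {s : ℝ} {c : ℝ} (hc : 0 < c)
    {x : {q : m // q ≠ p} → ℝ} (hx : patchChart p s c x ∈ spherePatch p s c) :
    Real.toNNReal ((c / 4)⁻¹ ^ (Fintype.card m - 1) * c ^ Fintype.card m) ≤ patchJac p s c x := by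
  have hx' : c ≤ s * (patchChart p s c x : EuclideanSpace ℝ m) p := hx
  exact Real.toNNReal_le_toNNReal (by gcongr)

/-- The factor `(s θ_p) ^ N` put into `F` cancels the density from `lintegral_gnomonic`; the
dilation by `(c / 4)⁻¹` contributes the remaining constant of the Jacobian. -/
theorem setLIntegral_spherePatch (p : m) {s : ℝ} (hs : s = 1 ∨ s = -1) {c : ℝ} (hc : 0 < c)
    {f : Metric.sphere (0 : EuclideanSpace ℝ m) 1 → ℝ≥0∞} (hf : Measurable f) :
    ∫⁻ θ in spherePatch p s c, f θ ∂(volume : Measure (EuclideanSpace ℝ m)).toSphere =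
      ∫⁻ x in patchChart p s c ⁻¹' spherePatch p s c,
        patchJac p s c x * f (patchChart p s c x) := by
  set N := Fintype.card m with hN
  have hcard : Fintype.card {q : m // q ≠ p} = N - 1 := by
    rw [Fintype.card_subtype_compl, Fintype.card_subtype_eq]
  have hκ : (c / 4)⁻¹ ≠ 0 := by positivity
  set F : Metric.sphere (0 : EuclideanSpace ℝ m) 1 → ℝ≥0∞ := (spherePatch p s c).indicator
    fun θ => ENNReal.ofReal ((s * (θ : EuclideanSpace ℝ m) p) ^ N) * f θ with hF
  have hFm : Measurable F :=
    Measurable.indicator (by fun_prop) (measurableSet_spherePatch p s c)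
  have hUm : MeasurableSet {θ : Metric.sphere (0 : EuclideanSpace ℝ m) 1 |
      0 < s * (θ : EuclideanSpace ℝ m) p} := measurableSet_lt measurable_const (by fun_prop)
  have h := lintegral_gnomonic p hs hFm
  have hR : ∫⁻ θ in {θ | 0 < s * (θ : EuclideanSpace ℝ m) p},
      ENNReal.ofReal ((s * (θ : EuclideanSpace ℝ m) p)⁻¹ ^ N) * F θ
        ∂(volume : Measure (EuclideanSpace ℝ m)).toSphere =
      ∫⁻ θ in spherePatch p s c, f θ ∂(volume : Measure (EuclideanSpace ℝ m)).toSphere := by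
    rw [← lintegral_indicator hUm, ← lintegral_indicator (measurableSet_spherePatch p s c)]
    refine lintegral_congr fun θ => ?_
    by_cases hθ : θ ∈ spherePatch p s c
    · have hθ' : c ≤ s * (θ : EuclideanSpace ℝ m) p := hθ
      have h0 : 0 < s * (θ : EuclideanSpace ℝ m) p := hc.trans_le hθ'
      rw [indicator_of_mem (by exact h0), indicator_of_mem hθ, hF, indicator_of_mem hθ,
        ← mul_assoc, ← ENNReal.ofReal_mul (by positivity), ← mul_pow, inv_mul_cancel₀ h0.ne']
      simp
    · rw [indicator_of_notMem hθ, hF]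
      simp [Set.indicator, hθ]
  rw [hR] at h
  rw [← h]
  have hmap := Measure.map_addHaar_smul (volume : Measure ({q : m // q ≠ p} → ℝ)) hκ
  have e2 := congrArg (fun μ => ∫⁻ w, F (gnomonic p s w) ∂μ) hmap
  simp only [lintegral_smul_measure] at e2
  rw [lintegral_map (f := fun w => F (gnomonic p s w)) (hFm.comp (measurable_gnomonic p s))
      (measurable_const_smul _),
    Module.finrank_fintype_fun_eq_card, hcard] at e2
  have e3 : ∫⁻ w, F (gnomonic p s w) =
      ENNReal.ofReal ((c / 4)⁻¹ ^ (N - 1)) * ∫⁻ x, F (patchChart p s c x) := by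
    simp only [patchChart]
    rw [e2, smul_eq_mul, ← mul_assoc, ← ENNReal.ofReal_mul (by positivity), abs_inv, abs_pow,
      abs_of_pos (by positivity : 0 < (c / 4)⁻¹), mul_inv_cancel₀ (pow_ne_zero _ hκ),
      ENNReal.ofReal_one, one_mul]
  rw [e3, ← lintegral_const_mul' _ _ (by simp), ← lintegral_indicator
    (measurable_patchChart p s c (measurableSet_spherePatch p s c))]
  refine lintegral_congr fun x => ?_
  by_cases hx : patchChart p s c x ∈ spherePatch p s c
  · rw [indicator_of_mem (by exact hx), hF, indicator_of_mem hx, ← mul_assoc,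
      ← ENNReal.ofReal_mul (by positivity)]
    rfl
  · rw [indicator_of_notMem (by exact hx), hF, indicator_of_notMem hx, mul_zero]

/-- As an identity of measures, the change of variables extends to integrands that are only a.e.
measurable. -/
theorem map_patchChart (p : m) {s : ℝ} (hs : s = 1 ∨ s = -1) {c : ℝ} (hc : 0 < c) :
    ((volume.restrict (patchChart p s c ⁻¹' spherePatch p s c)).withDensity
        fun x => (patchJac p s c x : ℝ≥0∞)).map (patchChart p s c) =
      (volume : Measure (EuclideanSpace ℝ m)).toSphere.restrict (spherePatch p s c) := by
  refine Measure.ext_of_lintegral _ fun f hf => ?_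
  rw [lintegral_map hf (measurable_patchChart p s c), setLIntegral_spherePatch p hs hc hf,
    lintegral_withDensity_eq_lintegral_mul_non_measurable _
      (measurable_patchJac p s c).coe_nnreal_ennreal (by simp)]
  rfl

variable {p : m} {s c : ℝ}

/-- The Jacobian is bounded below on the preimage of the patch, so Lebesgue measure there is
absolutely continuous with respect to the weighted measure, and null sets cause no trouble in the
pullback. -/
theorem aestronglyMeasurable_comp_patchChart (hs : s = 1 ∨ s = -1) (hc : 0 < c)
    {f : Metric.sphere (0 : EuclideanSpace ℝ m) 1 → ℂ}
    (hf : AEStronglyMeasurable f (volume : Measure (EuclideanSpace ℝ m)).toSphere)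
    (h0 : ∀ θ ∉ spherePatch p s c, f θ = 0) :
    AEStronglyMeasurable (f ∘ patchChart p s c) volume := by
  have h1 := hf.restrict (s := spherePatch p s c)
  rw [← map_patchChart p hs hc] at h1
  have h2 := h1.comp_measurable (measurable_patchChart p s c)
  have h3 : AEStronglyMeasurable (f ∘ patchChart p s c)
      (volume.restrict (patchChart p s c ⁻¹' spherePatch p s c)) := by
    refine h2.mono_ac (withDensity_absolutelyContinuous'
      (measurable_patchJac p s c).coe_nnreal_ennreal.aemeasurable ?_)
    filter_upwards [ae_restrict_mem
      (measurable_patchChart p s c (measurableSet_spherePatch p s c))] with x hx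
    have := le_patchJac p hc hx
    rw [ENNReal.coe_ne_zero]
    refine (lt_of_lt_of_le ?_ this).ne'
    rw [Real.toNNReal_pos]
    positivity
  have h4 := (aestronglyMeasurable_indicator_iff
    (measurable_patchChart p s c (measurableSet_spherePatch p s c))).2 h3
  refine h4.congr (ae_of_all _ fun x => ?_)
  by_cases hx : patchChart p s c x ∈ spherePatch p s c
  · rw [indicator_of_mem (by exact hx)]
  · rw [indicator_of_notMem (by exact hx), Function.comp, h0 _ hx]

theorem lintegral_eq_lintegral_unitCube (hs : s = 1 ∨ s = -1) (hc : 0 < c)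
    {f : Metric.sphere (0 : EuclideanSpace ℝ m) 1 → ℝ≥0∞}
    (hf : AEMeasurable f (volume : Measure (EuclideanSpace ℝ m)).toSphere)
    (h0 : ∀ θ ∉ spherePatch p s c, f θ = 0) :
    ∫⁻ θ, f θ ∂(volume : Measure (EuclideanSpace ℝ m)).toSphere =
      ∫⁻ x in unitCube {q : m // q ≠ p}, patchJac p s c x * f (patchChart p s c x) := by
  have hUm := measurable_patchChart p s c (measurableSet_spherePatch p s c)
  rw [← setLIntegral_eq_of_support_subset (s := spherePatch p s c) (by
    intro θ hθ; by_contra hn; exact hθ (h0 θ hn))]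
  have h1 := hf.restrict (s := spherePatch p s c)
  rw [← map_patchChart p hs hc] at h1 ⊢
  rw [lintegral_map' h1 (measurable_patchChart p s c).aemeasurable,
    lintegral_withDensity_eq_lintegral_mul_non_measurable _
      (measurable_patchJac p s c).coe_nnreal_ennreal (by simp)]
  rw [← lintegral_indicator hUm, ← lintegral_indicator (measurableSet_unitCube _)]
  refine lintegral_congr fun x => ?_
  by_cases hx : patchChart p s c x ∈ spherePatch p s c
  · rw [indicator_of_mem (by exact hx),
      indicator_of_mem (preimage_spherePatch_subset p hs hc hx)]
    rfl
  · rw [indicator_of_notMem (by exact hx)]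
    simp [Set.indicator, h0 _ hx]

theorem integral_eq_integral_unitCube (hs : s = 1 ∨ s = -1) (hc : 0 < c)
    {f : Metric.sphere (0 : EuclideanSpace ℝ m) 1 → ℂ}
    (hf : AEStronglyMeasurable f (volume : Measure (EuclideanSpace ℝ m)).toSphere)
    (h0 : ∀ θ ∉ spherePatch p s c, f θ = 0) :
    ∫ θ, f θ ∂(volume : Measure (EuclideanSpace ℝ m)).toSphere =
      ∫ x in unitCube {q : m // q ≠ p}, (patchJac p s c x : ℂ) * f (patchChart p s c x) := by
  have hUm := measurable_patchChart p s c (measurableSet_spherePatch p s c)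
  rw [← setIntegral_eq_integral_of_forall_compl_eq_zero (s := spherePatch p s c) h0]
  have h1 := hf.restrict (s := spherePatch p s c)
  rw [← map_patchChart p hs hc] at h1 ⊢
  rw [integral_map (measurable_patchChart p s c).aemeasurable h1,
    integral_withDensity_eq_integral_toReal_smul
      (measurable_patchJac p s c).coe_nnreal_ennreal (by simp)]
  rw [← integral_indicator hUm, ← integral_indicator (measurableSet_unitCube _)]
  refine integral_congr_ae (ae_of_all _ fun x => ?_)
  by_cases hx : patchChart p s c x ∈ spherePatch p s c
  · rw [indicator_of_mem (by exact hx),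
      indicator_of_mem (preimage_spherePatch_subset p hs hc hx)]
    simp
  · rw [indicator_of_notMem (by exact hx)]
    simp [Set.indicator, h0 _ hx]

/-- The Jacobian occurs squared on the cube, while the change of variables uses it once; the extra
factor is at most its upper bound. -/
theorem lintegral_sq_patch_le (hs : s = 1 ∨ s = -1) (hc : 0 < c)
    {f : Metric.sphere (0 : EuclideanSpace ℝ m) 1 → ℂ}
    (hf : AEStronglyMeasurable f (volume : Measure (EuclideanSpace ℝ m)).toSphere)
    (h0 : ∀ θ ∉ spherePatch p s c, f θ = 0) :
    ∫⁻ x in unitCube {q : m // q ≠ p},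
        ‖(patchJac p s c x : ℂ) * f (patchChart p s c x)‖ₑ ^ 2 ≤
      Real.toNNReal ((c / 4)⁻¹ ^ (Fintype.card m - 1)) *
        ∫⁻ θ, ‖f θ‖ₑ ^ 2 ∂(volume : Measure (EuclideanSpace ℝ m)).toSphere := by
  rw [lintegral_eq_lintegral_unitCube (p := p) hs hc (hf.enorm.pow_const 2)
    (fun θ hθ => by simp [h0 θ hθ]), ← lintegral_const_mul' _ _ ENNReal.coe_ne_top]
  refine lintegral_mono fun x => ?_
  have e : ‖(patchJac p s c x : ℂ)‖ₑ = patchJac p s c x := by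
    rw [enorm_eq_nnnorm]
    congr 1
    ext
    simp
  rw [enorm_mul, mul_pow, e, sq (patchJac p s c x : ℝ≥0∞), mul_assoc]
  gcongr
  exact patchJac_le p hs hc x

theorem memLp_patch (hs : s = 1 ∨ s = -1) (hc : 0 < c)
    {f : Metric.sphere (0 : EuclideanSpace ℝ m) 1 → ℂ}
    (hf : MemLp f 2 (volume : Measure (EuclideanSpace ℝ m)).toSphere)
    (h0 : ∀ θ ∉ spherePatch p s c, f θ = 0) :
    MemLp (fun x => (patchJac p s c x : ℂ) * f (patchChart p s c x)) 2
      (volume.restrict (unitCube {q : m // q ≠ p})) := by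
  refine ⟨?_, ?_⟩
  · have h1 := (aestronglyMeasurable_comp_patchChart hs hc hf.1 h0).restrict
      (s := unitCube {q : m // q ≠ p})
    refine AEStronglyMeasurable.mul ?_ h1
    have : Measurable fun x => ((patchJac p s c x : ℝ) : ℂ) :=
      Complex.measurable_ofReal.comp (measurable_patchJac p s c).coe_nnreal_real
    exact this.aestronglyMeasurable
  · have h1 := lintegral_sq_patch_le (p := p) hs hc hf.1 h0
    have h2 : ∫⁻ θ, ‖f θ‖ₑ ^ 2 ∂(volume : Measure (EuclideanSpace ℝ m)).toSphere < ⊤ := by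
      rw [← eLpNorm_two_sq]
      exact ENNReal.pow_lt_top hf.2
    have h3 := h1.trans_lt (ENNReal.mul_lt_top ENNReal.coe_lt_top h2)
    rw [← eLpNorm_two_sq] at h3
    exact lt_top_iff_ne_top.2 fun h => by simp [h] at h3

/-- This is why `f` is multiplied by the Jacobian: its cube coefficients become integrals over the
sphere, where rotation fields can be transposed onto the character. -/
theorem cubeCoeff_patch (hs : s = 1 ∨ s = -1) (hc : 0 < c)
    {f : Metric.sphere (0 : EuclideanSpace ℝ m) 1 → ℂ}
    (hf : AEStronglyMeasurable f (volume : Measure (EuclideanSpace ℝ m)).toSphere)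
    (h0 : ∀ θ ∉ spherePatch p s c, f θ = 0) (ξ : {q : m // q ≠ p} → ℤ) :
    cubeCoeff (fun x => (patchJac p s c x : ℂ) * f (patchChart p s c x)) ξ =
      ∫ θ, patchChar p c ξ θ * f θ ∂(volume : Measure (EuclideanSpace ℝ m)).toSphere := by
  have hm : Measurable fun θ : Metric.sphere (0 : EuclideanSpace ℝ m) 1 =>
      patchChar p c ξ (θ : EuclideanSpace ℝ m) := by
    unfold patchChar
    fun_prop
  rw [integral_eq_integral_unitCube (p := p) (f := fun θ => patchChar p c ξ θ * f θ) hs hc (hm.aestronglyMeasurable.mul hf)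
    (fun θ hθ => by simp [h0 θ hθ]), cubeCoeff]
  refine integral_congr_ae (ae_of_all _ fun x => ?_)
  simp only [patchChar_patchChart p hs hc]
  ring

/-- Bessel's inequality for the characters of a patch of the sphere. -/
theorem tsum_enorm_sq_patch_le (hs : s = 1 ∨ s = -1) (hc : 0 < c)
    {f : Metric.sphere (0 : EuclideanSpace ℝ m) 1 → ℂ}
    (hf : MemLp f 2 (volume : Measure (EuclideanSpace ℝ m)).toSphere)
    (h0 : ∀ θ ∉ spherePatch p s c, f θ = 0) :
    ∑' ξ : {q : m // q ≠ p} → ℤ,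
        ‖∫ θ, patchChar p c ξ θ * f θ ∂(volume : Measure (EuclideanSpace ℝ m)).toSphere‖ₑ ^ 2 ≤
      Real.toNNReal ((c / 4)⁻¹ ^ (Fintype.card m - 1)) *
        ∫⁻ θ, ‖f θ‖ₑ ^ 2 ∂(volume : Measure (EuclideanSpace ℝ m)).toSphere := by
  simp only [← cubeCoeff_patch hs hc hf.1 h0]
  rw [tsum_enorm_sq_cubeCoeff (memLp_patch hs hc hf h0)]
  exact lintegral_sq_patch_le hs hc hf.1 h0

/-- Product estimate in `L²` of a patch of the sphere. -/
theorem lintegral_prod_patch_le (hs : s = 1 ∨ s = -1) (hc : 0 < c) {κ : Type*} [Fintype κ]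
    [Nonempty κ] {M : ℕ} (hM : Fintype.card m - 1 < 2 * M) {b : κ → ℕ} (hb : ∑ i, b i ≤ M) :
    ∃ C : ℝ≥0, ∀ f : κ → Metric.sphere (0 : EuclideanSpace ℝ m) 1 → ℂ,
      (∀ i, MemLp (f i) 2 (volume : Measure (EuclideanSpace ℝ m)).toSphere) →
      (∀ i, ∀ θ ∉ spherePatch p s c, f i θ = 0) →
      ∫⁻ θ, ∏ i, ‖f i θ‖ₑ ^ 2 ∂(volume : Measure (EuclideanSpace ℝ m)).toSphere ≤
        C * ∏ i, ∑' ξ : {q : m // q ≠ p} → ℤ, (freqSize ξ : ℝ≥0∞) ^ (2 * (M - b i)) *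
          ‖∫ θ, patchChar p c ξ θ * f i θ
            ∂(volume : Measure (EuclideanSpace ℝ m)).toSphere‖ₑ ^ 2 := by
  have hcard : Fintype.card {q : m // q ≠ p} = Fintype.card m - 1 := by
    rw [Fintype.card_subtype_compl, Fintype.card_subtype_eq]
  obtain ⟨C, hC⟩ := lintegral_prod_le_cubeCoeff (ι := {q : m // q ≠ p}) (by rwa [hcard]) hb
  set j₀ : ℝ≥0 := Real.toNNReal ((c / 4)⁻¹ ^ (Fintype.card m - 1) * c ^ Fintype.card m) with hj₀
  set j₁ : ℝ≥0 := Real.toNNReal ((c / 4)⁻¹ ^ (Fintype.card m - 1)) with hj₁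
  have hj₀0 : 0 < j₀ := by rw [hj₀, Real.toNNReal_pos]; positivity
  -- The cube estimate applies to the Jacobian times `f i`. Removing the Jacobian from each squared
  -- factor costs `j₀⁻¹ ^ 2`, and the one in the change of variables costs `j₁`.
  refine ⟨j₁ * (∏ _i : κ, (j₀⁻¹) ^ 2) * C, fun f hf h0 => ?_⟩
  have h1 := hC (fun i x => (patchJac p s c x : ℂ) * f i (patchChart p s c x))
    (fun i => memLp_patch hs hc (hf i) (h0 i))
  simp only [cubeCoeff_patch hs hc (hf _).1 (h0 _)] at h1
  rw [lintegral_eq_lintegral_unitCube (p := p) hs hc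
    (Finset.aemeasurable_fun_prod _ fun i _ => (hf i).1.enorm.pow_const 2)
    (fun θ hθ => Finset.prod_eq_zero (Finset.mem_univ (Classical.arbitrary κ))
      (by simp [h0 _ θ hθ]))]
  push_cast
  rw [mul_assoc]
  refine le_trans ?_ (mul_le_mul_right h1 _)
  rw [← lintegral_const_mul' _ _ (ENNReal.mul_ne_top ENNReal.coe_ne_top
    (ENNReal.prod_ne_top fun _ _ => ENNReal.pow_ne_top ENNReal.coe_ne_top))]
  refine lintegral_mono fun x => ?_
  by_cases hx : patchChart p s c x ∈ spherePatch p s c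
  · rw [mul_assoc, ← Finset.prod_mul_distrib]
    refine mul_le_mul' (ENNReal.coe_le_coe.2 (patchJac_le p hs hc x))
      (Finset.prod_le_prod' fun i _ => ?_)
    have e : ‖(patchJac p s c x : ℂ)‖ₑ = patchJac p s c x := by
      rw [enorm_eq_nnnorm]
      congr 1
      ext
      simp
    rw [enorm_mul, mul_pow, e, ← mul_assoc, ← mul_pow]
    refine le_mul_of_one_le_left' (one_le_pow₀ ?_)
    have h2 : j₀ ≤ patchJac p s c x := le_patchJac p hc hx
    rw [← ENNReal.coe_mul, ← ENNReal.coe_one, ENNReal.coe_le_coe]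
    calc (1 : ℝ≥0) = j₀⁻¹ * j₀ := (inv_mul_cancel₀ hj₀0.ne').symm
      _ ≤ _ := by gcongr
  · rw [Finset.prod_eq_zero (Finset.mem_univ (Classical.arbitrary κ)) (by simp [h0 _ _ hx])]
    simp

end Patch

/-! ### Weak derivatives tested against products of radial and angular functions -/

section Separable

variable {n : ℕ} {α a : ℝ}

/-- The derivative along the rotation field `z_p ∂_q - z_q ∂_p`. -/
def rotField {F : Type*} [NormedAddCommGroup F] [NormedSpace ℝ F]
    (pq : Fin (n - 1) × Fin (n - 1)) (h : Ambient n → F) (z : Ambient n) : F :=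
  fderiv ℝ h z (z pq.1 • EuclideanSpace.single pq.2 (1 : ℝ) -
    z pq.2 • EuclideanSpace.single pq.1 (1 : ℝ))

theorem contDiff_rotField {F : Type*} [NormedAddCommGroup F] [NormedSpace ℝ F]
    (pq : Fin (n - 1) × Fin (n - 1)) {h : Ambient n → F} (hh : ContDiff ℝ ∞ h) :
    ContDiff ℝ ∞ (rotField pq h) := by
  refine (hh.fderiv_right (m := ∞) (by simp)).clm_apply ?_
  fun_prop

theorem tsupport_rotField_subset {F : Type*} [NormedAddCommGroup F] [NormedSpace ℝ F]
    (pq : Fin (n - 1) × Fin (n - 1)) (h : Ambient n → F) :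
    tsupport (rotField pq h) ⊆ tsupport h := by
  refine (closure_mono ?_).trans (tsupport_fderiv_subset ℝ (f := h))
  intro z hz hz'
  exact hz (by simp [rotField, hz'])

theorem hasCompactSupport_rotField {F : Type*} [NormedAddCommGroup F] [NormedSpace ℝ F]
    (pq : Fin (n - 1) × Fin (n - 1)) {h : Ambient n → F} (hc : HasCompactSupport h) :
    HasCompactSupport (rotField pq h) :=
  hc.mono' (subset_closure.trans (tsupport_rotField_subset pq h))

/-- The function `(x, z) ↦ φ x * h z`. -/
def sepTest (φ : ℝ → ℝ) (h : Ambient n → ℝ) : ℝ × Ambient n → ℝ := fun z => φ z.1 * h z.2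

theorem isTestFn_sepTest {φ : ℝ → ℝ} (hφ : IsTestFn1 a φ) {h : Ambient n → ℝ}
    (hh : ContDiff ℝ ∞ h) (hc : HasCompactSupport h) : IsTestFn n a (sepTest φ h) := by
  have hs : tsupport (sepTest φ h) ⊆ tsupport φ ×ˢ tsupport h := by
    refine closure_minimal ?_ ((isClosed_tsupport φ).prod (isClosed_tsupport h))
    intro z hz
    have hz' : φ z.1 * h z.2 ≠ 0 := hz
    exact ⟨subset_tsupport _ (left_ne_zero_of_mul hz'), subset_tsupport _ (right_ne_zero_of_mul hz')⟩
  refine ⟨(hφ.smooth.comp contDiff_fst).mul (hh.comp contDiff_snd), ?_,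
    hs.trans (prod_mono hφ.supp (subset_univ _))⟩
  exact IsCompact.of_isClosed_subset (hφ.compact.isCompact.prod hc.isCompact)
    (isClosed_tsupport _) hs

theorem fderiv_sepTest {φ : ℝ → ℝ} (hφ : Differentiable ℝ φ) {h : Ambient n → ℝ}
    (hh : Differentiable ℝ h) (z v : ℝ × Ambient n) :
    fderiv ℝ (sepTest φ h) z v = φ z.1 * fderiv ℝ h z.2 v.2 + deriv φ z.1 * v.1 * h z.2 := by
  have h1 := ((hφ z.1).hasFDerivAt.comp z hasFDerivAt_fst).mul
    ((hh z.2).hasFDerivAt.comp z hasFDerivAt_snd)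
  have h2 : HasFDerivAt (sepTest φ h) _ z := h1
  rw [h2.fderiv]
  simp [fderiv_eq_smul_deriv]
  ring

theorem twD_sepTest (α : ℝ) {φ : ℝ → ℝ} (hφ : Differentiable ℝ φ) {h : Ambient n → ℝ}
    (hh : Differentiable ℝ h) :
    twD α (sepTest φ h) = sepTest (fun x => deriv φ x + α / x * φ x) h := by
  ext z
  simp only [twD, fderiv_sepTest hφ hh, sepTest, map_zero]
  ring

theorem twDStar_sepTest (α : ℝ) {φ : ℝ → ℝ} (hφ : Differentiable ℝ φ) {h : Ambient n → ℝ}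
    (hh : Differentiable ℝ h) :
    twDStar α (sepTest φ h) = sepTest (fun x => -deriv φ x + (α - 1) / x * φ x) h := by
  ext z
  simp only [twDStar, fderiv_sepTest hφ hh, sepTest, map_zero]
  ring

theorem rotD_sepTest (pq : Fin (n - 1) × Fin (n - 1)) {φ : ℝ → ℝ} (hφ : Differentiable ℝ φ)
    {h : Ambient n → ℝ} (hh : Differentiable ℝ h) :
    rotD pq (sepTest φ h) = sepTest φ (rotField pq h) := by
  ext z
  simp only [rotD, fderiv_sepTest hφ hh, sepTest, rotField]
  ring

theorem IsTestFn1.differentiable {φ : ℝ → ℝ} (hφ : IsTestFn1 a φ) : Differentiable ℝ φ :=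
  hφ.smooth.differentiable (by simp)

theorem IsTestFn1.div_mul {φ : ℝ → ℝ} (hφ : IsTestFn1 a φ) (c : ℝ) :
    IsTestFn1 a (fun x => c / x * φ x) :=
  hφ.mul_contDiffOn fun _ hx => contDiffAt_const.div contDiffAt_id hx.ne'

theorem IsTestFn1.twisted {φ : ℝ → ℝ} (hφ : IsTestFn1 a φ) (α : ℝ) :
    IsTestFn1 a (fun x => _root_.deriv φ x + α / x * φ x) :=
  hφ.deriv.add (hφ.div_mul α)

theorem IsTestFn1.twistedStar {φ : ℝ → ℝ} (hφ : IsTestFn1 a φ) (α : ℝ) :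
    IsTestFn1 a (fun x => -_root_.deriv φ x + (α - 1) / x * φ x) := by
  simpa using (hφ.deriv.const_mul (-1)).add (hφ.div_mul (α - 1))

/-- The derivative of order `k + 1` adds an outermost `D_x` for even `k` and an outermost `D_x^*`
for odd `k`; its adjoint acts on the test function first. -/
theorem twAdj_succ (α : ℝ) (k : ℕ) (φ : ℝ × Ambient n → ℝ) :
    twAdj α (k + 1) φ = twAdj α k (if Even k then twDStar α φ else twD α φ) := by
  unfold twAdj
  by_cases hk : Even k
  · have h1 : ¬ Even (k + 1) := by simpa [Nat.even_add_one] using hk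
    have h2 : (k + 1) / 2 = k / 2 := by
      obtain ⟨r, rfl⟩ := hk
      omega
    simp only [hk, h1, if_true, if_false, h2]
  · have h1 : Even (k + 1) := by simpa [Nat.even_add_one] using hk
    have h2 : (k + 1) / 2 = k / 2 + 1 := by
      obtain ⟨r, rfl⟩ := Nat.not_even_iff_odd.1 hk
      omega
    simp only [hk, h1, if_true, if_false, h2, Function.iterate_succ_apply]

/-- The point is that one `ψ` serves all `h`: radial adjoints do not see the angular factor, and
this makes radial and angular derivatives commute. -/
theorem exists_twAdj_sepTest (α : ℝ) (k : ℕ) {φ : ℝ → ℝ} (hφ : IsTestFn1 a φ) :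
    ∃ ψ, IsTestFn1 a ψ ∧ ∀ h : Ambient n → ℝ, Differentiable ℝ h →
      twAdj α k (sepTest φ h) = sepTest ψ h := by
  induction k generalizing φ with
  | zero => exact ⟨φ, hφ, fun h _ => by simp [twAdj]⟩
  | succ k ih =>
    by_cases hk : Even k
    · obtain ⟨ψ, hψ, h⟩ := ih (hφ.twistedStar α)
      refine ⟨ψ, hψ, fun g hg => ?_⟩
      rw [twAdj_succ, if_pos hk, twDStar_sepTest α hφ.differentiable hg, h g hg]
    · obtain ⟨ψ, hψ, h⟩ := ih (hφ.twisted α)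
      refine ⟨ψ, hψ, fun g hg => ?_⟩
      rw [twAdj_succ, if_neg hk, twD_sepTest α hφ.differentiable hg, h g hg]

/-- Both weak derivatives are rewritten as integrals of `u` and compared there. The head of the list
is the outermost angular derivative, so its adjoint reaches `h` before those of `J`. -/
theorem IsWeakDeriv.integral_rot {k : ℕ} {J : List (Fin (n - 1) × Fin (n - 1))}
    {pq : Fin (n - 1) × Fin (n - 1)} {u w w' : ℝ × USphere n → ℝ}
    (hw : IsWeakDeriv α a k J u w) (hw' : IsWeakDeriv α a k (pq :: J) u w')
    {φ : ℝ → ℝ} (hφ : IsTestFn1 a φ) {h : Ambient n → ℝ} (hh : ContDiff ℝ ∞ h)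
    (hc : HasCompactSupport h) :
    ∫ z, w' z * (φ z.1 * h z.2) ∂(patchMeasure n a) =
      ∫ z, w z * (φ z.1 * -rotField pq h z.2) ∂(patchMeasure n a) := by
  have h1 := hw'.2 _ (isTestFn_sepTest hφ hh hc)
  have h2 := hw.2 _ (isTestFn_sepTest hφ (contDiff_rotField pq hh).neg
    (show HasCompactSupport (-rotField pq h) from (hasCompactSupport_rotField pq hc).neg))
  obtain ⟨ψ, hψ, hψh⟩ := exists_twAdj_sepTest (n := n) α k hφ
  have hd : Differentiable ℝ h := hh.differentiable (by simp)
  rw [hψh _ ((contDiff_rotField pq hh).neg.differentiable (by simp))] at h2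
  rw [hψh _ hd] at h1
  refine h1.trans (Eq.trans ?_ h2.symm)
  have h3 : (-rotD pq (sepTest ψ h)) = sepTest ψ (fun z => -rotField pq h z) := by
    rw [rotD_sepTest pq hψ.differentiable hd]
    ext z
    simp [sepTest]
  have h4 : rotAdj (pq :: J) (sepTest ψ h) = rotAdj J (-rotD pq (sepTest ψ h)) := rfl
  rw [h4, h3]

theorem IsWeakDeriv.integral_twisted {k : ℕ} {J : List (Fin (n - 1) × Fin (n - 1))}
    {u w w' : ℝ × USphere n → ℝ}
    (hw : IsWeakDeriv α a k J u w) (hw' : IsWeakDeriv α a (k + 1) J u w')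
    {φ : ℝ → ℝ} (hφ : IsTestFn1 a φ) {h : Ambient n → ℝ} (hh : ContDiff ℝ ∞ h)
    (hc : HasCompactSupport h) :
    ∫ z, w' z * (φ z.1 * h z.2) ∂(patchMeasure n a) =
      ∫ z, w z * ((if Even k then -deriv φ z.1 + (α - 1) / z.1 * φ z.1
        else deriv φ z.1 + α / z.1 * φ z.1) * h z.2) ∂(patchMeasure n a) := by
  have h1 := hw'.2 _ (isTestFn_sepTest hφ hh hc)
  have hd : Differentiable ℝ h := hh.differentiable (by simp)
  rw [twAdj_succ] at h1
  split_ifs at h1 ⊢ with hk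
  · rw [twDStar_sepTest α hφ.differentiable hd] at h1
    exact h1.trans (hw.2 _ (isTestFn_sepTest (hφ.twistedStar α) hh hc)).symm
  · rw [twD_sepTest α hφ.differentiable hd] at h1
    exact h1.trans (hw.2 _ (isTestFn_sepTest (hφ.twisted α) hh hc)).symm

end Separable

/-! ### Slices of square-integrable functions on a product -/

section Slices

variable {X Y : Type*} [MeasurableSpace X] [MeasurableSpace Y] {μ : Measure X} {ν : Measure Y}

theorem lintegral_enorm_sq_lt_top_iff {E : Type*} [NormedAddCommGroup E] {f : X → E} :
    ∫⁻ x, ‖f x‖ₑ ^ 2 ∂μ < ⊤ ↔ eLpNorm f 2 μ < ⊤ := by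
  rw [← eLpNorm_two_sq]
  exact ⟨fun h => lt_top_iff_ne_top.2 fun h' => by simp [h'] at h, fun h => ENNReal.pow_lt_top h⟩

variable [SFinite ν]

theorem MeasureTheory.MemLp.ae_memLp_prodMk {w : X × Y → ℝ} (hw : MemLp w 2 (μ.prod ν)) :
    ∀ᵐ x ∂μ, MemLp (fun y => w (x, y)) 2 ν := by
  have h2 := lintegral_enorm_sq_lt_top_iff.2 hw.2
  have hm : AEMeasurable (fun z => ‖w z‖ₑ ^ 2) (μ.prod ν) := hw.1.enorm.pow_const 2
  rw [lintegral_prod _ hm] at h2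
  filter_upwards [hw.1.prodMk_left, ae_lt_top' hm.lintegral_prod_right' h2.ne] with x hx hx'
  exact ⟨hx, lintegral_enorm_sq_lt_top_iff.1 hx'⟩

theorem MeasureTheory.MemLp.integral_mul_prodMk {𝕜 : Type*} [RCLike 𝕜] {w : X × Y → ℝ}
    (hw : MemLp w 2 (μ.prod ν)) {h : Y → 𝕜} (hh : MemLp h 2 ν) :
    MemLp (fun x => ∫ y, (w (x, y) : 𝕜) * h y ∂ν) 2 μ := by
  have h1 : AEStronglyMeasurable (fun z : X × Y => (w z : 𝕜) * h z.2) (μ.prod ν) :=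
    (RCLike.continuous_ofReal.comp_aestronglyMeasurable hw.1).mul hh.1.comp_snd
  refine ⟨h1.integral_prod_right', lintegral_enorm_sq_lt_top_iff.1 ?_⟩
  have h2 := lintegral_enorm_sq_lt_top_iff.2 hw.2
  have hm : AEMeasurable (fun z => ‖w z‖ₑ ^ 2) (μ.prod ν) := hw.1.enorm.pow_const 2
  rw [lintegral_prod _ hm] at h2
  refine lt_of_le_of_lt ?_ (ENNReal.mul_lt_top h2 (lintegral_enorm_sq_lt_top_iff.2 hh.2))
  rw [← lintegral_mul_const'' _ hm.lintegral_prod_right']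
  refine lintegral_mono_ae ?_
  filter_upwards [hw.1.prodMk_left] with x hx
  calc ‖∫ y, (w (x, y) : 𝕜) * h y ∂ν‖ₑ ^ 2 ≤ (∫⁻ y, ‖w (x, y)‖ₑ * ‖h y‖ₑ ∂ν) ^ 2 := by
        gcongr
        refine (enorm_integral_le_lintegral_enorm _).trans_eq (lintegral_congr fun y => ?_)
        rw [enorm_mul]
        congr 1
        simp [enorm_eq_nnnorm]
    _ ≤ _ := sq_lintegral_mul_le hx.enorm hh.1.enorm

end Slices

/-! ### Radial equations for the angular coefficients -/

section Coefficient

variable {n : ℕ} {α a : ℝ}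

/-- The surface measure of the unit sphere. -/
abbrev surfaceMeasure (n : ℕ) : Measure (USphere n) := (volume : Measure (Ambient n)).toSphere

theorem lintegral_patchMeasure {f : ℝ × USphere n → ℝ≥0∞}
    (hf : AEMeasurable f (patchMeasure n a)) :
    ∫⁻ z, f z ∂(patchMeasure n a) = ∫⁻ x, ∫⁻ θ, f (x, θ) ∂(surfaceMeasure n) ∂(radialMeasure a) :=
  lintegral_prod _ hf

theorem ae_memLp_slice {w : ℝ × USphere n → ℝ} (hw : MemLp w 2 (patchMeasure n a)) :
    ∀ᵐ x ∂(radialMeasure a), MemLp (fun θ => w (x, θ)) 2 (surfaceMeasure n) :=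
  hw.ae_memLp_prodMk

/-- The integral of `w (x, ·) h` over the sphere. -/
def sphCoef {𝕜 : Type*} [RCLike 𝕜] (w : ℝ × USphere n → ℝ) (h : Ambient n → 𝕜) (x : ℝ) : 𝕜 :=
  ∫ θ, (w (x, θ) : 𝕜) * h (θ : Ambient n) ∂(surfaceMeasure n)

theorem memLp_surfaceMeasure {𝕜 : Type*} [RCLike 𝕜] {h : Ambient n → 𝕜} (hh : Continuous h) :
    MemLp (fun θ : USphere n => h θ) 2 (surfaceMeasure n) := by
  have hc : Continuous fun θ : USphere n => h θ := hh.comp continuous_subtype_val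
  obtain ⟨K, hK⟩ := (isCompact_range hc).isBounded.exists_norm_le
  exact MemLp.of_bound hc.aestronglyMeasurable K (ae_of_all _ fun θ => hK _ (mem_range_self θ))

theorem memLp_sphCoef {𝕜 : Type*} [RCLike 𝕜] {w : ℝ × USphere n → ℝ}
    (hw : MemLp w 2 (patchMeasure n a)) {h : Ambient n → 𝕜} (hh : Continuous h) :
    MemLp (sphCoef w h) 2 (radialMeasure a) :=
  hw.integral_mul_prodMk (memLp_surfaceMeasure hh)

theorem integral_mul_sphCoef {w : ℝ × USphere n → ℝ} (hw : MemLp w 2 (patchMeasure n a))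
    {φ : ℝ → ℝ} (hφ : IsTestFn1 a φ) {h : Ambient n → ℝ} (hh : ContDiff ℝ ∞ h)
    (hc : HasCompactSupport h) :
    ∫ z, w z * (φ z.1 * h z.2) ∂(patchMeasure n a) =
      ∫ x, φ x * sphCoef w h x ∂(radialMeasure a) := by
  have h1 := integral_prod _ (memLp_integrable_mul_test hw (isTestFn_sepTest hφ hh hc))
  refine h1.trans (integral_congr_ae (ae_of_all _ fun x => ?_))
  simp only [sphCoef, sepTest, ← integral_const_mul]
  refine integral_congr_ae (ae_of_all _ fun θ => ?_)
  simp only [RCLike.ofReal_real_eq_id, id]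
  ring

theorem sphCoef_neg {𝕜 : Type*} [RCLike 𝕜] (w : ℝ × USphere n → ℝ) (h : Ambient n → 𝕜) (x : ℝ) :
    sphCoef w (fun z => -h z) x = -sphCoef w h x := by
  simp [sphCoef, integral_neg]

theorem ae_eq_of_forall_testFn1 {c f : ℝ → ℝ} (hc : MemLp c 2 (radialMeasure a))
    (hf : MemLp f 2 (radialMeasure a)) (h : ∀ φ, IsTestFn1 a φ →
      ∫ x, φ x * c x ∂(radialMeasure a) = ∫ x, φ x * f x ∂(radialMeasure a)) :
    c =ᵐ[radialMeasure a] f := by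
  have hci := hc.integrable (by norm_num)
  have hfi := hf.integrable (by norm_num)
  have key := (isOpen_Ioo (a := (0 : ℝ)) (b := a)).ae_eq_zero_of_integral_contDiff_smul_eq_zero
    (μ := radialMeasure a) ((hci.sub hfi).locallyIntegrable.locallyIntegrableOn _) (by
      intro g hg hgc hgs
      have ht : IsTestFn1 a g := ⟨hg, hgc, hgs⟩
      obtain ⟨K, hK⟩ := hgc.exists_bound_of_continuous hg.continuous
      simp only [Pi.sub_apply, smul_eq_mul, mul_sub]
      rw [integral_sub (hci.bdd_mul hg.continuous.aestronglyMeasurable (ae_of_all _ hK))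
        (hfi.bdd_mul hg.continuous.aestronglyMeasurable (ae_of_all _ hK)), h g ht, sub_self])
  have hmem : ∀ᵐ x ∂(radialMeasure a), x ∈ Ioo 0 a := ae_radialMeasure_iff.2 (ae_of_all _ fun _ h => h)
  filter_upwards [key, hmem] with x hx hx'
  exact sub_eq_zero.1 (hx hx')

theorem IsWeakDeriv.sphCoef_rot_real {k : ℕ} {J : List (Fin (n - 1) × Fin (n - 1))}
    {pq : Fin (n - 1) × Fin (n - 1)} {u w w' : ℝ × USphere n → ℝ}
    (hw : IsWeakDeriv α a k J u w) (hw' : IsWeakDeriv α a k (pq :: J) u w')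
    {h : Ambient n → ℝ} (hh : ContDiff ℝ ∞ h) (hc : HasCompactSupport h) :
    sphCoef w' h =ᵐ[radialMeasure a] fun x => -sphCoef w (rotField pq h) x := by
  have hr := contDiff_rotField pq hh
  have hrc := hasCompactSupport_rotField pq hc
  refine ae_eq_of_forall_testFn1 (memLp_sphCoef hw'.1 hh.continuous)
    (memLp_sphCoef hw.1 hr.continuous).neg fun φ hφ => ?_
  have h1 := hw.integral_rot hw' hφ hh hc
  rw [integral_mul_sphCoef hw'.1 hφ hh hc] at h1
  rw [h1]
  have h2 := integral_mul_sphCoef hw.1 hφ (h := fun z => -rotField pq h z) hr.neg hrc.neg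
  simpa only [sphCoef_neg] using h2

/-- For even `k` the next derivative is `D_x`, giving `c' + (α / x) c`. For odd `k` it is `D_x^*`,
and `-D_x^* c = c' + ((1 - α) / x) c`, which accounts for the exponent `1 - α` and the sign. -/
theorem IsWeakDeriv.isWeakTwisted_real {k : ℕ} {J : List (Fin (n - 1) × Fin (n - 1))}
    {u w w' : ℝ × USphere n → ℝ}
    (hw : IsWeakDeriv α a k J u w) (hw' : IsWeakDeriv α a (k + 1) J u w')
    {h : Ambient n → ℝ} (hh : ContDiff ℝ ∞ h) (hc : HasCompactSupport h) :
    IsWeakTwisted a (if Even k then α else 1 - α) (sphCoef w h)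
      fun x => (if Even k then 1 else -1) * sphCoef w' h x := by
  intro φ hφ
  have h1 := hw.integral_twisted hw' hφ hh hc
  rw [integral_mul_sphCoef hw'.1 hφ hh hc] at h1
  split_ifs at h1 ⊢ with hk
  · simp only [one_mul]
    rw [h1]
    exact integral_mul_sphCoef hw.1 (hφ.twistedStar α) hh hc
  · have h2 := integral_mul_sphCoef hw.1 (hφ.twisted α) hh hc
    rw [h2] at h1
    simp only [neg_one_mul, mul_neg]
    rw [integral_neg, h1, ← integral_neg]
    refine integral_congr_ae (ae_of_all _ fun x => ?_)
    simp only
    ring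

end Coefficient

/-! ### Coefficients against complex characters -/

section ComplexCoefficient

variable {n : ℕ} {α a : ℝ}

theorem enorm_sq_eq_re_add_im (z : ℂ) : ‖z‖ₑ ^ 2 = ‖z.re‖ₑ ^ 2 + ‖z.im‖ₑ ^ 2 := by
  simp only [← ofReal_norm, ← ENNReal.ofReal_pow (norm_nonneg _)]
  rw [← ENNReal.ofReal_add (by positivity) (by positivity), ← Complex.normSq_eq_norm_sq,
    Complex.normSq_apply]
  simp [sq]

theorem integrable_mul_sphere {𝕜 : Type*} [RCLike 𝕜] {f : USphere n → ℝ}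
    (hf : MemLp f 2 (surfaceMeasure n)) {h : Ambient n → 𝕜} (hh : Continuous h) :
    Integrable (fun θ => (f θ : 𝕜) * h θ) (surfaceMeasure n) :=
  MemLp.integrable_mul (p := 2) (q := 2) hf.ofReal (memLp_surfaceMeasure hh)

/-- Weak derivatives are tested against real functions while the characters are complex; taking `L`
to be the real or the imaginary part reduces one to the other. -/
theorem ae_sphCoef_clm {w : ℝ × USphere n → ℝ} (hw : MemLp w 2 (patchMeasure n a))
    {h : Ambient n → ℂ} (hh : Continuous h) (L : ℂ →L[ℝ] ℝ) :
    ∀ᵐ x ∂(radialMeasure a), sphCoef w (fun z => L (h z)) x = L (sphCoef w h x) := by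
  filter_upwards [ae_memLp_slice hw] with x hx
  rw [sphCoef, sphCoef, ← L.integral_comp_comm (integrable_mul_sphere hx hh)]
  refine integral_congr_ae (ae_of_all _ fun θ => ?_)
  simp only [RCLike.ofReal_real_eq_id, id]
  have : ((w (x, θ) : ℂ)) * h θ = w (x, θ) • h θ := by simp
  erw [this, map_smul, smul_eq_mul]

theorem rotField_clm (pq : Fin (n - 1) × Fin (n - 1)) {h : Ambient n → ℂ}
    (hh : Differentiable ℝ h) (L : ℂ →L[ℝ] ℝ) :
    rotField pq (fun z => L (h z)) = fun z => L (rotField pq h z) := by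
  ext z
  have := (L.hasFDerivAt.comp z (hh z).hasFDerivAt).fderiv
  simp only [rotField]
  erw [this]
  rfl

/-- Transposition of the derivative along a rotation field. -/
theorem IsWeakDeriv.sphCoef_rot {k : ℕ} {J : List (Fin (n - 1) × Fin (n - 1))}
    {pq : Fin (n - 1) × Fin (n - 1)} {u w w' : ℝ × USphere n → ℝ}
    (hw : IsWeakDeriv α a k J u w) (hw' : IsWeakDeriv α a k (pq :: J) u w')
    {h : Ambient n → ℂ} (hh : ContDiff ℝ ∞ h) (hc : HasCompactSupport h) :
    ∀ᵐ x ∂(radialMeasure a), sphCoef w' h x = -sphCoef w (rotField pq h) x := by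
  have hd := hh.differentiable (by simp)
  have key : ∀ L : ℂ →L[ℝ] ℝ, ∀ᵐ x ∂(radialMeasure a),
      L (sphCoef w' h x) = L (-sphCoef w (rotField pq h) x) := by
    intro L
    have h1 := hw.sphCoef_rot_real hw' (L.contDiff.comp hh) (hc.comp_left (map_zero L))
    filter_upwards [h1, ae_sphCoef_clm hw'.1 hh.continuous L,
      ae_sphCoef_clm hw.1 (contDiff_rotField pq hh).continuous L] with x h1 h2 h3
    rw [map_neg, ← h2, ← h3, ← rotField_clm pq hd]
    exact h1
  filter_upwards [key Complex.reCLM, key Complex.imCLM] with x h1 h2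
  exact Complex.ext h1 h2

/-- Weighted boundedness in `x` of the coefficients of a function that has one more twisted
derivative. -/
theorem exists_bound_sphCoef (n : ℕ) {η : ℝ} (ha : 0 < a) (hα : 0 < α) (hη_gt : 1 < α → η = 0)
    (hη_lt : α < 1 → η = max α (1 - α)) (hη_eq : α = 1 → 0 < η) (k : ℕ) :
    ∃ C : ℝ≥0, ∀ (J : List (Fin (n - 1) × Fin (n - 1))) (u w w' : ℝ × USphere n → ℝ),
      IsWeakDeriv α a k J u w → IsWeakDeriv α a (k + 1) J u w' →
      ∀ h : Ambient n → ℂ, ContDiff ℝ ∞ h → HasCompactSupport h →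
      ∀ᵐ x ∂(radialMeasure a), ‖x ^ η‖ₑ ^ 2 * ‖sphCoef w h x‖ₑ ^ 2 ≤
        C * (∫⁻ x, ‖sphCoef w h x‖ₑ ^ 2 ∂(radialMeasure a) +
          ∫⁻ x, ‖sphCoef w' h x‖ₑ ^ 2 ∂(radialMeasure a)) := by
  obtain ⟨C, hC⟩ := exists_bound_of_isWeakTwisted (η := η)
    (β := if Even k then α else 1 - α) ha (by
      -- Here the value of `η` is used. If `α < 1`, both exponents are at most `η > 0`. If `α = 1`,
      -- the exponent `1` is covered by the vanishing boundary term and the exponent `0` by `η > 0`.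
      -- If `α > 1`, then `α ≥ 1` and `1 - α < 0` are the two cases that allow `η = 0`.
      rcases lt_trichotomy α 1 with h | h | h
      · have := hη_lt h
        have h1 := le_max_left α (1 - α)
        have h2 := le_max_right α (1 - α)
        left
        split_ifs <;> constructor <;> linarith
      · have := hη_eq h
        split_ifs
        · right; right; constructor <;> linarith
        · left; constructor <;> linarith
      · have := hη_gt h
        right
        split_ifs
        · right; constructor <;> linarith
        · left; constructor <;> linarith)
  refine ⟨C, fun J u w w' hw hw' h hh hc => ?_⟩
  have key : ∀ L : ℂ →L[ℝ] ℝ, ∀ᵐ x ∂(radialMeasure a),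
      ‖x ^ η‖ₑ ^ 2 * ‖L (sphCoef w h x)‖ₑ ^ 2 ≤
        C * (∫⁻ x, ‖L (sphCoef w h x)‖ₑ ^ 2 ∂(radialMeasure a) +
          ∫⁻ x, ‖L (sphCoef w' h x)‖ₑ ^ 2 ∂(radialMeasure a)) := by
    intro L
    have hL : ContDiff ℝ ∞ fun z => L (h z) := L.contDiff.comp hh
    have hLc : HasCompactSupport fun z => L (h z) := hc.comp_left (map_zero L)
    have h1 := hC _ _ (memLp_sphCoef hw.1 hL.continuous)
      ((memLp_sphCoef hw'.1 hL.continuous).const_mul _) (hw.isWeakTwisted_real hw' hL hLc)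
    have h2 := ae_sphCoef_clm hw.1 hh.continuous L
    have h3 := ae_sphCoef_clm hw'.1 hh.continuous L
    have e2 : ∫⁻ x, ‖sphCoef w (fun z => L (h z)) x‖ₑ ^ 2 ∂(radialMeasure a) =
        ∫⁻ x, ‖L (sphCoef w h x)‖ₑ ^ 2 ∂(radialMeasure a) :=
      lintegral_congr_ae (by filter_upwards [h2] with x hx; rw [hx])
    have e3 : ∫⁻ x, ‖(if Even k then 1 else -1) * sphCoef w' (fun z => L (h z)) x‖ₑ ^ 2
        ∂(radialMeasure a) = ∫⁻ x, ‖L (sphCoef w' h x)‖ₑ ^ 2 ∂(radialMeasure a) :=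
      lintegral_congr_ae (by
        filter_upwards [h3] with x hx
        rw [hx]
        split_ifs <;> simp)
    rw [e2, e3] at h1
    filter_upwards [h1, h2] with x h1 h2
    rwa [h2, enorm_mul, mul_pow] at h1
  have hm : ∀ {v : ℝ × USphere n → ℝ}, MemLp v 2 (patchMeasure n a) →
      AEMeasurable (fun x => ‖Complex.reCLM (sphCoef v h x)‖ₑ ^ 2) (radialMeasure a) := fun hv =>
    ((Complex.continuous_re.comp_aestronglyMeasurable
      (memLp_sphCoef hv hh.continuous).1).enorm.pow_const 2)
  filter_upwards [key Complex.reCLM, key Complex.imCLM] with x h1 h2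
  simp only [enorm_sq_eq_re_add_im (sphCoef _ _ _)]
  rw [lintegral_add_left' (f := fun x => ‖(sphCoef w h x).re‖ₑ ^ 2) (hm hw.1),
    lintegral_add_left' (f := fun x => ‖(sphCoef w' h x).re‖ₑ ^ 2) (hm hw'.1), mul_add]
  refine (add_le_add h1 h2).trans_eq ?_
  simp only [Complex.reCLM_apply, Complex.imCLM_apply]
  ring

end ComplexCoefficient

/-! ### The weak derivatives and the Sobolev norm -/

section Norm

variable {n : ℕ} {α a : ℝ}

theorem MemTwH.isWeakDeriv {m : ℕ} {u : ℝ × USphere n → ℝ} (hu : MemTwH α a m u) {k : ℕ}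
    {J : List (Fin (n - 1) × Fin (n - 1))} (h : k + J.length ≤ m) :
    IsWeakDeriv α a k J u (weakDeriv α a k J u) := by
  have h1 := hu.2 k J h
  rw [weakDeriv, dif_pos h1]
  exact h1.choose_spec

theorem eLpNorm_weakDeriv_le_twNorm {m : ℕ} (u : ℝ × USphere n → ℝ) {k : ℕ}
    {J : List (Fin (n - 1) × Fin (n - 1))} (h : k + J.length ≤ m) :
    eLpNorm (weakDeriv α a k J u) 2 (patchMeasure n a) ≤ twNorm α a m u := by
  unfold twNorm
  refine le_trans ?_ (Finset.single_le_sum_of_canonicallyOrdered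
    (Finset.mem_range.2 (by omega : k < m + 1)))
  refine le_trans ?_ (Finset.single_le_sum_of_canonicallyOrdered
    (Finset.mem_range.2 (by omega : J.length < m + 1 - k)))
  refine le_trans ?_ (Finset.single_le_sum_of_canonicallyOrdered (Finset.mem_univ J.get))
  rw [List.ofFn_get]

end Norm

/-! ### Cutoffs, and frequencies as rotation derivatives -/

section Cutoff

variable {n : ℕ} {a : ℝ} {p : Fin (n - 1)} {s c : ℝ}

/-- Smooth functions with compact support in `{z | c < s z_p}`. -/
structure IsPatchCutoff (p : Fin (n - 1)) (s c : ℝ) (χ : Ambient n → ℝ) : Prop where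
  smooth : ContDiff ℝ ∞ χ
  compact : HasCompactSupport χ
  supp : tsupport χ ⊆ {z | c < s * z p}

theorem IsPatchCutoff.smooth_mul {χ : Ambient n → ℝ} (h : IsPatchCutoff p s c χ)
    {f : Ambient n → ℝ} (hf : ContDiff ℝ ∞ f) : IsPatchCutoff p s c (fun z => f z * χ z) :=
  ⟨hf.mul h.smooth, h.compact.mul_left, tsupport_mul_subset_right.trans h.supp⟩

theorem IsPatchCutoff.rotField {χ : Ambient n → ℝ} (h : IsPatchCutoff p s c χ)
    (pq : Fin (n - 1) × Fin (n - 1)) : IsPatchCutoff p s c (rotField pq χ) :=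
  ⟨contDiff_rotField pq h.smooth, hasCompactSupport_rotField pq h.compact,
    (tsupport_rotField_subset pq χ).trans h.supp⟩

theorem IsPatchCutoff.apply_ne_zero (hc : 0 < c) {χ : Ambient n → ℝ} (h : IsPatchCutoff p s c χ)
    {z : Ambient n} (hz : z ∈ tsupport χ) : z p ≠ 0 := by
  intro h0
  have h1 : c < s * z p := h.supp hz
  rw [h0, mul_zero] at h1
  linarith

theorem hasFDerivAt_patchChar (c : ℝ) (ξ : {q // q ≠ p} → ℤ) {z : Ambient n} (hz : z p ≠ 0) :
    ∃ L : Ambient n →L[ℝ] ℂ, HasFDerivAt (patchChar p c ξ) L z ∧ ∀ v, L v =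
      patchChar p c ξ z * (-(2 * Real.pi *
        (∑ q, ξ q * (c / 4 * ((v q * z p - z q * v p) / z p ^ 2)) : ℝ) * Complex.I)) := by
  have hcoord : ∀ q : Fin (n - 1), HasFDerivAt (fun z : Ambient n => z q)
      (EuclideanSpace.proj (𝕜 := ℝ) q : Ambient n →L[ℝ] ℝ) z := fun q =>
    (EuclideanSpace.proj (𝕜 := ℝ) q : Ambient n →L[ℝ] ℝ).hasFDerivAt
  have h1 : ∀ q : Fin (n - 1), HasFDerivAt (fun z : Ambient n => z q / z p)
      ((z p ^ 2)⁻¹ • (z p • (EuclideanSpace.proj (𝕜 := ℝ) q : Ambient n →L[ℝ] ℝ) -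
        z q • (EuclideanSpace.proj (𝕜 := ℝ) p : Ambient n →L[ℝ] ℝ))) z := by
    intro q
    have h := (hcoord q).mul ((hasDerivAt_inv hz).comp_hasFDerivAt z (hcoord p))
    convert! h using 1
    ext v
    simp
    field_simp
    ring
  have h2 := HasFDerivAt.fun_sum (u := Finset.univ) fun (q : {q // q ≠ p}) _ =>
    (((h1 q).const_mul (c / 4)).const_mul (ξ q : ℝ))
  have h3 := (((((Complex.ofRealCLM.hasFDerivAt).comp z h2).const_mul
    (2 * Real.pi : ℂ)).mul_const Complex.I).neg).cexp
  refine ⟨_, h3, fun v => ?_⟩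
  have e : ∑ q : {q // q ≠ p}, ξ q * (c / 4 * ((v q * z p - z q * v p) / z p ^ 2)) =
      (∑ q : {q // q ≠ p}, (ξ q : ℝ) • (c / 4) • (z p ^ 2)⁻¹ •
        (z p • (EuclideanSpace.proj (𝕜 := ℝ) (q : Fin (n - 1)) : Ambient n →L[ℝ] ℝ) -
        z q • (EuclideanSpace.proj (𝕜 := ℝ) p : Ambient n →L[ℝ] ℝ))) v := by
    simp only [sum_apply]
    refine Finset.sum_congr rfl fun q _ => ?_
    simp only [smul_apply, sub_apply, PiLp.proj_apply, smul_eq_mul]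
    ring
  rw [e]
  simp only [smul_apply, neg_apply,
    ContinuousLinearMap.comp_apply, smul_eq_mul]
  simp only [Complex.ofRealCLM_apply]
  exact (by intro x y; ring : ∀ x y : ℂ, x * -(Complex.I * (2 * Real.pi * y)) =
    x * -(2 * Real.pi * y * Complex.I)) _ _

theorem contDiffAt_patchChar (c : ℝ) (ξ : {q // q ≠ p} → ℤ) {z : Ambient n} (hz : z p ≠ 0) :
    ContDiffAt ℝ ∞ (patchChar p c ξ) z := by
  have h1 : ContDiffAt ℝ ∞ (fun z : Ambient n =>
      (∑ q : {q // q ≠ p}, ξ q * (c / 4 * (z q / z p)) : ℝ)) z := by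
    refine ContDiffAt.sum fun q _ => contDiffAt_const.mul (contDiffAt_const.mul
      (ContDiffAt.div ?_ ?_ hz)) <;> fun_prop
  exact ((((Complex.ofRealCLM.contDiff.contDiffAt.comp z h1).const_smul
    (2 * Real.pi : ℂ)).mul contDiffAt_const).neg).cexp

/-- A character of a patch times a cutoff function. -/
def patchTest (p : Fin (n - 1)) (c : ℝ) (ξ : {q // q ≠ p} → ℤ) (χ : Ambient n → ℝ)
    (z : Ambient n) : ℂ := patchChar p c ξ z * (χ z : ℂ)

theorem tsupport_patchTest_subset (ξ : {q // q ≠ p} → ℤ) (χ : Ambient n → ℝ) :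
    tsupport (patchTest p c ξ χ) ⊆ tsupport χ := by
  refine closure_mono fun z hz => ?_
  intro h0
  exact hz (by simp [patchTest, h0])

theorem IsPatchCutoff.contDiff_patchTest (hc : 0 < c) {χ : Ambient n → ℝ}
    (h : IsPatchCutoff p s c χ) (ξ : {q // q ≠ p} → ℤ) : ContDiff ℝ ∞ (patchTest p c ξ χ) := by
  refine contDiff_iff_contDiffAt.2 fun z => ?_
  by_cases hz : z ∈ tsupport χ
  · exact (contDiffAt_patchChar c ξ (h.apply_ne_zero hc hz)).mul
      (Complex.ofRealCLM.contDiff.contDiffAt.comp z h.smooth.contDiffAt)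
  · have h0 : patchTest p c ξ χ =ᶠ[𝓝 z] fun _ => 0 := by
      filter_upwards [(isClosed_tsupport χ).isOpen_compl.mem_nhds hz] with y hy
      simp [patchTest, image_eq_zero_of_notMem_tsupport hy]
    exact contDiffAt_const.congr_of_eventuallyEq h0

theorem IsPatchCutoff.hasCompactSupport_patchTest {χ : Ambient n → ℝ}
    (h : IsPatchCutoff p s c χ) (ξ : {q // q ≠ p} → ℤ) :
    HasCompactSupport (patchTest p c ξ χ) :=
  h.compact.mono' (subset_closure.trans (tsupport_patchTest_subset ξ χ))

/-- Multiplication by a frequency is a combination of derivatives along rotation fields. -/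
theorem IsPatchCutoff.freq_mul_patchTest (hc : 0 < c) {χ : Ambient n → ℝ}
    (h : IsPatchCutoff p s c χ) (ξ : {q // q ≠ p} → ℤ) (q : {q // q ≠ p}) (z : Ambient n) :
    (-(2 * Real.pi * (ξ q * (c / 4) * ‖z‖ ^ 2 : ℝ) * Complex.I)) * patchTest p c ξ χ z =
      ∑ r, (_root_.rotField (r, (q : Fin (n - 1))) (patchTest p c ξ fun z => z p * z r * χ z) z -
        patchTest p c ξ (_root_.rotField (r, (q : Fin (n - 1))) fun z => z p * z r * χ z) z) := by
  have hr : ∀ r, IsPatchCutoff p s c fun z => z p * z r * χ z := fun r =>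
    h.smooth_mul (f := fun z => z p * z r) (by fun_prop)
  by_cases hz : z ∈ tsupport χ
  · obtain ⟨L, hL, hLv⟩ := hasFDerivAt_patchChar (p := p) c ξ (h.apply_ne_zero hc hz)
    -- By the product rule the subtracted term is the derivative falling on the cutoff, so only the
    -- derivative of the character remains.
    have h1 : ∀ r, _root_.rotField (r, (q : Fin (n - 1)))
        (patchTest p c ξ fun z => z p * z r * χ z) z -
        patchTest p c ξ (_root_.rotField (r, (q : Fin (n - 1))) fun z => z p * z r * χ z) z =
        z p * χ z * L (z r • (z r • EuclideanSpace.single (q : Fin (n - 1)) (1 : ℝ) -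
          z q • EuclideanSpace.single r (1 : ℝ))) := by
      intro r
      have h2 := hL.mul (Complex.ofRealCLM.hasFDerivAt.comp z
        ((hr r).smooth.differentiable (by simp) z).hasFDerivAt)
      have h3 : HasFDerivAt (patchTest p c ξ fun z => z p * z r * χ z) _ z := h2
      simp only [_root_.rotField, h3.fderiv, patchTest]
      simp
      ring
    rw [Finset.sum_congr rfl fun r _ => h1 r, ← Finset.mul_sum, ← map_sum, hLv]
    -- The weighted sum of the rotation fields is `‖z‖ ^ 2 ∂_q - z_q (z · ∇)`.
    have h4 : ∑ r, z r • (z r • EuclideanSpace.single (q : Fin (n - 1)) (1 : ℝ) -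
          z q • EuclideanSpace.single r (1 : ℝ)) =
        ‖z‖ ^ 2 • EuclideanSpace.single (q : Fin (n - 1)) (1 : ℝ) - z q • z := by
      ext i
      simp only [EuclideanSpace.norm_sq_eq, Real.norm_eq_abs, sq_abs]
      simp [mul_sub, Finset.sum_sub_distrib, sq]
      simp only [Pi.single_apply, mul_ite, mul_one, mul_zero,
        Finset.sum_ite_eq, Finset.mem_univ, if_true]
      split_ifs
      · ring
      · rw [Finset.sum_const_zero]
        ring
    rw [h4]
    -- The radial term drops out because the character depends only on the quotients `z_q' / z_p`;
    -- just the component `q` survives, and its `1 / z_p` is cancelled by the `z p` in the cutoff.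
    have h5 : ∀ q' : {q // q ≠ p}, (‖z‖ ^ 2 • EuclideanSpace.single (q : Fin (n - 1)) (1 : ℝ) -
        z q • z) q' * z p - z q' * (‖z‖ ^ 2 • EuclideanSpace.single (q : Fin (n - 1)) (1 : ℝ) -
        z q • z) p = if q' = q then ‖z‖ ^ 2 * z p else 0 := by
      intro q'
      have : p ≠ q := q.2.symm
      simp [this, Subtype.ext_iff]
      have hq : (q' : Fin (n - 1)) = q ↔ q' = q := Subtype.ext_iff.symm
      split_ifs <;> ring
    have h6 : ∑ q' : {q // q ≠ p}, (ξ q' : ℝ) * (c / 4 *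
        ((if q' = q then ‖z‖ ^ 2 * z p else 0) / z p ^ 2)) =
        ξ q * (c / 4 * (‖z‖ ^ 2 * z p / z p ^ 2)) := by
      rw [Finset.sum_eq_single q (fun q' _ hq' => by simp [hq']) (by simp), if_pos rfl]
    have h7 : (z p : ℂ) ≠ 0 := Complex.ofReal_ne_zero.2 (h.apply_ne_zero hc hz)
    simp only [h5, h6, patchTest]
    push_cast
    field_simp
  · have h1 : ∀ r, z ∉ tsupport fun z => z p * z r * χ z := fun r hz' =>
      hz (tsupport_mul_subset_right hz')
    have h2 : ∀ r, _root_.rotField (r, (q : Fin (n - 1)))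
        (patchTest p c ξ fun z => z p * z r * χ z) z = 0 := fun r =>
      image_eq_zero_of_notMem_tsupport fun hz' => h1 r
        (tsupport_patchTest_subset ξ _ (tsupport_rotField_subset _ _ hz'))
    have h3 : ∀ r, _root_.rotField (r, (q : Fin (n - 1))) (fun z => z p * z r * χ z) z = 0 :=
      fun r => image_eq_zero_of_notMem_tsupport fun hz' => h1 r (tsupport_rotField_subset _ _ hz')
    simp [h2, h3, patchTest, image_eq_zero_of_notMem_tsupport hz]

end Cutoff

/-! ### Decay of the coefficients from angular derivatives -/

section Energy

variable {n : ℕ} {α a : ℝ} {p : Fin (n - 1)} {s c : ℝ}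

theorem enorm_sum_sq_le {ι : Type*} [Fintype ι] (x : ι → ℂ) :
    ‖∑ i, x i‖ₑ ^ 2 ≤ Fintype.card ι * ∑ i, ‖x i‖ₑ ^ 2 := by
  have h : ‖∑ i, x i‖₊ ^ 2 ≤ Fintype.card ι * ∑ i, ‖x i‖₊ ^ 2 :=
    (pow_le_pow_left' (nnnorm_sum_le _ _) 2).trans sq_sum_le_card_mul_sum_sq
  simp only [enorm_eq_nnnorm]
  exact_mod_cast h

theorem freqSize_sq_le {ι : Type*} [Fintype ι] (ξ : ι → ℤ) :
    freqSize ξ ^ 2 ≤ (Fintype.card ι + 1) * (1 + ∑ q, ((ξ q).natAbs : ℝ≥0) ^ 2) := by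
  have h := sq_sum_le_card_mul_sum_sq (s := (Finset.univ : Finset (Option ι)))
    (f := fun o => o.elim (1 : ℝ≥0) fun q => ((ξ q).natAbs : ℝ≥0))
  simpa [freqSize, Fintype.sum_option] using h

/-- Weighted sum of the squared `L²` norms of the coefficients of a localized function. -/
def patchEnergy (a : ℝ) (p : Fin (n - 1)) (c : ℝ) (t : ℕ) (w : ℝ × USphere n → ℝ)
    (χ : Ambient n → ℝ) : ℝ≥0∞ :=
  ∑' ξ : {q // q ≠ p} → ℤ, (freqSize ξ : ℝ≥0∞) ^ (2 * t) *
    ∫⁻ x, ‖sphCoef w (patchTest p c ξ χ) x‖ₑ ^ 2 ∂(radialMeasure a)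

theorem sphCoef_patchTest (w : ℝ × USphere n → ℝ) (ξ : {q // q ≠ p} → ℤ) (χ : Ambient n → ℝ)
    (x : ℝ) : sphCoef w (patchTest p c ξ χ) x =
      ∫ θ, patchChar p c ξ (θ : Ambient n) * ((w (x, θ) : ℂ) * (χ θ : ℂ)) ∂(surfaceMeasure n) := by
  refine integral_congr_ae (ae_of_all _ fun θ => ?_)
  simp only [patchTest]
  exact mul_left_comm _ _ _

theorem IsPatchCutoff.eq_zero_of_notMem {χ : Ambient n → ℝ} (h : IsPatchCutoff p s c χ)
    {θ : USphere n} (hθ : θ ∉ spherePatch p s c) : χ θ = 0 := by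
  by_contra h0
  have h1 : c < s * (θ : Ambient n) p := h.supp (subset_tsupport _ h0)
  exact hθ h1.le

theorem IsPatchCutoff.memLp_mul {χ : Ambient n → ℝ} (h : IsPatchCutoff p s c χ)
    {f : USphere n → ℝ} (hf : MemLp f 2 (surfaceMeasure n)) :
    MemLp (fun θ => (f θ : ℂ) * (χ θ : ℂ)) 2 (surfaceMeasure n) := by
  obtain ⟨B, hB⟩ := h.compact.exists_bound_of_continuous h.smooth.continuous
  have hc : Continuous fun θ : USphere n => (χ θ : ℂ) :=
    Complex.continuous_ofReal.comp (h.smooth.continuous.comp continuous_subtype_val)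
  refine MemLp.of_le_mul (c := B) (hf.ofReal (K := ℂ))
    ((hf.ofReal (K := ℂ)).1.mul hc.aestronglyMeasurable) (ae_of_all _ fun θ => ?_)
  rw [norm_mul, mul_comm]
  exact mul_le_mul_of_nonneg_right (by simpa using hB θ) (norm_nonneg _)

theorem aemeasurable_enorm_sq_sphCoef (hc : 0 < c) {χ : Ambient n → ℝ}
    (h : IsPatchCutoff p s c χ) {w : ℝ × USphere n → ℝ} (hw : MemLp w 2 (patchMeasure n a))
    (ξ : {q // q ≠ p} → ℤ) :
    AEMeasurable (fun x => ‖sphCoef w (patchTest p c ξ χ) x‖ₑ ^ 2) (radialMeasure a) :=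
  (memLp_sphCoef hw (h.contDiff_patchTest hc ξ).continuous).1.enorm.pow_const 2

/-- Bessel's inequality on the patch for almost every `x`, integrated in `x`. -/
theorem IsPatchCutoff.exists_patchEnergy_zero_le (hs : s = 1 ∨ s = -1) (hc : 0 < c)
    {χ : Ambient n → ℝ} (h : IsPatchCutoff p s c χ) :
    ∃ C : ℝ≥0, ∀ w : ℝ × USphere n → ℝ, MemLp w 2 (patchMeasure n a) →
      patchEnergy a p c 0 w χ ≤ C * eLpNorm w 2 (patchMeasure n a) ^ 2 := by
  obtain ⟨B, hB⟩ := h.compact.exists_bound_of_continuous h.smooth.continuous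
  set j : ℝ≥0 := Real.toNNReal ((c / 4)⁻¹ ^ (Fintype.card (Fin (n - 1)) - 1)) with hj
  refine ⟨j * Real.toNNReal B ^ 2, fun w hw => ?_⟩
  have hm : AEMeasurable (fun z => ‖w z‖ₑ ^ 2) (patchMeasure n a) := hw.1.enorm.pow_const 2
  simp only [patchEnergy, mul_zero, pow_zero, one_mul]
  rw [eLpNorm_two_sq, lintegral_patchMeasure hm,
    ← lintegral_tsum fun ξ => aemeasurable_enorm_sq_sphCoef hc h hw ξ,
    ← lintegral_const_mul' _ _ (by finiteness)]
  refine lintegral_mono_ae ?_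
  filter_upwards [ae_memLp_slice hw] with x hx
  simp only [sphCoef_patchTest]
  refine (tsum_enorm_sq_patch_le hs hc (h.memLp_mul hx)
    fun θ hθ => by simp [h.eq_zero_of_notMem hθ]).trans ?_
  rw [← hj, ENNReal.coe_mul, mul_assoc]
  gcongr
  rw [← lintegral_const_mul' _ _ (by finiteness)]
  refine lintegral_mono fun θ => ?_
  rw [enorm_mul, mul_pow, mul_comm]
  have e1 : ‖(χ θ : ℂ)‖ₑ ≤ (Real.toNNReal B : ℝ≥0∞) := by
    rw [← ofReal_norm]
    exact ENNReal.ofReal_le_ofReal (by simpa using hB θ)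
  have e2 : ‖((w (x, θ) : ℝ) : ℂ)‖ₑ = ‖w (x, θ)‖ₑ := by simp [enorm_eq_nnnorm]
  rw [e2]
  push_cast
  gcongr

/-- The identity for `patchTest` is integrated over the sphere, where `‖θ‖ = 1`, and its rotation
derivatives are transposed onto `w`. The price of one power of the frequency is one angular
derivative and a change of cutoff. -/
theorem IsWeakDeriv.freq_mul_sphCoef (hc : 0 < c) {k : ℕ} {J : List (Fin (n - 1) × Fin (n - 1))}
    {χ : Ambient n → ℝ} (h : IsPatchCutoff p s c χ) (ξ : {q // q ≠ p} → ℤ) (q : {q // q ≠ p})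
    {u w : ℝ × USphere n → ℝ} {w' : Fin (n - 1) → ℝ × USphere n → ℝ}
    (hw : IsWeakDeriv α a k J u w)
    (hw' : ∀ r, IsWeakDeriv α a k ((r, (q : Fin (n - 1))) :: J) u (w' r)) :
    ∀ᵐ x ∂(radialMeasure a),
      (-(2 * Real.pi * (ξ q * (c / 4) : ℝ) * Complex.I)) * sphCoef w (patchTest p c ξ χ) x =
      ∑ r, (-sphCoef (w' r) (patchTest p c ξ fun z => z p * z r * χ z) x -
        sphCoef w (patchTest p c ξ
          (rotField (r, (q : Fin (n - 1))) fun z => z p * z r * χ z)) x) := by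
  have hr : ∀ r, IsPatchCutoff p s c fun z => z p * z r * χ z := fun r =>
    h.smooth_mul (f := fun z => z p * z r) (by fun_prop)
  have h1 : ∀ᵐ x ∂(radialMeasure a), ∀ r, sphCoef (w' r)
      (patchTest p c ξ fun z => z p * z r * χ z) x = -sphCoef w (rotField (r, (q : Fin (n - 1)))
        (patchTest p c ξ fun z => z p * z r * χ z)) x :=
    ae_all_iff.2 fun r => hw.sphCoef_rot (hw' r) ((hr r).contDiff_patchTest hc ξ)
      ((hr r).hasCompactSupport_patchTest ξ)
  filter_upwards [h1, ae_memLp_slice hw.1] with x hx hwx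
  have hi1 : ∀ r, Integrable (fun θ : USphere n => (w (x, θ) : ℂ) * rotField (r, (q : Fin (n - 1)))
      (patchTest p c ξ fun z => z p * z r * χ z) θ) (surfaceMeasure n) := fun r =>
    integrable_mul_sphere hwx (contDiff_rotField _ ((hr r).contDiff_patchTest hc ξ)).continuous
  have hi2 : ∀ r, Integrable (fun θ : USphere n => (w (x, θ) : ℂ) * patchTest p c ξ
      (rotField (r, (q : Fin (n - 1))) fun z => z p * z r * χ z) θ) (surfaceMeasure n) := fun r =>
    integrable_mul_sphere hwx (((hr r).rotField _).contDiff_patchTest hc ξ).continuous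
  simp only [hx, neg_neg]
  simp only [sphCoef, ← integral_const_mul]
  have h2 : ∀ r, (∫ θ : USphere n, (w (x, θ) : ℂ) * rotField (r, (q : Fin (n - 1)))
      (patchTest p c ξ fun z => z p * z r * χ z) θ ∂(surfaceMeasure n)) -
      (∫ θ : USphere n, (w (x, θ) : ℂ) * patchTest p c ξ
      (rotField (r, (q : Fin (n - 1))) fun z => z p * z r * χ z) θ ∂(surfaceMeasure n)) =
      ∫ θ : USphere n, (w (x, θ) : ℂ) * (rotField (r, (q : Fin (n - 1)))
      (patchTest p c ξ fun z => z p * z r * χ z) θ - patchTest p c ξ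
      (rotField (r, (q : Fin (n - 1))) fun z => z p * z r * χ z) θ) ∂(surfaceMeasure n) := by
    intro r
    rw [← integral_sub (hi1 r) (hi2 r)]
    simp only [mul_sub]
  refine Eq.trans ?_ (Finset.sum_congr rfl fun r _ => (h2 r).symm)
  rw [← integral_finsetSum _ fun r _ => by
    simpa only [mul_sub] using! (hi1 r).sub (hi2 r)]
  refine integral_congr_ae (ae_of_all _ fun θ => ?_)
  have h3 := h.freq_mul_patchTest hc ξ q (θ : Ambient n)
  have h4 : ‖(θ : Ambient n)‖ = 1 := by simp
  rw [h4] at h3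
  simp only [← Finset.mul_sum]
  rw [← h3]
  simp only [one_pow, mul_one]
  exact mul_left_comm _ _ _

theorem IsWeakDeriv.natAbs_sq_mul_le (hc : 0 < c) {k : ℕ}
    {J : List (Fin (n - 1) × Fin (n - 1))}
    {χ : Ambient n → ℝ} (h : IsPatchCutoff p s c χ) (ξ : {q // q ≠ p} → ℤ) (q : {q // q ≠ p})
    {u w : ℝ × USphere n → ℝ} {w' : Fin (n - 1) → ℝ × USphere n → ℝ}
    (hw : IsWeakDeriv α a k J u w)
    (hw' : ∀ r, IsWeakDeriv α a k ((r, (q : Fin (n - 1))) :: J) u (w' r)) :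
    ((ξ q).natAbs : ℝ≥0∞) ^ 2 *
        ∫⁻ x, ‖sphCoef w (patchTest p c ξ χ) x‖ₑ ^ 2 ∂(radialMeasure a) ≤
      (Real.toNNReal ((2 * Real.pi * (c / 4))⁻¹) ^ 2 * ((n - 1 : ℕ) * 2) : ℝ≥0) * ∑ r,
        (∫⁻ x, ‖sphCoef (w' r) (patchTest p c ξ fun z => z p * z r * χ z) x‖ₑ ^ 2
          ∂(radialMeasure a) +
        ∫⁻ x, ‖sphCoef w (patchTest p c ξ
          (rotField (r, (q : Fin (n - 1))) fun z => z p * z r * χ z)) x‖ₑ ^ 2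
          ∂(radialMeasure a)) := by
  have hr : ∀ r, IsPatchCutoff p s c fun z => z p * z r * χ z := fun r =>
    h.smooth_mul (f := fun z => z p * z r) (by fun_prop)
  have hm1 := fun r => aemeasurable_enorm_sq_sphCoef hc (hr r) (hw' r).1 ξ
  have hm2 := fun r => aemeasurable_enorm_sq_sphCoef hc
    ((hr r).rotField (r, (q : Fin (n - 1)))) hw.1 ξ
  have hm : ∀ r, AEMeasurable (fun x =>
      ‖sphCoef (w' r) (patchTest p c ξ fun z => z p * z r * χ z) x‖ₑ ^ 2 +
      ‖sphCoef w (patchTest p c ξ (rotField (r, (q : Fin (n - 1)))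
        fun z => z p * z r * χ z)) x‖ₑ ^ 2) (radialMeasure a) := fun r => (hm1 r).add (hm2 r)
  simp only [← lintegral_add_left' (hm1 _)]
  rw [← lintegral_finsetSum' _ fun r _ => hm r,
    ← lintegral_const_mul' _ _ (by finiteness), ← lintegral_const_mul' _ _ (by finiteness)]
  refine lintegral_mono_ae ?_
  filter_upwards [hw.freq_mul_sphCoef hc h ξ q hw'] with x hx
  set D : ℝ := 2 * Real.pi * (c / 4) with hD
  have hD0 : 0 < D := by positivity
  have e1 : ((ξ q).natAbs : ℝ≥0∞) * ‖sphCoef w (patchTest p c ξ χ) x‖ₑ =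
      (Real.toNNReal D⁻¹ : ℝ≥0∞) *
      ‖(-(2 * Real.pi * (ξ q * (c / 4) : ℝ) * Complex.I)) * sphCoef w (patchTest p c ξ χ) x‖ₑ := by
    rw [enorm_mul, ← mul_assoc]
    congr 1
    have e2 : (-(2 * Real.pi * (ξ q * (c / 4) : ℝ) * Complex.I)) = (-(ξ q * D : ℝ) * Complex.I) := by
      rw [hD]
      push_cast
      ring
    rw [e2, enorm_mul, enorm_neg]
    simp only [← ofReal_norm, Complex.norm_real, Complex.norm_I, ENNReal.ofReal_one, mul_one]
    have e3 : (Real.toNNReal D⁻¹ : ℝ≥0∞) = ENNReal.ofReal D⁻¹ := rfl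
    rw [e3, ← ENNReal.ofReal_mul (by positivity), norm_mul, Real.norm_of_nonneg hD0.le,
      mul_comm ‖_‖ D, ← mul_assoc, inv_mul_cancel₀ hD0.ne', one_mul,
      ← ENNReal.ofReal_natCast]
    simp
  rw [← mul_pow, e1, mul_pow, hx]
  rw [ENNReal.coe_mul, ENNReal.coe_pow, ENNReal.coe_mul, ENNReal.coe_natCast, ENNReal.coe_ofNat,
    mul_assoc]
  gcongr
  refine (enorm_sum_sq_le _).trans ?_
  rw [Fintype.card_fin, mul_assoc]
  gcongr
  rw [Finset.mul_sum]
  refine Finset.sum_le_sum fun r _ => ?_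
  refine (pow_le_pow_left' enorm_sub_le 2).trans ((add_sq_le_two_mul _ _).trans_eq ?_)
  rw [enorm_neg]

/-- Two powers of `freqSize` are at most a constant times `1 + ∑ |ξ_q| ^ 2`. The term `1` keeps `w`
at weight `t`, and each `|ξ_q| ^ 2` is traded for angular derivatives and new cutoffs. -/
theorem IsPatchCutoff.exists_patchEnergy_succ_le (α a : ℝ) (hc : 0 < c) (k t : ℕ)
    (J : List (Fin (n - 1) × Fin (n - 1))) {χ : Ambient n → ℝ} (h : IsPatchCutoff p s c χ) :
    ∃ K₀ K₁ : ℝ≥0, ∀ (u w : ℝ × USphere n → ℝ)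
      (w' : {q // q ≠ p} → Fin (n - 1) → ℝ × USphere n → ℝ), IsWeakDeriv α a k J u w →
      (∀ (q : {q // q ≠ p}) r, IsWeakDeriv α a k ((r, (q : Fin (n - 1))) :: J) u (w' q r)) →
    patchEnergy a p c (t + 1) w χ ≤ K₀ *
      (patchEnergy a p c t w χ + ∑ q : {q // q ≠ p}, K₁ * ∑ r,
        (patchEnergy a p c t (w' q r) (fun z => z p * z r * χ z) +
          patchEnergy a p c t w
            (_root_.rotField (r, (q : Fin (n - 1))) fun z => z p * z r * χ z))) := by
  obtain ⟨K₁, hK₁⟩ : ∃ K₁ : ℝ≥0, K₁ =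
    Real.toNNReal ((2 * Real.pi * (c / 4))⁻¹) ^ 2 * ((n - 1 : ℕ) * 2) := ⟨_, rfl⟩
  refine ⟨Fintype.card {q // q ≠ p} + 1, K₁, fun u w w' hw hw' => ?_⟩
  simp only [patchEnergy]
  have hsum : ∀ {ι : Type} [Fintype ι] (f : ι → ({q // q ≠ p} → ℤ) → ℝ≥0∞),
      ∑ i, ∑' ξ, f i ξ = ∑' ξ, ∑ i, f i ξ := fun f =>
    (Summable.tsum_finsetSum fun _ _ => ENNReal.summable).symm
  simp only [← ENNReal.tsum_add, hsum, ← ENNReal.tsum_mul_left]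
  refine ENNReal.tsum_le_tsum fun ξ => ?_
  have h1 : (freqSize ξ : ℝ≥0∞) ^ 2 ≤ (Fintype.card {q // q ≠ p} + 1 : ℝ≥0) *
      (1 + ∑ q, ((ξ q).natAbs : ℝ≥0∞) ^ 2) := by
    have := freqSize_sq_le ξ
    exact_mod_cast this
  rw [mul_add 2 t 1, mul_one, pow_add, mul_assoc]
  calc (freqSize ξ : ℝ≥0∞) ^ (2 * t) * ((freqSize ξ : ℝ≥0∞) ^ 2 *
        ∫⁻ x, ‖sphCoef w (patchTest p c ξ χ) x‖ₑ ^ 2 ∂(radialMeasure a)) ≤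
      (freqSize ξ : ℝ≥0∞) ^ (2 * t) * ((Fintype.card {q // q ≠ p} + 1 : ℝ≥0) *
      (1 + ∑ q, ((ξ q).natAbs : ℝ≥0∞) ^ 2) *
        ∫⁻ x, ‖sphCoef w (patchTest p c ξ χ) x‖ₑ ^ 2 ∂(radialMeasure a)) := by gcongr
    _ = (Fintype.card {q // q ≠ p} + 1 : ℝ≥0) * ((freqSize ξ : ℝ≥0∞) ^ (2 * t) *
        (∫⁻ x, ‖sphCoef w (patchTest p c ξ χ) x‖ₑ ^ 2 ∂(radialMeasure a)) +
        ∑ q, (freqSize ξ : ℝ≥0∞) ^ (2 * t) * (((ξ q).natAbs : ℝ≥0∞) ^ 2 *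
          ∫⁻ x, ‖sphCoef w (patchTest p c ξ χ) x‖ₑ ^ 2 ∂(radialMeasure a))) := by
      rw [← Finset.mul_sum, ← Finset.sum_mul]
      ring
    _ ≤ _ := by
      refine mul_le_mul_right (add_le_add le_rfl (Finset.sum_le_sum fun q _ => ?_)) _
      refine (mul_le_mul_right (hw.natAbs_sq_mul_le hc h ξ q (hw' q)) _).trans_eq ?_
      rw [← hK₁, mul_left_comm, Finset.mul_sum]
      simp only [mul_add]

/-- Decay of the coefficients: `t` angular derivatives control the weight of order `t`. -/
theorem IsPatchCutoff.exists_patchEnergy_le (α a : ℝ) (m : ℕ) (hs : s = 1 ∨ s = -1)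
    (hc : 0 < c) (k t : ℕ) (J : List (Fin (n - 1) × Fin (n - 1))) (hm : k + J.length + t ≤ m)
    {χ : Ambient n → ℝ} (h : IsPatchCutoff p s c χ) :
    ∃ C : ℝ≥0, ∀ u : ℝ × USphere n → ℝ, MemTwH α a m u →
      patchEnergy a p c t (weakDeriv α a k J u) χ ≤ C * twNorm α a m u ^ 2 := by
  -- Each step prepends a rotation field to `J` or replaces `χ` by another cutoff for the same
  -- patch, so both must vary.
  induction t generalizing J χ with
  | zero =>
    obtain ⟨C, hC⟩ := h.exists_patchEnergy_zero_le (a := a) hs hc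
    refine ⟨C, fun u hu => (hC _ (hu.isWeakDeriv (by omega)).1).trans ?_⟩
    gcongr
    exact eLpNorm_weakDeriv_le_twNorm u (by omega)
  | succ t ih =>
    have hr : ∀ r, IsPatchCutoff p s c fun z => z p * z r * χ z := fun r =>
      h.smooth_mul (f := fun z => z p * z r) (by fun_prop)
    obtain ⟨C₀, hC₀⟩ := ih J (by omega) h
    choose C₁ hC₁ using fun (q : {q // q ≠ p}) (r : Fin (n - 1)) =>
      ih ((r, (q : Fin (n - 1))) :: J) (by simp only [List.length_cons]; omega) (hr r)
    choose C₂ hC₂ using fun (q : {q // q ≠ p}) (r : Fin (n - 1)) =>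
      ih J (by omega) ((hr r).rotField (r, (q : Fin (n - 1))))
    obtain ⟨K₀, K₁, hK⟩ := h.exists_patchEnergy_succ_le α a hc k t J
    refine ⟨K₀ * (C₀ + ∑ q, K₁ * ∑ r, (C₁ q r + C₂ q r)), fun u hu => ?_⟩
    refine (hK u _ (fun q r => weakDeriv α a k ((r, (q : Fin (n - 1))) :: J) u)
      (hu.isWeakDeriv (by omega)) fun q r => hu.isWeakDeriv
        (by simp only [List.length_cons]; omega)).trans ?_
    rw [ENNReal.coe_mul, ENNReal.coe_add, ENNReal.ofNNReal_finsetSum, mul_assoc, add_mul,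
      Finset.sum_mul]
    refine mul_le_mul_right (add_le_add (hC₀ u hu) (Finset.sum_le_sum fun q _ => ?_)) _
    rw [ENNReal.coe_mul, ENNReal.ofNNReal_finsetSum, mul_assoc, Finset.sum_mul]
    refine mul_le_mul_right (Finset.sum_le_sum fun r _ => ?_) _
    rw [ENNReal.coe_add, add_mul]
    exact add_le_add (hC₁ q r u hu) (hC₂ q r u hu)

end Energy

/-! ### The product estimate for localized factors -/

section Product

variable {n : ℕ} {α a η : ℝ} {p : Fin (n - 1)} {s c : ℝ}

/-- The radial bound is applied to each coefficient and summed with the frequency weight; the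
right-hand side becomes the energies of orders `k` and `k + 1`. The `1` in `hm` is this extra radial
derivative. -/
theorem IsPatchCutoff.exists_weighted_bound (ha : 0 < a) (hα : 0 < α)
    (hη_gt : 1 < α → η = 0) (hη_lt : α < 1 → η = max α (1 - α)) (hη_eq : α = 1 → 0 < η)
    {m : ℕ} (hs : s = 1 ∨ s = -1) (hc : 0 < c) (k t : ℕ)
    (J : List (Fin (n - 1) × Fin (n - 1))) (hm : k + 1 + J.length + t ≤ m)
    {χ : Ambient n → ℝ} (h : IsPatchCutoff p s c χ) :
    ∃ C : ℝ≥0, ∀ u : ℝ × USphere n → ℝ, MemTwH α a m u →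
      ∀ᵐ x ∂(radialMeasure a), ‖x ^ η‖ₑ ^ 2 * ∑' ξ : {q // q ≠ p} → ℤ,
        (freqSize ξ : ℝ≥0∞) ^ (2 * t) *
          ‖sphCoef (weakDeriv α a k J u) (patchTest p c ξ χ) x‖ₑ ^ 2 ≤ C * twNorm α a m u ^ 2 := by
  obtain ⟨D, hD⟩ := exists_bound_sphCoef n ha hα hη_gt hη_lt hη_eq k
  obtain ⟨C₀, hC₀⟩ := h.exists_patchEnergy_le α a m hs hc k t J (by omega)
  obtain ⟨C₁, hC₁⟩ := h.exists_patchEnergy_le α a m hs hc (k + 1) t J hm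
  refine ⟨D * (C₀ + C₁), fun u hu => ?_⟩
  have h1 : ∀ᵐ x ∂(radialMeasure a), ∀ ξ : {q // q ≠ p} → ℤ,
      ‖x ^ η‖ₑ ^ 2 * ‖sphCoef (weakDeriv α a k J u) (patchTest p c ξ χ) x‖ₑ ^ 2 ≤
        D * (∫⁻ x, ‖sphCoef (weakDeriv α a k J u) (patchTest p c ξ χ) x‖ₑ ^ 2
            ∂(radialMeasure a) +
          ∫⁻ x, ‖sphCoef (weakDeriv α a (k + 1) J u) (patchTest p c ξ χ) x‖ₑ ^ 2
            ∂(radialMeasure a)) :=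
    ae_all_iff.2 fun ξ => hD J u _ _ (hu.isWeakDeriv (by omega)) (hu.isWeakDeriv (by omega)) _
      (h.contDiff_patchTest hc ξ) (h.hasCompactSupport_patchTest ξ)
  filter_upwards [h1] with x hx
  calc _ = ∑' ξ : {q // q ≠ p} → ℤ, (freqSize ξ : ℝ≥0∞) ^ (2 * t) * (‖x ^ η‖ₑ ^ 2 *
          ‖sphCoef (weakDeriv α a k J u) (patchTest p c ξ χ) x‖ₑ ^ 2) := by
        rw [← ENNReal.tsum_mul_left]
        exact tsum_congr fun ξ => mul_left_comm _ _ _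
    _ ≤ ∑' ξ : {q // q ≠ p} → ℤ, (freqSize ξ : ℝ≥0∞) ^ (2 * t) *
        (D * (∫⁻ x, ‖sphCoef (weakDeriv α a k J u) (patchTest p c ξ χ) x‖ₑ ^ 2
            ∂(radialMeasure a) +
          ∫⁻ x, ‖sphCoef (weakDeriv α a (k + 1) J u) (patchTest p c ξ χ) x‖ₑ ^ 2
            ∂(radialMeasure a))) :=
      ENNReal.tsum_le_tsum fun ξ => mul_le_mul_right (hx ξ) _
    _ = D * (patchEnergy a p c t (weakDeriv α a k J u) χ +
          patchEnergy a p c t (weakDeriv α a (k + 1) J u) χ) := by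
      rw [patchEnergy, patchEnergy, ← ENNReal.tsum_add, ← ENNReal.tsum_mul_left]
      refine tsum_congr fun ξ => ?_
      rw [mul_left_comm, mul_add]
    _ ≤ D * (C₀ * twNorm α a m u ^ 2 + C₁ * twNorm α a m u ^ 2) :=
      mul_le_mul_right (add_le_add (hC₀ u hu) (hC₁ u hu)) _
    _ = _ := by
      push_cast
      ring

theorem MemTwH.twNorm_ne_top {m : ℕ} {u : ℝ × USphere n → ℝ} (hu : MemTwH α a m u) :
    twNorm α a m u ≠ ⊤ := by
  refine ENNReal.sum_ne_top.2 fun k hk => ENNReal.sum_ne_top.2 fun j hj =>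
    ENNReal.sum_ne_top.2 fun J _ => (hu.isWeakDeriv ?_).1.2.ne
  rw [Finset.mem_range] at hk hj
  rw [List.length_ofFn]
  omega

theorem enorm_rpow_sq_eq_prod {l : ℕ} (i₀ : Fin l) {x : ℝ} (hx : 0 < x) (η : ℝ) :
    ‖x ^ (((l : ℝ) - 1) * η)‖ₑ ^ 2 = ∏ _i ∈ Finset.univ.erase i₀, ‖x ^ η‖ₑ ^ 2 := by
  have hl : 1 ≤ l := by have := i₀.2; omega
  rw [Finset.prod_const, Finset.card_erase_of_mem (Finset.mem_univ _), Finset.card_univ,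
    Fintype.card_fin, mul_comm, Real.rpow_mul hx.le, ← Nat.cast_one, ← Nat.cast_sub hl,
    Real.rpow_natCast, enorm_pow, ← pow_mul, ← pow_mul, mul_comm]

/-- For fixed `x` the spherical product estimate with `M = m - 1` bounds the slice by a product of
weighted coefficient sums. All but one of these sums are bounded in `x` after multiplication by the
square of `x ^ η`, and the last one is integrated. -/
theorem IsPatchCutoff.exists_lintegral_prod_le (ha : 0 < a) (hα : 0 < α)
    (hη_gt : 1 < α → η = 0) (hη_lt : α < 1 → η = max α (1 - α)) (hη_eq : α = 1 → 0 < η)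
    {m : ℕ} (hn : 2 ≤ n) (hnm : n < 2 * m) (hs : s = 1 ∨ s = -1) (hc : 0 < c)
    {l : ℕ} (hl : 1 ≤ l) (k : Fin l → ℕ) (J : Fin l → List (Fin (n - 1) × Fin (n - 1)))
    (hkJ : ∑ i, (k i + (J i).length) ≤ m) {χ : Ambient n → ℝ} (h : IsPatchCutoff p s c χ) :
    ∃ C : ℝ≥0, ∀ u : Fin l → ℝ × USphere n → ℝ, (∀ i, MemTwH α a m (u i)) →
      ∫⁻ z, ‖z.1 ^ (((l : ℝ) - 1) * η)‖ₑ ^ 2 *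
          ∏ i, ‖weakDeriv α a (k i) (J i) (u i) z * χ z.2‖ₑ ^ 2 ∂(patchMeasure n a) ≤
        C * ∏ i, twNorm α a m (u i) ^ 2 := by
  have : Nonempty (Fin l) := ⟨⟨0, hl⟩⟩
  set b : Fin l → ℕ := fun i => k i + (J i).length with hb
  -- The factor of highest order is the one left in `L²` in `x`. Any other factor has order at most
  -- `m - 1`: if it had order `m`, so would this one, and the total would exceed `m` since `m` is
  -- positive.
  obtain ⟨i₀, hi₀⟩ := Finite.exists_max b
  have hle : ∀ i, b i ≤ m := fun i => (Finset.single_le_sum_of_canonicallyOrdered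
    (Finset.mem_univ i)).trans hkJ
  have hsplit : b i₀ + (Finset.univ.erase i₀).sum b ≤ m := by
    rwa [Finset.add_sum_erase _ _ (Finset.mem_univ _)]
  have hpair : ∀ i, i ≠ i₀ → b i ≤ m - 1 := by
    intro i hi
    have h1 : b i ≤ (Finset.univ.erase i₀).sum b :=
      Finset.single_le_sum_of_canonicallyOrdered (Finset.mem_erase.2 ⟨hi, Finset.mem_univ _⟩)
    have := hi₀ i
    omega
  -- The distinguished factor uses no radial derivative for boundedness, so it can afford `m - b i₀`
  -- angular ones; lowering its order by one brings the total within `m - 1`. If `b i₀ = 0`,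
  -- truncated subtraction changes nothing, but then all orders vanish.
  set b' : Fin l → ℕ := Function.update b i₀ (b i₀ - 1) with hb'
  have hb'0 : b' i₀ = b i₀ - 1 := by simp [hb']
  have hb'i : ∀ i, i ≠ i₀ → b' i = b i := fun i hi => by simp [hb', hi]
  have hsum : ∑ i, b' i ≤ m - 1 := by
    rw [← Finset.add_sum_erase _ _ (Finset.mem_univ i₀), hb'0,
      Finset.sum_congr rfl fun i hi => hb'i i (Finset.ne_of_mem_erase hi)]
    change b i₀ - 1 + (Finset.univ.erase i₀).sum b ≤ m - 1
    rcases Nat.eq_zero_or_pos (b i₀) with h0 | h0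
    · have : (Finset.univ.erase i₀).sum b = 0 :=
        Finset.sum_eq_zero fun i _ => Nat.le_zero.1 ((hi₀ i).trans h0.le)
      omega
    · omega
  obtain ⟨C₀, hC₀⟩ := lintegral_prod_patch_le (m := Fin (n - 1)) (p := p) hs hc
    (by rw [Fintype.card_fin]; omega) hsum
  obtain ⟨C₁, hC₁⟩ := h.exists_patchEnergy_le α a m hs hc (k i₀) (m - 1 - b' i₀) (J i₀) (by
    have h1 : b i₀ = k i₀ + (J i₀).length := rfl
    have := hle i₀
    omega)
  -- The bound is claimed only for `i ≠ i₀`; the dummy value at `i₀` allows constants to be chosen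
  -- for all indices at once.
  have hex : ∀ i, ∃ K : ℝ≥0, i ≠ i₀ → ∀ u : ℝ × USphere n → ℝ, MemTwH α a m u →
      ∀ᵐ x ∂(radialMeasure a), ‖x ^ η‖ₑ ^ 2 * ∑' ξ : {q // q ≠ p} → ℤ,
        (freqSize ξ : ℝ≥0∞) ^ (2 * (m - 1 - b' i)) *
          ‖sphCoef (weakDeriv α a (k i) (J i) u) (patchTest p c ξ χ) x‖ₑ ^ 2 ≤
        K * twNorm α a m u ^ 2 := by
    intro i
    by_cases hi : i = i₀
    · exact ⟨0, fun h => absurd hi h⟩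
    · obtain ⟨K, hK⟩ := h.exists_weighted_bound ha hα hη_gt hη_lt hη_eq (m := m) hs hc (k i)
        (m - 1 - b' i) (J i) (by
          have h1 : b i = k i + (J i).length := rfl
          have := hpair i hi
          rw [hb'i i hi]
          omega)
      exact ⟨K, fun _ => hK⟩
  choose K hK using hex
  refine ⟨C₀ * (∏ i ∈ Finset.univ.erase i₀, K i) * C₁, fun u hu => ?_⟩
  set w : Fin l → ℝ × USphere n → ℝ := fun i => weakDeriv α a (k i) (J i) (u i) with hw
  have hwm : ∀ i, MemLp (w i) 2 (patchMeasure n a) := fun i => ((hu i).isWeakDeriv (hle i)).1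
  set A : Fin l → ℝ → ℝ≥0∞ := fun i x => ∑' ξ : {q // q ≠ p} → ℤ,
    (freqSize ξ : ℝ≥0∞) ^ (2 * (m - 1 - b' i)) *
      ‖sphCoef (w i) (patchTest p c ξ χ) x‖ₑ ^ 2 with hA
  have hA0 : ∫⁻ x, A i₀ x ∂(radialMeasure a) ≤ C₁ * twNorm α a m (u i₀) ^ 2 := by
    refine le_trans (le_of_eq ?_) (hC₁ (u i₀) (hu i₀))
    have hm := fun ξ => aemeasurable_enorm_sq_sphCoef hc h (hwm i₀) ξ
    simp only [hA]
    rw [lintegral_tsum fun ξ => (hm ξ).const_mul _, patchEnergy]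
    exact tsum_congr fun ξ => lintegral_const_mul'' _ (hm ξ)
  have hslice : ∀ᵐ x ∂(radialMeasure a), ∫⁻ θ, ∏ i, ‖w i (x, θ) * χ θ‖ₑ ^ 2
      ∂(surfaceMeasure n) ≤ C₀ * ∏ i, A i x := by
    filter_upwards [ae_all_iff.2 fun i => ae_memLp_slice (hwm i)] with x hx
    have h1 := hC₀ (fun i θ => (w i (x, θ) : ℂ) * (χ θ : ℂ)) (fun i => h.memLp_mul (hx i))
      fun i θ hθ => by simp [h.eq_zero_of_notMem hθ]
    simp only [← sphCoef_patchTest] at h1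
    refine le_trans (le_of_eq (lintegral_congr fun θ => Finset.prod_congr rfl fun i _ => ?_)) h1
    rw [← Complex.ofReal_mul]
    simp [enorm_eq_nnnorm]
  have hpos : ∀ᵐ x ∂(radialMeasure a), 0 < x :=
    ae_radialMeasure_iff.2 (ae_of_all _ fun _ hx => hx.1)
  have hF : AEMeasurable (fun z : ℝ × USphere n => ‖z.1 ^ (((l : ℝ) - 1) * η)‖ₑ ^ 2 *
      ∏ i, ‖w i z * χ z.2‖ₑ ^ 2) (patchMeasure n a) := by
    have hχ : AEStronglyMeasurable (fun z : ℝ × USphere n => χ z.2) (patchMeasure n a) :=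
      (h.smooth.continuous.comp (continuous_subtype_val.comp
        continuous_snd)).aestronglyMeasurable
    refine AEMeasurable.mul (by fun_prop) (Finset.aemeasurable_fun_prod _ fun i _ => ?_)
    exact ((hwm i).1.mul hχ).enorm.pow_const 2
  rw [lintegral_patchMeasure hF]
  have hmain : ∀ᵐ x ∂(radialMeasure a), ∫⁻ θ, ‖x ^ (((l : ℝ) - 1) * η)‖ₑ ^ 2 *
      ∏ i, ‖w i (x, θ) * χ θ‖ₑ ^ 2 ∂(surfaceMeasure n) ≤
      (C₀ * ∏ i ∈ Finset.univ.erase i₀, (K i * twNorm α a m (u i) ^ 2)) * A i₀ x := by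
    have hKx : ∀ᵐ x ∂(radialMeasure a), ∀ i, i ≠ i₀ →
        ‖x ^ η‖ₑ ^ 2 * A i x ≤ K i * twNorm α a m (u i) ^ 2 := by
      refine ae_all_iff.2 fun i => ?_
      by_cases hi : i = i₀
      · exact ae_of_all _ fun _ h => absurd hi h
      · filter_upwards [hK i hi (u i) (hu i)] with x hx _ using hx
    filter_upwards [hslice, hpos, hKx] with x h1 h2 h3
    rw [lintegral_const_mul' _ _ (by finiteness)]
    refine (mul_le_mul_right h1 _).trans ?_
    -- The exponent `(l - 1) η` splits into one weight `x ^ η` for each factor other than `i₀`.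
    rw [enorm_rpow_sq_eq_prod i₀ h2, ← Finset.mul_prod_erase _ _ (Finset.mem_univ i₀)]
    calc _ = (C₀ * ∏ i ∈ Finset.univ.erase i₀, (‖x ^ η‖ₑ ^ 2 * A i x)) * A i₀ x := by
          rw [Finset.prod_mul_distrib]
          ring
      _ ≤ _ := by
        refine mul_le_mul_left (mul_le_mul_right (Finset.prod_le_prod' fun i hi => ?_) _) _
        exact h3 i (Finset.ne_of_mem_erase hi)
  refine (lintegral_mono_ae hmain).trans ?_
  have htop : (C₀ * ∏ i ∈ Finset.univ.erase i₀, (K i * twNorm α a m (u i) ^ 2) : ℝ≥0∞) ≠ ⊤ :=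
    ENNReal.mul_ne_top ENNReal.coe_ne_top (ENNReal.prod_ne_top fun i _ =>
      ENNReal.mul_ne_top ENNReal.coe_ne_top (ENNReal.pow_ne_top (hu i).twNorm_ne_top))
  rw [lintegral_const_mul' _ _ htop]
  refine (mul_le_mul_right hA0 _).trans_eq ?_
  rw [← Finset.mul_prod_erase _ (fun i => twNorm α a m (u i) ^ 2) (Finset.mem_univ i₀),
    Finset.prod_mul_distrib]
  push_cast
  ring

end Product

/-! ### Covering the sphere by patches -/

section Cover

variable {n : ℕ} {p : Fin (n - 1)} {s c : ℝ}

/-- A smooth step in `s z_p` rising from `3 / 2 * c` to `2 * c`, times a bump equal to `1` on the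
unit ball. Starting above `c` keeps the closed support in the open region `c < s z_p`. -/
theorem exists_isPatchCutoff (p : Fin (n - 1)) (s : ℝ) (hc : 0 < c) :
    ∃ χ : Ambient n → ℝ, IsPatchCutoff p s c χ ∧
      ∀ z : Ambient n, ‖z‖ ≤ 1 → 2 * c ≤ s * z p → χ z = 1 := by
  let f : ContDiffBump (0 : Ambient n) := ⟨1, 2, one_pos, one_lt_two⟩
  have hcd : ContDiff ℝ ∞ fun z : Ambient n =>
      Real.smoothTransition ((s * z p - 3 / 2 * c) / (c / 2)) :=
    Real.smoothTransition.contDiff.comp (by fun_prop)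
  refine ⟨fun z => Real.smoothTransition ((s * z p - 3 / 2 * c) / (c / 2)) * f z,
    ⟨hcd.mul f.contDiff, f.hasCompactSupport.mul_left, ?_⟩, fun z hz hp => ?_⟩
  · have h1 : tsupport (fun z : Ambient n =>
        Real.smoothTransition ((s * z p - 3 / 2 * c) / (c / 2)) * f z) ⊆
        {z : Ambient n | 3 / 2 * c ≤ s * z p} := by
      refine closure_minimal ?_ (isClosed_le continuous_const (by fun_prop))
      intro z hz
      by_contra hlt
      have hlt' : s * z p < 3 / 2 * c := not_le.1 hlt
      refine hz ?_
      simp only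
      rw [Real.smoothTransition.zero_of_nonpos
        (div_nonpos_of_nonpos_of_nonneg (by linarith) (by linarith)), zero_mul]
    intro z hz
    have h2 : 3 / 2 * c ≤ s * z p := h1 hz
    have : c < s * z p := by linarith
    exact this
  · simp only
    rw [Real.smoothTransition.one_of_one_le, f.one_of_mem_closedBall, one_mul]
    · simpa [f] using hz
    · rw [le_div_iff₀ (by positivity)]
      linarith

theorem exists_le_abs_coord (hn : 2 ≤ n) (θ : USphere n) :
    ∃ p, 1 / ((n - 1 : ℕ) : ℝ) ≤ |(θ : Ambient n) p| := by
  by_contra! hlt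
  have hN : 0 < n - 1 := by omega
  have hN1 : (1 : ℝ) ≤ ((n - 1 : ℕ) : ℝ) := by exact_mod_cast hN
  have h1 : ‖(θ : Ambient n)‖ ^ 2 = 1 := by simp
  rw [EuclideanSpace.norm_sq_eq] at h1
  have h2 : ∑ p, ‖(θ : Ambient n) p‖ ^ 2 < ∑ _p : Fin (n - 1), 1 / ((n - 1 : ℕ) : ℝ) := by
    refine Finset.sum_lt_sum_of_nonempty ⟨⟨0, hN⟩, Finset.mem_univ _⟩ fun p _ => ?_
    have h3 : 1 / ((n - 1 : ℕ) : ℝ) ≤ 1 := by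
      rw [div_le_one (by positivity)]
      exact hN1
    calc ‖(θ : Ambient n) p‖ ^ 2 = |(θ : Ambient n) p| * |(θ : Ambient n) p| := by
          rw [sq, Real.norm_eq_abs]
      _ ≤ |(θ : Ambient n) p| * 1 := by
          gcongr
          exact (hlt p).le.trans h3
      _ < _ := by rw [mul_one]; exact hlt p
  rw [h1, Finset.sum_const, Finset.card_univ, Fintype.card_fin, nsmul_eq_mul,
    mul_one_div_cancel (by positivity)] at h2
  exact lt_irrefl _ h2

theorem exists_cover (hn : 2 ≤ n) :
    ∃ (c : ℝ) (χ : Fin (n - 1) × Bool → Ambient n → ℝ), 0 < c ∧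
      (∀ e, IsPatchCutoff e.1 (if e.2 then 1 else -1) c (χ e)) ∧
      ∀ θ : USphere n, ∃ e, χ e θ = 1 := by
  have hN : (0 : ℝ) < ((n - 1 : ℕ) : ℝ) := by
    have : 0 < n - 1 := by omega
    exact_mod_cast this
  have hc : (0 : ℝ) < 1 / (2 * ((n - 1 : ℕ) : ℝ)) := by positivity
  choose χ hχ hχ1 using fun e : Fin (n - 1) × Bool =>
    exists_isPatchCutoff e.1 (if e.2 then 1 else -1) hc
  refine ⟨_, χ, hc, hχ, fun θ => ?_⟩
  obtain ⟨p, hp⟩ := exists_le_abs_coord hn θ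
  have e1 : 2 * (1 / (2 * ((n - 1 : ℕ) : ℝ))) = 1 / ((n - 1 : ℕ) : ℝ) := by field_simp
  have hθ : ‖(θ : Ambient n)‖ ≤ 1 := by simp
  rcases abs_cases ((θ : Ambient n) p) with ⟨h, _⟩ | ⟨h, _⟩
  · exact ⟨(p, true), hχ1 _ _ hθ (by rw [e1]; simpa [h] using hp)⟩
  · exact ⟨(p, false), hχ1 _ _ hθ (by rw [e1]; simpa [h] using hp)⟩

end Cover

/-! ### Assembling the patches -/

section Final

variable {n : ℕ} {α a η : ℝ}

/-- No partition of unity is needed: at each point some cutoff equals `1`, so the product is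
dominated by the sum of the products in which every factor carries the same cutoff. -/
theorem exists_eLpNorm_prod_weakDeriv_le (ha : 0 < a) (hα : 0 < α)
    (hη_gt : 1 < α → η = 0) (hη_lt : α < 1 → η = max α (1 - α)) (hη_eq : α = 1 → 0 < η)
    {m : ℕ} (hn : 2 ≤ n) (hnm : n < 2 * m) {l : ℕ} (hl : 1 ≤ l) (k : Fin l → ℕ)
    (J : Fin l → List (Fin (n - 1) × Fin (n - 1)))
    (hkJ : ∑ i, (k i + (J i).length) ≤ m) :
    ∃ C : ℝ≥0, ∀ u : Fin l → ℝ × USphere n → ℝ, (∀ i, MemTwH α a m (u i)) →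
      eLpNorm (fun z => z.1 ^ (((l : ℝ) - 1) * η) *
          ∏ i, weakDeriv α a (k i) (J i) (u i) z) 2 (patchMeasure n a) ≤
        C * ∏ i, twNorm α a m (u i) := by
  obtain ⟨c, χ, hc, hχ, hcov⟩ := exists_cover hn
  choose C hC using fun e => (hχ e).exists_lintegral_prod_le ha hα hη_gt hη_lt hη_eq hn hnm
    (by split_ifs <;> simp) hc hl k J hkJ
  have hle : ∀ i, k i + (J i).length ≤ m := fun i =>
    (Finset.single_le_sum_of_canonicallyOrdered (f := fun i => k i + (J i).length)
      (Finset.mem_univ i)).trans hkJ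
  -- The estimate is proved for squares; adding `1` gives `∑ C e ≤ (∑ C e + 1) ^ 2` and avoids a
  -- square root.
  refine ⟨∑ e, C e + 1, fun u hu => ?_⟩
  rw [← ENNReal.pow_le_pow_left_iff two_ne_zero, eLpNorm_two_sq]
  calc ∫⁻ z, ‖z.1 ^ (((l : ℝ) - 1) * η) *
          ∏ i, weakDeriv α a (k i) (J i) (u i) z‖ₑ ^ 2 ∂(patchMeasure n a) ≤
      ∫⁻ z, ∑ e, ‖z.1 ^ (((l : ℝ) - 1) * η)‖ₑ ^ 2 *
          ∏ i, ‖weakDeriv α a (k i) (J i) (u i) z * χ e z.2‖ₑ ^ 2 ∂(patchMeasure n a) := by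
        refine lintegral_mono fun z => ?_
        obtain ⟨e, he⟩ := hcov z.2
        refine le_trans (le_of_eq ?_)
          (Finset.single_le_sum_of_canonicallyOrdered (Finset.mem_univ e))
        simp only [he, mul_one]
        rw [enorm_mul, mul_pow, Finset.prod_pow]
        simp [enorm_eq_nnnorm]
    _ = ∑ e, ∫⁻ z, ‖z.1 ^ (((l : ℝ) - 1) * η)‖ₑ ^ 2 *
          ∏ i, ‖weakDeriv α a (k i) (J i) (u i) z * χ e z.2‖ₑ ^ 2 ∂(patchMeasure n a) := by
        refine lintegral_finsetSum' _ fun e _ => ?_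
        have h1 : AEStronglyMeasurable (fun z : ℝ × USphere n => χ e z.2) (patchMeasure n a) :=
          ((hχ e).smooth.continuous.comp (continuous_subtype_val.comp
            continuous_snd)).aestronglyMeasurable
        refine AEMeasurable.mul (by fun_prop) (Finset.aemeasurable_fun_prod _ fun i _ => ?_)
        exact (((hu i).isWeakDeriv (hle i)).1.1.mul h1).enorm.pow_const 2
    _ ≤ ∑ e, C e * ∏ i, twNorm α a m (u i) ^ 2 := Finset.sum_le_sum fun e _ => hC e u hu
    _ ≤ _ := by
        rw [← Finset.sum_mul, Finset.prod_pow, mul_pow, ← ENNReal.ofNNReal_finsetSum]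
        refine mul_le_mul_left ?_ _
        have h1 : ∑ e, C e ≤ (∑ e, C e + 1) ^ 2 := by
          nlinarith [zero_le (a := ∑ e, C e)]
        exact_mod_cast h1

end Final

end

theorem propositionP (n : ℕ) (hn : 2 ≤ n) (α a : ℝ) (hα : 0 < α) (ha : 0 < a)
    (m : ℕ) (hm : (n : ℝ) / 2 < (m : ℝ))
    (l : ℕ) (hl : 1 ≤ l) (j k : Fin l → ℕ) (hjk : ∑ i, j i + ∑ i, k i ≤ m)
    (η : ℝ) (hη_gt : 1 < α → η = 0) (hη_lt : α < 1 → η = max α (1 - α))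
    (hη_eq : α = 1 → 0 < η) :
    ∃ C : ℝ≥0, ∀ u : Fin l → ℝ × USphere n → ℝ, (∀ i, MemTwH α a m (u i)) →
      ∀ J : (i : Fin l) → Fin (j i) → Fin (n - 1) × Fin (n - 1),
        eLpNorm (fun z => z.1 ^ (((l : ℝ) - 1) * η) *
            ∏ i, weakDeriv α a (k i) (List.ofFn (J i)) (u i) z) 2 (patchMeasure n a) ≤
          (C : ℝ≥0∞) * ∏ i, twNorm α a m (u i) := by
  have hnm : n < 2 * m := by
    have : (n : ℝ) < 2 * m := by linarith
    exact_mod_cast this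
  -- There are finitely many choices of angular components, so the sum of their constants is uniform
  -- in `J`.
  choose C hC using fun J : (i : Fin l) → Fin (j i) → Fin (n - 1) × Fin (n - 1) =>
    exists_eLpNorm_prod_weakDeriv_le ha hα hη_gt hη_lt hη_eq hn hnm hl k
      (fun i => List.ofFn (J i)) (by
        simp only [List.length_ofFn, Finset.sum_add_distrib]
        omega)
  refine ⟨∑ J, C J, fun u hu J => (hC J u hu).trans ?_⟩
  gcongr
  exact Finset.single_le_sum_of_canonicallyOrdered (Finset.mem_univ J)
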